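/- All forests are ordered and have node labels in an alphabet $\{0,\dots,\sigma-1\}$; $|F|$ is the number of nodes of $F$ and $+$ is concatenation from left to right. Removing a node makes its children, in order, children of its parent (or roots, if it was a root). The edit distance $\mathrm{ed}(F,F')$ is the least total number of relabelings and removals of single nodes, applied to $F$ and to $F'$, that make the two forests identical, and $\mathrm{sim}(F,F')=|F|+|F'|-\mathrm{ed}(F,F')$. The bi-order traversal sequence of $T$ lists every node of $T$ when it is entered and when it is left in the left-to-right depth-first traversal; for $1\le i\le j\le 2|T|+1$, $T[i,j)$ is $T$ with all nodes removed that occur among the entries $1,\dots,i-1$ or $j,\dots,2|T|$ of this sequence. The similarity matrix $S(F)=S(F,T)$ is the $(2|T|+1)\times(2|T|+1)$ matrix with entries $\mathrm{sim}(F,T[i,j))$ if $i\le j$ and $-\infty$ if $i>j$. "Computing" a family of matrices in time $t$ means: a deterministic word RAM builds, in at most $t$ steps, a data structure from which each of the following range queries on each matrix $A$ of the family is answered in $\tilde O(1)$ steps: the entry $A_{ij}$; $\mathrm{mincol}(A,i,x)=\min\{j: A_{ij}\ge x\}$; $\mathrm{maxrow}(A,j,x)=\max\{i: A_{ij}\ge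 x\}$, where $x$ is $-\infty$ or a natural number (any index is a correct answer if there is no such $j$ or $i$). The notation $\tilde O$ hides factors polylogarithmic in $k+|F_1+\dots+F_k|+|T_2|$; the word length is at least a constant times the logarithm of this number, and symbols of the alphabet fit into words. Corollary. Let $F_1,\dots,F_k$ ($k\ge1$) be a sequence of forests and $T_2$ a tree. For $1\le l\le k$ let $G_l=F_1+\dots+F_l$ and let $S(\cdot)=S(\cdot,T_2)$. Then the similarity matrices $S(G_1),\dots,S(G_k)$ can be computed together in $\tilde O(k+|G_k|^2|T_2|)$ time. In particular, if no $F_i$ is empty, the time is $\tilde O(|G_k|^2|T_2|)$, since then $k\le|G_k|$. The same holds for the matrices $S(F_l+\dots+F_k)$, $1\le l\le k$, of the suffix concatenations. -/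

import Mathlib

namespace TED

/-! ### Ordered labelled forests -/

/-- Ordered forests with node labels in `α`.  `cons a c s` is the forest whose leftmost tree has a
root labelled `a` with `c` as the (ordered) forest of the subtrees of its children, and whose
remaining trees, from left to right, form the forest `s`. -/
inductive Forest (α : Type*) where
  | nil : Forest α
  | cons (a : α) (c s : Forest α) : Forest α

namespace Forest

variable {α β : Type*}

/-- The number of nodes. -/
def size : Forest α → ℕ
  | nil => 0
  | cons _ c s => c.size + s.size + 1

/-- Concatenation of two forests, from left to right. -/
def append : Forest α → Forest α → Forest α
  | nil, G => G
  | cons a c s, G => cons a c (s.append G)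

instance : Add (Forest α) := ⟨append⟩

/-- Concatenation of a sequence of forests, from left to right. -/
def sum : List (Forest α) → Forest α
  | [] => nil
  | F :: Fs => F + sum Fs

/-- A forest that consists of exactly one tree. -/
def IsTree (F : Forest α) : Prop := ∃ a c, F = cons a c nil

/-- Change all labels by `f`. -/
def map (f : α → β) : Forest α → Forest β
  | nil => nil
  | cons a c s => cons (f a) (c.map f) (s.map f)

/-- Remove all nodes whose label does not satisfy `p`: the children of a removed node become
children of its parent (or roots, if it was a root), in the same order. -/
def keep (p : α → Prop) [DecidablePred p] : Forest α → Forest α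
  | nil => nil
  | cons a c s => if p a then cons a (c.keep p) (s.keep p) else c.keep p + s.keep p

/-- Label every node additionally with its number in left-to-right preorder, starting at `n`; this
gives every node an identity. -/
def number : ℕ → Forest α → Forest (α × ℕ)
  | _, nil => nil
  | n, cons a c s => cons (a, n) (c.number (n + 1)) (s.number (n + 1 + c.size))

/-- The bi-order traversal sequence: every node is listed when it is entered and when it is left in
the depth-first traversal from left to right. -/
def biorder : Forest α → List α
  | nil => []
  | cons a c s => a :: (c.biorder ++ a :: s.biorder)

/-- The subforest `F[l, r)`, for `1 ≤ l ≤ r ≤ 2 |F| + 1`: remove all nodes that appear among the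
entries `1, …, l - 1` or among the entries `r, …, 2 |F|` of the bi-order traversal sequence. -/
def subforest [DecidableEq α] (F : Forest α) (l r : ℕ) : Forest α :=
  ((F.number 0).keep fun v =>
    v ∉ (F.number 0).biorder.take (l - 1) ∧ v ∉ (F.number 0).biorder.drop (r - 1)).map Prod.fst

/-! ### Edit distance and similarity -/

/-- `EditStep F G`: one relabeling or one deletion of a node turns `F` into `G`. -/
inductive EditStep : Forest α → Forest α → Prop
  | relabel (a b : α) (c s : Forest α) : a ≠ b → EditStep (cons a c s) (cons b c s)
  | delete (a : α) (c s : Forest α) : EditStep (cons a c s) (c + s)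
  | inside (a : α) (c c' s : Forest α) : EditStep c c' → EditStep (cons a c s) (cons a c' s)
  | right (a : α) (c s s' : Forest α) : EditStep s s' → EditStep (cons a c s) (cons a c s')

/-- `Edits n F G`: some sequence of exactly `n` operations turns `F` into `G`. -/
def Edits : ℕ → Forest α → Forest α → Prop
  | 0, F, G => F = G
  | n + 1, F, G => ∃ H, EditStep F H ∧ Edits n H G

/-- The tree edit distance: the minimum total number of operations on `F` and on `G` that make the
two forests identical. -/
noncomputable def ed (F G : Forest α) : ℕ :=
  sInf {n | ∃ p q H, n = p + q ∧ Edits p F H ∧ Edits q G H}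

/-- The similarity. -/
noncomputable def sim (F G : Forest α) : ℤ := (F.size : ℤ) + G.size - ed F G

/-- The similarity matrix `S(F, T)`.  Its rows and columns are numbered `1, …, 2 |T| + 1`; the
element `i` of `Fin (2 |T| + 1)` stands for the number `i + 1`; the value `⊥` stands for `-∞`. -/
noncomputable def simMatrix [DecidableEq α] (F T : Forest α) :
    Matrix (Fin (2 * T.size + 1)) (Fin (2 * T.size + 1)) (WithBot ℤ) :=
  fun i j => if i ≤ j then ((sim F (T.subforest (i + 1) (j + 1)) : ℤ) : WithBot ℤ) else ⊥

/-- The prefix sum `F_1 + ⋯ + F_l`. -/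
def prefixSum (Fs : List (Forest α)) (l : ℕ) : Forest α := sum (Fs.take l)

/-- The suffix sum `F_l + ⋯ + F_k`, for `1 ≤ l ≤ k`. -/
def suffixSum (Fs : List (Forest α)) (l : ℕ) : Forest α := sum (Fs.drop (l - 1))

end Forest

/-! ### Range queries on a matrix -/

/-- `j` is a correct answer to the query `mincol(A, i, x)`: the least `j` with `x ≤ A i j`; any
column if there is none. -/
def IsMinCol {N : ℕ} (A : Matrix (Fin N) (Fin N) (WithBot ℤ)) (i : Fin N) (x : WithBot ℤ)
    (j : Fin N) : Prop :=
  (∃ j', x ≤ A i j') → IsLeast {j' | x ≤ A i j'} j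

/-- `i` is a correct answer to the query `maxrow(A, j, x)`: the greatest `i` with `x ≤ A i j`; any
row if there is none. -/
def IsMaxRow {N : ℕ} (A : Matrix (Fin N) (Fin N) (WithBot ℤ)) (j : Fin N) (x : WithBot ℤ)
    (i : Fin N) : Prop :=
  (∃ i', x ≤ A i' j) → IsGreatest {i' | x ≤ A i' j} i

/-! ### The word RAM

Words have `w` bits.  A machine has registers and a memory of `2 ^ w` words that is addressed by
words.  A program is a fixed finite text that does not depend on `w` (and so uses a fixed finite
number of registers). -/

/-- Arithmetic on words: addition, subtraction and multiplication modulo `2 ^ w`, and the rounded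
quotient. -/
inductive Arith where
  | add | sub | mul | div

/-- The value of an arithmetic operation. -/
def Arith.eval {w : ℕ} : Arith → BitVec w → BitVec w → BitVec w
  | add, x, y => x + y
  | sub, x, y => x - y
  | mul, x, y => x * y
  | div, x, y => x / y

/-- Programs.  The numbers `r`, `a`, `b` are names of registers. -/
inductive Program where
  | skip : Program
  /-- `r := n` -/
  | const (r n : ℕ) : Program
  /-- `r := a o b` -/
  | arith (o : Arith) (r a b : ℕ) : Program
  /-- `r := mem[a]` -/
  | load (r a : ℕ) : Program
  /-- `mem[a] := b` -/
  | store (a b : ℕ) : Program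
  /-- first `p`, then `q` -/
  | seq (p q : Program) : Program
  /-- if `a < b` then `p` else `q` -/
  | ite (a b : ℕ) (p q : Program) : Program
  /-- while `a < b` do `p` -/
  | while (a b : ℕ) (p : Program) : Program

/-- The state of a machine with words of `w` bits. -/
@[ext] structure State (w : ℕ) where
  reg : ℕ → BitVec w
  mem : BitVec w → BitVec w

namespace State

variable {w : ℕ}

/-- Write `v` to register `r`. -/
def setReg (s : State w) (r : ℕ) (v : BitVec w) : State w :=
  { s with reg := Function.update s.reg r v }

/-- Write `v` to the memory cell with address `a`. -/
def setMem (s : State w) (a v : BitVec w) : State w :=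
  { s with mem := Function.update s.mem a v }

end State

open Program in
/-- `Runs p s t s'`: the program `p`, started in the state `s`, halts in the state `s'` after `t`
steps.  Every elementary instruction and every evaluation of a condition is one step. -/
inductive Runs {w : ℕ} : Program → State w → ℕ → State w → Prop
  | skip (s) : Runs skip s 1 s
  | const (r n) (s) : Runs (const r n) s 1 (s.setReg r (BitVec.ofNat w n))
  | arith (o r a b) (s) : Runs (arith o r a b) s 1 (s.setReg r (o.eval (s.reg a) (s.reg b)))
  | load (r a) (s) : Runs (load r a) s 1 (s.setReg r (s.mem (s.reg a)))
  | store (a b) (s) : Runs (store a b) s 1 (s.setMem (s.reg a) (s.reg b))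
  | seq {p q s t s' t' s''} : Runs p s t s' → Runs q s' t' s'' → Runs (seq p q) s (t + t') s''
  | ite_true {a b p q s t s'} : s.reg a < s.reg b → Runs p s t s' → Runs (ite a b p q) s (t + 1) s'
  | ite_false {a b p q s t s'} : ¬ s.reg a < s.reg b → Runs q s t s' →
      Runs (ite a b p q) s (t + 1) s'
  | while_true {a b p s t s' t' s''} : s.reg a < s.reg b → Runs p s t s' →
      Runs (.while a b p) s' t' s'' → Runs (.while a b p) s (t + t' + 1) s''
  | while_false {a b p s} : ¬ s.reg a < s.reg b → Runs (.while a b p) s 1 s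

/-! ### Input and output -/

/-- A forest as a list of numbers, in the order of the bi-order traversal: entering a node with
label `a` is written `a + 1`, leaving a node is written `0`. -/
def encodeForest {σ : ℕ} : Forest (Fin σ) → List ℕ
  | .nil => []
  | .cons a c s => ((a : ℕ) + 1) :: (encodeForest c ++ 0 :: encodeForest s)

/-- The input: the number `k` of forests, the size of `T`, the tree `T`, and then every one of the
forests `F_1, …, F_k`, preceded by its size. -/
def encodeInput {σ : ℕ} (Fs : List (Forest (Fin σ))) (T : Forest (Fin σ)) : List ℕ :=
  Fs.length :: T.size :: (encodeForest T ++ Fs.flatMap fun F => F.size :: encodeForest F)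

/-- The initial state: the input is in the first memory cells, all else is `0`. -/
def initial (w : ℕ) (input : List ℕ) : State w where
  reg _ := 0
  mem a := BitVec.ofNat w (input.getD a.toNat 0)

/-- The element of `ℕ ∪ {-∞}` that a word stands for: `0` stands for `-∞`, and `n + 1` stands
for `n`. -/
def decodeValue {w : ℕ} (v : BitVec w) : WithBot ℤ :=
  if v.toNat = 0 then ⊥ else (((v.toNat : ℤ) - 1 : ℤ) : WithBot ℤ)

/-- The word that stands for a row or column, numbered from `1`. -/
def indexWord (w : ℕ) {N : ℕ} (i : Fin N) : BitVec w := BitVec.ofNat w (i + 1)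

/-- The program `q`, started with memory contents `mem` and with the three arguments `x`, `y`, `z`
in the registers `0`, `1`, `2` (and anything in the other registers), halts after at most `τ` steps
with an answer in register `0` that satisfies `ok`, and has not changed the memory. -/
def Answers {w : ℕ} (q : Program) (mem : BitVec w → BitVec w) (τ : ℕ) (x y z : BitVec w)
    (ok : BitVec w → Prop) : Prop :=
  ∀ s : State w, s.mem = mem → s.reg 0 = x → s.reg 1 = y → s.reg 2 = z →
    ∃ t s', Runs q s t s' ∧ t ≤ τ ∧ s'.mem = mem ∧ ok (s'.reg 0)

/-- The memory contents `mem` represent the matrices `A 1, …, A k`: the three query programs answer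
all range queries on these matrices in at most `τ` steps per query.  The arguments of a query are
the number `l` of the matrix and the two arguments of the range query. -/
def Represents {w N : ℕ} (entry mincol maxrow : Program) (τ : ℕ) (mem : BitVec w → BitVec w)
    (k : ℕ) (A : ℕ → Matrix (Fin N) (Fin N) (WithBot ℤ)) : Prop :=
  ∀ l, 1 ≤ l → l ≤ k →
    (∀ i j, Answers entry mem τ (BitVec.ofNat w l) (indexWord w i) (indexWord w j)
      fun v => decodeValue v = A l i j) ∧
    (∀ i x, Answers mincol mem τ (BitVec.ofNat w l) (indexWord w i) x
      fun v => ∃ j, v = indexWord w j ∧ IsMinCol (A l) i (decodeValue x) j) ∧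
    (∀ j x, Answers maxrow mem τ (BitVec.ofNat w l) (indexWord w j) x
      fun v => ∃ i, v = indexWord w i ∧ IsMaxRow (A l) j (decodeValue x) i)

/-- `K (1 + log N) ^ K`, the factor that is hidden in the notation `Õ`. -/
def polylog (K N : ℕ) : ℕ := K * (1 + Nat.log 2 N) ^ K

/-- There is an algorithm that computes, for all sequences `F_1, …, F_k` (`k ≥ 1`) of forests and
all trees `T`, the similarity matrices with respect to `T` of all the forests `H Fs 1, …, H Fs k` in
time `Õ(k + |F_1 + ⋯ + F_k| ^ 2 |T|)`; that is, after this time all range queries on any of these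
matrices can be answered in time `Õ(1)` each.

The programs and the constant `K` are fixed first.  With `n = |F_1 + ⋯ + F_k|`, the word length `w`
is any that is at least `K log (k + n + |T|)` and for which the symbols of the alphabet
`{0, …, σ - 1}` fit into words. -/
def SimMatricesComputable
    (H : ∀ {α : Type}, List (Forest α) → ℕ → Forest α) : Prop :=
  ∃ (build entry mincol maxrow : Program) (K : ℕ),
    ∀ (σ w : ℕ) (Fs : List (Forest (Fin σ))) (T : Forest (Fin σ)),
      Fs ≠ [] → T.IsTree →
      let k := Fs.length
      let n := (Forest.sum Fs).size
      let N := k + n + T.size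
      σ < 2 ^ w → N ^ K ≤ 2 ^ w →
      ∃ (t : ℕ) (s : State w),
        Runs build (initial w (encodeInput Fs T)) t s ∧
        t ≤ polylog K N * (k + n ^ 2 * T.size) ∧
        Represents entry mincol maxrow (polylog K N) s.mem k fun l => (H Fs l).simMatrix T

end TED

/-!
The matrices are not stored.  Fix the tree `T`, and for a forest `F`, a row `i` and a number `x` let
`tab T F i x` be the least column `j` in which the similarity matrix of `F` has an entry `≥ x`.  The
similarity of `F` with anything is at most `2 |F|`, so this table has only `O(|F| |T|)` entries, and
by `le_simMatrix_iff` it determines the matrix: `mincol` is a look into the table, and the other two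
queries are binary searches, since the entries of the matrix increase with the column and decrease
with the row.

By `le_sim_iff`, similarities obey a recursion on `F` alone (`Fits`): the first root is removed, or
it is matched to a node of `T`.  To prove it, an optimal pair of edit sequences is normalized: edit
sequences amount to embeddings (`Emb`), the relabelings are moved to the side of `F`, so that only
removals (`Sub`) are left on the side of `T`, and the forests that arise by removals from `T[i, j)`
are those that occur (`Occ`) at nodes with all positions in `[i, j)`.  For the tables the recursion
has two consequences.

* The matrix of `F + G` is a max-plus product, `tab (F + G) i x = min_y tab G (tab F i y) (x - y)`
  (`tab_add_le_iff`).  The number of relevant `y` is `O(min |F| |G|)`, so the table is computed in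
  time `O((|F| + 1) (|G| + 1) |T|)` (`wp_concat`).
* The table of a tree arises from that of the forest below its root in time proportional to its size
  (`tab_tree_le_iff`, `wp_tree`): in row `i`, either the root is not matched to the node of `T` that
  is entered at `i`, or it is.

A forest is read from left to right with a stack, and a product is computed whenever a node is left.
The products of sizes that occur add up to `O(|F|²)`, since pairs of nodes are not counted twice
(`costs_tokens_le`, `wp_scan`).  In the same way the products for the prefix or suffix sums
add up to `O(|F_1 + ⋯ + F_k|²)` (`wp_addForest`, `wp_build`); all of their tables are kept.

The programs are written in a small imperative language over the natural numbers, which is compiled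
to the word RAM, and they are verified with a program logic (`Wp`) in which the states carry a
counter of the steps.  The word length guarantees that no arithmetic operation overflows.
-/

namespace TED

namespace Forest

variable {α : Type*}

/-! ### Forests and edit sequences -/

@[simp] theorem nil_add (G : Forest α) : nil + G = G := rfl

@[simp] theorem cons_add (a : α) (c s G : Forest α) : cons a c s + G = cons a c (s + G) := rfl

@[simp] theorem add_nil (F : Forest α) : F + nil = F := by
  induction F with
  | nil => rfl
  | cons a c s _ ih => rw [cons_add, ih]

theorem add_assoc (F G H : Forest α) : F + G + H = F + (G + H) := by
  induction F with
  | nil => rfl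
  | cons a c s _ ih => rw [cons_add, cons_add, cons_add, ih]

@[simp] theorem size_nil : (nil : Forest α).size = 0 := rfl

@[simp] theorem size_cons (a : α) (c s : Forest α) :
    (cons a c s).size = c.size + s.size + 1 := rfl

@[simp] theorem size_add (F G : Forest α) : (F + G).size = F.size + G.size := by
  induction F with
  | nil => simp
  | cons a c s _ ih => simp [ih]; omega

/-- `Emb F H d`: `H` arises from `F` by removals and relabelings of total cost at most `d`.  In
contrast to a sequence of edit operations, this is defined by recursion on `F`. -/
inductive Emb : Forest α → Forest α → ℕ → Prop
  | nil : Emb nil nil 0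
  | keep {a b : α} {c c' s s' : Forest α} {m n d : ℕ} (h : a = b ∨ 1 ≤ d) :
      Emb c c' m → Emb s s' n → Emb (cons a c s) (cons b c' s') (m + n + d)
  | drop {a : α} {c c' s s' : Forest α} {m n : ℕ} :
      Emb c c' m → Emb s s' n → Emb (cons a c s) (c' + s') (m + n + 1)

/-- `Sub F H`: `H` arises from `F` by removals only. -/
inductive Sub : Forest α → Forest α → Prop
  | nil : Sub nil nil
  | keep {a : α} {c c' s s' : Forest α} :
      Sub c c' → Sub s s' → Sub (cons a c s) (cons a c' s')
  | drop {a : α} {c c' s s' : Forest α} : Sub c c' → Sub s s' → Sub (cons a c s) (c' + s')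

theorem Emb.refl (F : Forest α) : Emb F F 0 := by
  induction F with
  | nil => exact .nil
  | cons a c s ihc ihs => exact .keep (d := 0) (.inl rfl) ihc ihs

theorem Emb.append {F F' G G' : Forest α} {m n : ℕ} (h : Emb F F' m) (hG : Emb G G' n) :
    Emb (F + G) (F' + G') (m + n) := by
  induction h with
  | nil => simpa using hG
  | keep h hc _ _ ihs =>
    rw [Nat.add_right_comm _ _ n, Nat.add_assoc _ _ n]
    exact .keep h hc ihs
  | drop hc _ _ ihs =>
    rw [add_assoc, Nat.add_right_comm _ _ n, Nat.add_assoc _ _ n]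
    exact .drop hc ihs

theorem Emb.split {F G H : Forest α} {n : ℕ} (h : Emb (F + G) H n) :
    ∃ H₁ H₂ n₁ n₂, H = H₁ + H₂ ∧ n = n₁ + n₂ ∧ Emb F H₁ n₁ ∧ Emb G H₂ n₂ := by
  induction F generalizing H n with
  | nil => exact ⟨Forest.nil, H, 0, n, rfl, by omega, .nil, h⟩
  | cons a c s _ ihs =>
    rw [cons_add] at h
    cases h with
    | keep hd hc hs =>
      obtain ⟨H₁, H₂, n₁, n₂, rfl, rfl, h₁, h₂⟩ := ihs hs
      exact ⟨_, H₂, _, n₂, (cons_add _ _ _ _).symm, by omega, .keep hd hc h₁, h₂⟩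
    | drop hc hs =>
      obtain ⟨H₁, H₂, n₁, n₂, rfl, rfl, h₁, h₂⟩ := ihs hs
      exact ⟨_, H₂, _, n₂, (add_assoc _ _ _).symm, by omega, .drop hc h₁, h₂⟩

theorem Emb.trans {F G H : Forest α} {m n : ℕ} (h : Emb F G m) (hG : Emb G H n) :
    ∃ d ≤ m + n, Emb F H d := by
  induction h generalizing H n with
  | nil => exact ⟨n, by omega, hG⟩
  | @keep _ _ _ _ _ _ _ _ d hd _ _ ihc ihs =>
    cases hG with
    | @keep _ _ _ _ _ _ _ _ d' hd' hc' hs' =>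
      obtain ⟨d₁, hd₁, h₁⟩ := ihc hc'
      obtain ⟨d₂, hd₂, h₂⟩ := ihs hs'
      refine ⟨d₁ + d₂ + (d + d'), by omega, .keep ?_ h₁ h₂⟩
      rcases hd with rfl | hd
      · exact hd'.imp id (by omega)
      · exact .inr (by omega)
    | drop hc' hs' =>
      obtain ⟨d₁, hd₁, h₁⟩ := ihc hc'
      obtain ⟨d₂, hd₂, h₂⟩ := ihs hs'
      exact ⟨_, by omega, .drop h₁ h₂⟩
  | drop _ _ ihc ihs =>
    obtain ⟨H₁, H₂, n₁, n₂, rfl, rfl, hc', hs'⟩ := hG.split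
    obtain ⟨d₁, hd₁, h₁⟩ := ihc hc'
    obtain ⟨d₂, hd₂, h₂⟩ := ihs hs'
    exact ⟨_, by omega, .drop h₁ h₂⟩

theorem EditStep.emb {F G : Forest α} (h : EditStep F G) : Emb F G 1 := by
  induction h with
  | relabel a b c s _ => exact .keep (d := 1) (.inr le_rfl) (.refl c) (.refl s)
  | delete a c s => exact .drop (.refl c) (.refl s)
  | inside a c c' s _ ih => exact .keep (d := 0) (.inl rfl) ih (.refl s)
  | right a c s s' _ ih => exact .keep (d := 0) (.inl rfl) (.refl c) ih

theorem Edits.emb {n : ℕ} {F G : Forest α} (h : Edits n F G) : ∃ d ≤ n, Emb F G d := by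
  induction n generalizing F with
  | zero =>
    obtain rfl : F = G := h
    exact ⟨0, le_rfl, .refl F⟩
  | succ n ih =>
    obtain ⟨H, h₁, h₂⟩ := h
    obtain ⟨d, hd, h₂⟩ := ih h₂
    obtain ⟨d', hd', h'⟩ := h₁.emb.trans h₂
    exact ⟨d', by omega, h'⟩

theorem Edits.trans {m n : ℕ} {F G H : Forest α} (h : Edits m F G) (hG : Edits n G H) :
    Edits (m + n) F H := by
  induction m generalizing F with
  | zero => cases h; simpa using hG
  | succ m ih =>
    obtain ⟨F', h₁, h₂⟩ := h
    rw [Nat.succ_add]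
    exact ⟨F', h₁, ih h₂⟩

theorem Edits.inside {n : ℕ} {c c' : Forest α} (h : Edits n c c') (a : α) (s : Forest α) :
    Edits n (cons a c s) (cons a c' s) := by
  induction n generalizing c with
  | zero => cases h; rfl
  | succ n ih =>
    obtain ⟨H, h₁, h₂⟩ := h
    exact ⟨_, .inside a c H s h₁, ih h₂⟩

theorem Edits.right {n : ℕ} {s s' : Forest α} (h : Edits n s s') (a : α) (c : Forest α) :
    Edits n (cons a c s) (cons a c s') := by
  induction n generalizing s with
  | zero => cases h; rfl
  | succ n ih =>
    obtain ⟨H, h₁, h₂⟩ := h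
    exact ⟨_, .right a c s H h₁, ih h₂⟩

theorem Emb.edits {F G : Forest α} {n : ℕ} (h : Emb F G n) : ∃ k ≤ n, Edits k F G := by
  induction h with
  | nil => exact ⟨0, le_rfl, rfl⟩
  | @keep a b c c' s s' m n d hd _ _ ihc ihs =>
    obtain ⟨k₁, hk₁, h₁⟩ := ihc
    obtain ⟨k₂, hk₂, h₂⟩ := ihs
    have h := (h₁.inside a s).trans (h₂.right a c')
    by_cases hab : a = b
    · subst hab
      exact ⟨_, by omega, h⟩
    · exact ⟨k₁ + k₂ + 1, by have := hd.resolve_left hab; omega,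
        h.trans (n := 1) ⟨_, .relabel a b c' s' hab, rfl⟩⟩
  | @drop a c c' s s' m n _ _ ihc ihs =>
    obtain ⟨k₁, hk₁, h₁⟩ := ihc
    obtain ⟨k₂, hk₂, h₂⟩ := ihs
    exact ⟨k₁ + k₂ + 1, by omega, ((h₁.inside a s).trans (h₂.right a c')).trans (n := 1)
      ⟨_, .delete a c' s', rfl⟩⟩

theorem emb_nil (F : Forest α) : Emb F nil F.size := by
  induction F with
  | nil => exact .nil
  | cons a c s ihc ihs => exact .drop ihc ihs

theorem ed_le {F G H : Forest α} {p q : ℕ} (hF : Emb F H p) (hG : Emb G H q) :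
    ed F G ≤ p + q := by
  obtain ⟨p', hp, hF⟩ := hF.edits
  obtain ⟨q', hq, hG⟩ := hG.edits
  have : ed F G ≤ p' + q' := Nat.sInf_le ⟨p', q', H, rfl, hF, hG⟩
  omega

theorem exists_emb (F G : Forest α) :
    ∃ p q H, p + q ≤ ed F G ∧ Emb F H p ∧ Emb G H q := by
  have hne : {n | ∃ p q H, n = p + q ∧ Edits p F H ∧ Edits q G H}.Nonempty := by
    obtain ⟨p, _, hp⟩ := (emb_nil F).edits
    obtain ⟨q, _, hq⟩ := (emb_nil G).edits
    exact ⟨_, p, q, nil, rfl, hp, hq⟩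
  obtain ⟨p, q, H, h, hF, hG⟩ := Nat.sInf_mem hne
  obtain ⟨p', hp, hF⟩ := hF.emb
  obtain ⟨q', hq, hG⟩ := hG.emb
  exact ⟨p', q', H, by unfold ed; omega, hF, hG⟩

/-- Relabelings can be moved to the other side of a common forest. -/
theorem Emb.exists_sub {G H : Forest α} {q : ℕ} (h : Emb G H q) :
    ∃ G' e, Sub G G' ∧ Emb H G' e ∧ G.size + e ≤ q + G'.size := by
  induction h with
  | nil => exact ⟨Forest.nil, 0, .nil, .nil, by simp⟩
  | keep hd _ _ ihc ihs =>
    obtain ⟨c', m, h₁, h₁', e₁⟩ := ihc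
    obtain ⟨s', n, h₂, h₂', e₂⟩ := ihs
    exact ⟨_, _, .keep h₁ h₂, .keep (hd.imp Eq.symm id) h₁' h₂', by simp; omega⟩
  | drop _ _ ihc ihs =>
    obtain ⟨c', m, h₁, h₁', e₁⟩ := ihc
    obtain ⟨s', n, h₂, h₂', e₂⟩ := ihs
    exact ⟨_, _, .drop h₁ h₂, h₁'.append h₂', by simp; omega⟩

theorem Sub.emb {G H : Forest α} (h : Sub G H) : ∃ q, Emb G H q ∧ q + H.size = G.size := by
  induction h with
  | nil => exact ⟨0, .nil, rfl⟩
  | keep _ _ ihc ihs =>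
    obtain ⟨m, h₁, e₁⟩ := ihc
    obtain ⟨n, h₂, e₂⟩ := ihs
    exact ⟨_, .keep (d := 0) (.inl rfl) h₁ h₂, by simp; omega⟩
  | drop _ _ ihc ihs =>
    obtain ⟨m, h₁, e₁⟩ := ihc
    obtain ⟨n, h₂, e₂⟩ := ihs
    exact ⟨_, .drop h₁ h₂, by simp; omega⟩

theorem Sub.append {F F' G G' : Forest α} (h : Sub F F') (hG : Sub G G') :
    Sub (F + G) (F' + G') := by
  induction h with
  | nil => simpa using hG
  | keep hc _ _ ihs => exact .keep hc ihs
  | drop hc _ _ ihs =>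
    rw [add_assoc]
    exact .drop hc ihs

theorem Sub.split {F G H : Forest α} (h : Sub (F + G) H) :
    ∃ H₁ H₂, H = H₁ + H₂ ∧ Sub F H₁ ∧ Sub G H₂ := by
  induction F generalizing H with
  | nil => exact ⟨Forest.nil, H, rfl, .nil, h⟩
  | cons a c s _ ihs =>
    rw [cons_add] at h
    cases h with
    | keep hc hs =>
      obtain ⟨H₁, H₂, rfl, h₁, h₂⟩ := ihs hs
      exact ⟨_, H₂, (cons_add _ _ _ _).symm, .keep hc h₁, h₂⟩
    | drop hc hs =>
      obtain ⟨H₁, H₂, rfl, h₁, h₂⟩ := ihs hs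
      exact ⟨_, H₂, (add_assoc _ _ _).symm, .drop hc h₁, h₂⟩

/-! ### Positions in the bi-order traversal -/

/-- `NodeAt T e f b`: some node of `T` with label `b` is entered at position `e` and left at
position `f` of the bi-order traversal sequence; positions are numbered from `0`. -/
def NodeAt : Forest α → ℕ → ℕ → α → Prop
  | nil, _, _, _ => False
  | cons a c s, e, f, b =>
    (e = 0 ∧ f = 2 * c.size + 1 ∧ b = a) ∨
    (∃ e' f', e = e' + 1 ∧ f = f' + 1 ∧ NodeAt c e' f' b) ∨
    (∃ e' f', e = e' + (2 * c.size + 2) ∧ f = f' + (2 * c.size + 2) ∧ NodeAt s e' f' b)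

theorem NodeAt.lt {T : Forest α} {e f : ℕ} {b : α} (h : NodeAt T e f b) :
    e < f ∧ f < 2 * T.size := by
  induction T generalizing e f with
  | nil => exact h.elim
  | cons a c s ihc ihs =>
    rcases h with ⟨rfl, rfl, _⟩ | ⟨e', f', rfl, rfl, h⟩ | ⟨e', f', rfl, rfl, h⟩
    · simp; omega
    · have := ihc h; simp; omega
    · have := ihs h; simp; omega

/-- `Occ T H i j`: the forest `H` occurs in `T` at nodes all of whose positions lie in `[i, j)`. -/
def Occ (T : Forest α) : Forest α → ℕ → ℕ → Prop
  | nil, i, j => i ≤ j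
  | cons b c s, i, j =>
    ∃ e f, NodeAt T e f b ∧ i ≤ e ∧ f + 1 ≤ j ∧ Occ T c (e + 1) f ∧ Occ T s (f + 1) j

theorem Occ.le {T H : Forest α} {i j : ℕ} (h : Occ T H i j) : i ≤ j := by
  cases H with
  | nil => exact h
  | cons b c s =>
    obtain ⟨e, f, hn, _, _, _, _⟩ := h
    have := hn.lt
    omega

theorem Occ.mono {T H : Forest α} {i j i' j' : ℕ} (h : Occ T H i j) (hi : i' ≤ i) (hj : j ≤ j') :
    Occ T H i' j' := by
  induction H generalizing i j i' with
  | nil => exact le_trans hi (le_trans h hj)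
  | cons b c s ihc ihs =>
    obtain ⟨e, f, hn, h₁, h₂, h₃, h₄⟩ := h
    exact ⟨e, f, hn, by omega, by omega, h₃, ihs h₄ le_rfl hj⟩

theorem Occ.append {T H K : Forest α} {i p j : ℕ} (h : Occ T H i p) (hK : Occ T K p j) :
    Occ T (H + K) i j := by
  induction H generalizing i with
  | nil => exact hK.mono h le_rfl
  | cons b c s ihc ihs =>
    obtain ⟨e, f, hn, h₁, h₂, h₃, h₄⟩ := h
    have := hK.le
    exact ⟨e, f, hn, h₁, by omega, h₃, ihs h₄⟩

theorem Occ.split {T H K : Forest α} {i j : ℕ} (h : Occ T (H + K) i j) :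
    ∃ p, Occ T H i p ∧ Occ T K p j := by
  induction H generalizing i with
  | nil => exact ⟨i, le_refl i, h⟩
  | cons b c s ihc ihs =>
    obtain ⟨e, f, hn, h₁, h₂, h₃, h₄⟩ := h
    obtain ⟨p, h₅, h₆⟩ := ihs h₄
    have := h₅.le
    exact ⟨p, ⟨e, f, hn, h₁, by omega, h₃, h₅⟩, h₆⟩

/-- Transport of occurrences along a map of positions that shifts them by `d`. -/
theorem Occ.shift {T U H : Forest α} {d i j : ℕ}
    (hTU : ∀ e f b, NodeAt U e f b → NodeAt T (e + d) (f + d) b) (h : Occ U H i j) :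
    Occ T H (i + d) (j + d) := by
  induction H generalizing i j with
  | nil => exact Nat.add_le_add_right h d
  | cons b c s ihc ihs =>
    obtain ⟨e, f, hn, h₁, h₂, h₃, h₄⟩ := h
    have h₃' := ihc h₃
    have h₄' := ihs h₄
    exact ⟨e + d, f + d, hTU _ _ _ hn, by omega, by omega,
      by rwa [show e + d + 1 = e + 1 + d by omega],
      by rwa [show f + d + 1 = f + 1 + d by omega]⟩

/-- Transport of occurrences from a forest `T` to a forest `U` whose positions are those of `T`
from `d` on, up to an upper end `r`. -/
theorem Occ.unshift {T U H : Forest α} {d r i j : ℕ}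
    (hTU : ∀ e f b, d ≤ e → f < r → NodeAt T e f b → NodeAt U (e - d) (f - d) b)
    (h : Occ T H i j) (hi : d ≤ i) (hj : j ≤ r) : Occ U H (i - d) (j - d) := by
  induction H generalizing i j with
  | nil => exact Nat.sub_le_sub_right h d
  | cons b c s ihc ihs =>
    obtain ⟨e, f, hn, h₁, h₂, h₃, h₄⟩ := h
    have := hn.lt
    have h₃' := ihc h₃ (by omega) (by omega)
    have h₄' := ihs h₄ (by omega) hj
    exact ⟨e - d, f - d, hTU _ _ _ (by omega) (by omega) hn, by omega, by omega,
      by rwa [show e - d + 1 = e + 1 - d by omega],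
      by rwa [show f - d + 1 = f + 1 - d by omega]⟩

theorem Occ.truncate {T H : Forest α} {i j : ℕ} (h : Occ T H i j) (hi : i ≤ 2 * T.size) :
    Occ T H i (min j (2 * T.size)) := by
  induction H generalizing i with
  | nil => have : i ≤ j := h; exact le_min this hi
  | cons b c s ihc ihs =>
    obtain ⟨e, f, hn, h₁, h₂, h₃, h₄⟩ := h
    have := hn.lt
    exact ⟨e, f, hn, h₁, by omega, h₃, ihs h₄ (by omega)⟩

theorem Occ.eq_nil {T H : Forest α} {i j : ℕ} (h : Occ T H i j) (hj : j ≤ i) : H = nil := by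
  cases H with
  | nil => rfl
  | cons b c s =>
    obtain ⟨e, f, hn, h₁, h₂, h₃, h₄⟩ := h
    have := hn.lt
    omega

theorem nodeAt_child {a : α} {c s : Forest α} {e f : ℕ} {b : α} (h : NodeAt c e f b) :
    NodeAt (cons a c s) (e + 1) (f + 1) b := .inr (.inl ⟨e, f, rfl, rfl, h⟩)

theorem nodeAt_sibling {a : α} {c s : Forest α} {e f : ℕ} {b : α} (h : NodeAt s e f b) :
    NodeAt (cons a c s) (e + (2 * c.size + 2)) (f + (2 * c.size + 2)) b :=
  .inr (.inr ⟨e, f, rfl, rfl, h⟩)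

theorem NodeAt.of_child {a : α} {c s : Forest α} {e f : ℕ} {b : α}
    (h : NodeAt (cons a c s) e f b) (he : 1 ≤ e) (hf : f < 2 * c.size + 1) :
    NodeAt c (e - 1) (f - 1) b := by
  rcases h with ⟨rfl, _⟩ | ⟨e', f', rfl, rfl, h⟩ | ⟨e', f', rfl, rfl, h⟩
  · omega
  · exact h
  · omega

theorem NodeAt.of_sibling {a : α} {c s : Forest α} {e f : ℕ} {b : α}
    (h : NodeAt (cons a c s) e f b) (he : 2 * c.size + 2 ≤ e) :
    NodeAt s (e - (2 * c.size + 2)) (f - (2 * c.size + 2)) b := by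
  rcases h with ⟨rfl, _⟩ | ⟨e', f', rfl, rfl, h⟩ | ⟨e', f', rfl, rfl, h⟩
  · omega
  · have := h.lt
    omega
  · simpa using h

theorem Occ.child {a : α} {c s H : Forest α} {i j : ℕ} (h : Occ (cons a c s) H i j) (hi : 1 ≤ i)
    (hj : j ≤ 2 * c.size + 1) : Occ c H (i - 1) (j - 1) :=
  h.unshift (r := 2 * c.size + 1) (fun _ _ _ he hf hn => hn.of_child he hf) hi hj

theorem Occ.sibling {a : α} {c s H : Forest α} {i j : ℕ} (h : Occ (cons a c s) H i j)
    (hi : 2 * c.size + 2 ≤ i) : Occ s H (i - (2 * c.size + 2)) (j - (2 * c.size + 2)) :=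
  h.unshift (r := j) (fun _ _ _ he _ hn => hn.of_sibling he) hi le_rfl

/-- An occurrence in a nonempty forest uses the first root, or it consists of an occurrence below
this root and an occurrence in the remaining trees. -/
theorem Occ.of_cons {a : α} {c s H : Forest α} {l r : ℕ} (h : Occ (cons a c s) H l r) :
    (l = 0 ∧ 2 * c.size + 2 ≤ r ∧ ∃ c' s', H = cons a c' s' ∧ Occ c c' 0 (2 * c.size) ∧
      Occ s s' 0 (r - (2 * c.size + 2))) ∨
    ∃ c' s', H = c' + s' ∧ Occ c c' (l - 1) (r - 1) ∧
      Occ s s' (l - (2 * c.size + 2)) (r - (2 * c.size + 2)) := by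
  induction H generalizing l with
  | nil =>
    have hlr : l ≤ r := h
    exact .inr ⟨nil, nil, rfl, Nat.sub_le_sub_right hlr _, Nat.sub_le_sub_right hlr _⟩
  | cons b c₁ s₁ _ ihs =>
    obtain ⟨e, f, hn, h₁, h₂, h₃, h₄⟩ := h
    have hlt := hn.lt
    rcases hn with ⟨rfl, rfl, rfl⟩ | ⟨e', f', rfl, rfl, hn⟩ | ⟨e', f', rfl, rfl, hn⟩
    · have hc := h₃.child (by omega) (by omega)
      have hs := h₄.sibling (by omega)
      refine .inl ⟨by omega, by omega, _, _, rfl, by simpa using hc, ?_⟩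
      simpa using hs
    · have hf := hn.lt
      have hc := h₃.child (by omega) (by omega)
      rcases ihs h₄ with ⟨h0, _⟩ | ⟨c', s', rfl, h₅, h₆⟩
      · omega
      · refine .inr ⟨cons b c₁ c', s', rfl, ⟨e', f', hn, by omega, by omega, ?_, ?_⟩,
          h₆.mono (by omega) le_rfl⟩
        · simpa using hc
        · simpa using h₅
    · have hc := h₃.sibling (by omega)
      have hs := h₄.sibling (by omega)
      refine .inr ⟨nil, cons b c₁ s₁, rfl, ?_, e', f', hn, by omega, by omega, ?_, ?_⟩
      · show l - 1 ≤ r - 1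
        omega
      · convert hc using 1 <;> omega
      · convert hs using 1; omega

/-! ### The subforest of a window of positions -/

/-- The forest that consists of the nodes with all positions in `[l, r)`. -/
def window : Forest α → ℕ → ℕ → Forest α
  | nil, _, _ => nil
  | cons a c s, l, r =>
    if l = 0 ∧ 2 * c.size + 2 ≤ r then
      cons a (c.window (l - 1) (r - 1)) (s.window (l - (2 * c.size + 2)) (r - (2 * c.size + 2)))
    else c.window (l - 1) (r - 1) + s.window (l - (2 * c.size + 2)) (r - (2 * c.size + 2))

theorem sub_window_of_occ {T H : Forest α} {l r : ℕ} (h : Occ T H l r) : Sub (T.window l r) H := by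
  induction T generalizing H l r with
  | nil =>
    cases H with
    | nil => exact .nil
    | cons b c s => obtain ⟨e, f, hn, _⟩ := h; exact hn.elim
  | cons a c s ihc ihs =>
    rw [window]
    rcases h.of_cons with ⟨rfl, hr, c', s', rfl, hc, hs⟩ | ⟨c', s', rfl, hc, hs⟩
    · rw [if_pos ⟨rfl, hr⟩]
      exact .keep (ihc (hc.mono le_rfl (by omega))) (ihs (by simpa using hs))
    · split_ifs
      · exact .drop (ihc hc) (ihs hs)
      · exact (ihc hc).append (ihs hs)

theorem occ_of_sub_window {T H : Forest α} {l r : ℕ} (hlr : l ≤ r) (h : Sub (T.window l r) H) :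
    Occ T H l r := by
  induction T generalizing H l r with
  | nil => cases h; exact hlr
  | cons a c s ihc ihs =>
    rw [window] at h
    have hboth : ∀ c' s', Sub (c.window (l - 1) (r - 1)) c' →
        Sub (s.window (l - (2 * c.size + 2)) (r - (2 * c.size + 2))) s' →
        Occ (cons a c s) (c' + s') l r := by
      intro c' s' hc hs
      have hc := ihc (by omega) hc
      have hs := ihs (by omega) hs
      have hs' := hs.shift fun e f b => nodeAt_sibling (a := a) (c := c)
      by_cases hl : 2 * c.size + 1 ≤ l
      · -- the window lies to the right of the subtree of the first root
        have hc0 : c' = nil := by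
          cases c' with
          | nil => rfl
          | cons b c₁ s₁ =>
            obtain ⟨e, f, hn, _⟩ := hc
            have := hn.lt
            omega
        subst hc0
        by_cases hr : 2 * c.size + 2 ≤ r
        · exact hs'.mono (by omega) (by omega)
        · rw [hs.eq_nil (by omega)]
          exact hlr
      · have hc' := (hc.truncate (by omega)).shift fun e f b => nodeAt_child (a := a) (s := s)
        by_cases hr : 2 * c.size + 2 ≤ r
        · exact Occ.append (p := 2 * c.size + 2) (hc'.mono (by omega) (by omega))
            (hs'.mono (by omega) (by omega))
        · rw [hs.eq_nil (by omega), add_nil]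
          rcases Nat.eq_zero_or_pos r with h0 | h0
          · rw [hc.eq_nil (by omega)]
            exact hlr
          · exact hc'.mono (by omega) (by omega)
    split_ifs at h with hk
    · cases h with
      | keep hc hs =>
        have hc := (ihc (by omega) hc).truncate (by omega)
        have hs := ihs (by omega) hs
        have hc' := hc.shift fun e f b => nodeAt_child (a := a) (s := s)
        have hs' := hs.shift fun e f b => nodeAt_sibling (a := a) (c := c)
        exact ⟨0, 2 * c.size + 1, .inl ⟨rfl, rfl, rfl⟩, by omega, by omega,
          hc'.mono (by omega) (by omega), hs'.mono (by omega) (by omega)⟩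
      | drop hc hs => exact hboth _ _ hc hs
    · obtain ⟨c', s', rfl, hc, hs⟩ := h.split
      exact hboth _ _ hc hs

@[simp] theorem length_biorder (F : Forest α) : F.biorder.length = 2 * F.size := by
  induction F with
  | nil => rfl
  | cons a c s ihc ihs => simp [biorder, ihc, ihs]; omega

theorem keep_congr (F : Forest α) {p q : α → Prop} [DecidablePred p] [DecidablePred q]
    (h : ∀ v ∈ F.biorder, (p v ↔ q v)) : F.keep p = F.keep q := by
  induction F with
  | nil => rfl
  | cons a c s ihc ihs =>
    have ha : p a ↔ q a := h a (by simp [biorder])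
    have hc := ihc fun v hv => h v (by simp [biorder, hv])
    have hs := ihs fun v hv => h v (by simp [biorder, hv])
    simp only [keep, ha, hc, hs]

/-- No node occurs twice. -/
def Distinct : Forest α → Prop
  | nil => True
  | cons a c s => a ∉ c.biorder ∧ a ∉ s.biorder ∧ (∀ v ∈ c.biorder, v ∉ s.biorder) ∧
      c.Distinct ∧ s.Distinct

theorem keep_eq_window [DecidableEq α] (F : Forest α) (hF : F.Distinct) (l r : ℕ) :
    F.keep (fun v => v ∉ F.biorder.take l ∧ v ∉ F.biorder.drop r) = F.window l r := by
  induction F generalizing l r with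
  | nil => rfl
  | cons a c s ihc ihs =>
    obtain ⟨hac, has, hcs, hc, hs⟩ := hF
    have ht : ∀ v, v ∈ (cons a c s).biorder.take l ↔ (v = a ∧ l ≠ 0) ∨
        v ∈ c.biorder.take (l - 1) ∨ v ∈ s.biorder.take (l - (2 * c.size + 2)) := by
      intro v
      rcases l with _ | l
      · simp
      · simp only [biorder, List.take_succ_cons, List.take_append, length_biorder, List.mem_cons,
          List.mem_append, ne_eq, Nat.succ_ne_zero, not_false_eq_true, and_true,
          Nat.add_sub_cancel]
        rcases hd : l - 2 * c.size with _ | d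
        · rw [show l + 1 - (2 * c.size + 2) = 0 by omega]
          simp
        · rw [show l + 1 - (2 * c.size + 2) = d by omega]
          simp only [List.take_succ_cons, List.mem_cons]
          tauto
    have hd : ∀ v, v ∈ (cons a c s).biorder.drop r ↔ (v = a ∧ r < 2 * c.size + 2) ∨
        v ∈ c.biorder.drop (r - 1) ∨ v ∈ s.biorder.drop (r - (2 * c.size + 2)) := by
      intro v
      rcases r with _ | r
      · simp only [biorder, List.drop_zero, List.mem_cons, List.mem_append, Nat.zero_sub]
        have : 0 < 2 * c.size + 2 := by omega
        tauto
      · simp only [biorder, List.drop_succ_cons, List.drop_append, length_biorder,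
          List.mem_append, Nat.add_sub_cancel]
        rcases hd : r - 2 * c.size with _ | d
        · rw [show r + 1 - (2 * c.size + 2) = 0 by omega]
          simp only [List.drop_zero, List.mem_cons]
          have : r + 1 < 2 * c.size + 2 := by omega
          tauto
        · rw [show r + 1 - (2 * c.size + 2) = d by omega]
          have : ¬ r + 1 < 2 * c.size + 2 := by omega
          simp only [List.drop_succ_cons]
          tauto
    have hca : c.keep (fun v => v ∉ (cons a c s).biorder.take l ∧
        v ∉ (cons a c s).biorder.drop r) = c.window (l - 1) (r - 1) := by
      rw [← ihc hc]
      refine keep_congr _ fun v hv => ?_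
      have h₁ : v ≠ a := fun h => hac (h ▸ hv)
      have h₂ := fun h => hcs v hv (List.mem_of_mem_take (i := l - (2 * c.size + 2)) h)
      have h₃ := fun h => hcs v hv (List.mem_of_mem_drop (i := r - (2 * c.size + 2)) h)
      rw [ht, hd]
      tauto
    have hsa : s.keep (fun v => v ∉ (cons a c s).biorder.take l ∧
        v ∉ (cons a c s).biorder.drop r) =
        s.window (l - (2 * c.size + 2)) (r - (2 * c.size + 2)) := by
      rw [← ihs hs]
      refine keep_congr _ fun v hv => ?_
      have h₁ : v ≠ a := fun h => has (h ▸ hv)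
      have h₂ := fun h => hcs v (List.mem_of_mem_take (i := l - 1) h) hv
      have h₃ := fun h => hcs v (List.mem_of_mem_drop (i := r - 1) h) hv
      rw [ht, hd]
      tauto
    have hroot : (a ∉ (cons a c s).biorder.take l ∧ a ∉ (cons a c s).biorder.drop r) ↔
        l = 0 ∧ 2 * c.size + 2 ≤ r := by
      have h₁ := fun h => hac (List.mem_of_mem_take (i := l - 1) h)
      have h₂ := fun h => has (List.mem_of_mem_take (i := l - (2 * c.size + 2)) h)
      have h₃ := fun h => hac (List.mem_of_mem_drop (i := r - 1) h)
      have h₄ := fun h => has (List.mem_of_mem_drop (i := r - (2 * c.size + 2)) h)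
      rw [ht, hd]
      have : r < 2 * c.size + 2 ↔ ¬ 2 * c.size + 2 ≤ r := not_le.symm
      tauto
    rw [keep, window, hca, hsa]
    simp only [hroot]

theorem mem_biorder_number {F : Forest α} {n : ℕ} {v : α × ℕ}
    (h : v ∈ (F.number n).biorder) : n ≤ v.2 ∧ v.2 < n + F.size := by
  induction F generalizing n with
  | nil => simp [number, biorder] at h
  | cons a c s ihc ihs =>
    simp only [number, biorder, List.mem_cons, List.mem_append] at h
    simp only [size_cons]
    rcases h with rfl | h | rfl | h
    · simp
    · have := ihc h; omega
    · simp
    · have := ihs h; omega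

theorem distinct_number (F : Forest α) (n : ℕ) : (F.number n).Distinct := by
  induction F generalizing n with
  | nil => trivial
  | cons a c s ihc ihs =>
    refine ⟨fun h => ?_, fun h => ?_, fun v hc hs => ?_, ihc _, ihs _⟩
    · have := (mem_biorder_number h).1; simp at this
    · have := (mem_biorder_number h).1; simp at this; omega
    · have := (mem_biorder_number hc).2
      have := (mem_biorder_number hs).1
      omega

@[simp] theorem size_number (F : Forest α) (n : ℕ) : (F.number n).size = F.size := by
  induction F generalizing n with
  | nil => rfl
  | cons a c s ihc ihs => simp [number, ihc, ihs]

theorem map_add {β : Type*} (f : α → β) (F G : Forest α) : (F + G).map f = F.map f + G.map f := by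
  induction F with
  | nil => rfl
  | cons a c s _ ihs => simp [map, ihs]

theorem map_window_number (F : Forest α) (n l r : ℕ) :
    ((F.number n).window l r).map Prod.fst = F.window l r := by
  induction F generalizing n l r with
  | nil => rfl
  | cons a c s ihc ihs =>
    simp only [number, window, size_number]
    split_ifs
    · simp [map, ihc, ihs]
    · simp [map_add, ihc, ihs]

theorem subforest_eq_window [DecidableEq α] (F : Forest α) (l r : ℕ) :
    F.subforest (l + 1) (r + 1) = F.window l r := by
  unfold subforest
  rw [← map_window_number F 0, ← keep_eq_window _ (distinct_number F 0)]
  congr 1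
  exact @keep_congr _ _ _ _ (_) (_) fun _ _ => Iff.rfl

/-! ### Similarity by recursion on one of the forests -/

section

variable [DecidableEq α]

/-- The contribution to the similarity of a pair of matched nodes with the labels `a` and `b`: both
nodes are saved, and they may have to be relabeled. -/
def score (a b : α) : ℕ := if a = b then 2 else 1

/-- `Fits T F i j x`: the similarity of `F` and the subforest of `T` on the positions in `[i, j)`
is at least `x`, see `le_sim_iff`.  The first root of `F` is removed or it is matched to a node of
`T` that is entered at `e` and left at `f`. -/
def Fits (T : Forest α) : Forest α → ℕ → ℕ → ℕ → Prop
  | nil, i, j, x => i ≤ j ∧ x = 0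
  | cons a c s, i, j, x => ∃ p y z, x ≤ y + z ∧
      (Fits T c i p y ∨ ∃ e f b y', NodeAt T e f b ∧ i ≤ e ∧ f + 1 ≤ p ∧ y ≤ y' + score a b ∧
        Fits T c (e + 1) f y') ∧ Fits T s p j z

theorem Fits.of_emb {T F H : Forest α} {i j d x : ℕ} (h : Emb F H d) (hH : Occ T H i j)
    (hx : x ≤ F.size + H.size - d) : Fits T F i j x := by
  induction h generalizing i j x with
  | nil => exact ⟨hH, by simpa using hx⟩
  | @keep a b c c' s s' m n d hd _ _ ihc ihs =>
    obtain ⟨e, f, hn, h₁, h₂, h₃, h₄⟩ := hH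
    simp only [size_cons] at hx
    have hsc : 2 ≤ score a b + d := by
      unfold score; split_ifs with hab
      · omega
      · have := hd.resolve_left hab; omega
    exact ⟨f + 1, c.size + c'.size - m + score a b, s.size + s'.size - n, by omega,
      .inr ⟨e, f, b, c.size + c'.size - m, hn, h₁, le_rfl, le_rfl, ihc h₃ le_rfl⟩, ihs h₄ le_rfl⟩
  | @drop a c c' s s' m n _ _ ihc ihs =>
    obtain ⟨p, h₁, h₂⟩ := hH.split
    simp only [size_cons, size_add] at hx
    exact ⟨p, c.size + c'.size - m, s.size + s'.size - n, by omega, .inl (ihc h₁ le_rfl),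
      ihs h₂ le_rfl⟩

theorem Fits.exists_emb {T F : Forest α} {i j x : ℕ} (h : Fits T F i j x) :
    ∃ H d, Emb F H d ∧ Occ T H i j ∧ x + d ≤ F.size + H.size := by
  induction F generalizing i j x with
  | nil => exact ⟨nil, 0, .nil, h.1, by simp [h.2]⟩
  | cons a c s ihc ihs =>
    obtain ⟨p, y, z, hx, h₁, h₂⟩ := h
    obtain ⟨s', n, hs, hos, hn⟩ := ihs h₂
    rcases h₁ with h₁ | ⟨e, f, b, y', hnode, hie, hf, hy, h₁⟩
    · obtain ⟨c', m, hc, hoc, hm⟩ := ihc h₁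
      exact ⟨_, _, .drop hc hs, hoc.append hos, by simp; omega⟩
    · obtain ⟨c', m, hc, hoc, hm⟩ := ihc h₁
      have := hos.le
      refine ⟨cons b c' s', m + n + (2 - score a b), .keep ?_ hc hs,
        ⟨e, f, hnode, hie, by omega, hoc, hos.mono hf le_rfl⟩, ?_⟩
      · unfold score
        split_ifs with hab
        · exact .inl hab
        · exact .inr le_rfl
      · have : score a b ≤ 2 := by unfold score; split_ifs <;> omega
        simp only [size_cons]
        omega

theorem le_sim_iff {T F : Forest α} {i j : ℕ} (hij : i ≤ j) (x : ℕ) :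
    (x : ℤ) ≤ sim F (T.subforest (i + 1) (j + 1)) ↔ Fits T F i j x := by
  rw [subforest_eq_window]
  unfold sim
  constructor
  · intro h
    obtain ⟨p, q, H, hpq, hF, hG⟩ := exists_emb F (T.window i j)
    obtain ⟨G', e, hsub, hemb, hsize⟩ := hG.exists_sub
    obtain ⟨d, hd, hF⟩ := hF.trans hemb
    exact .of_emb hF (occ_of_sub_window hij hsub) (by omega)
  · intro h
    obtain ⟨H, d, hF, hH, hx⟩ := h.exists_emb
    obtain ⟨q, hG, hq⟩ := (sub_window_of_occ hH).emb
    have := ed_le hF hG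
    omega

end

end Forest

namespace Forest

section

variable {α : Type*} [DecidableEq α]

/-! ### Tables of least columns -/

theorem Fits.zero {T F : Forest α} {i j : ℕ} (h : i ≤ j) : Fits T F i j 0 := by
  induction F generalizing i j with
  | nil => exact ⟨h, rfl⟩
  | cons a c s ihc ihs => exact ⟨i, 0, 0, le_rfl, .inl (ihc le_rfl), ihs h⟩

theorem Fits.le {T F : Forest α} {i j x : ℕ} (h : Fits T F i j x) : i ≤ j := by
  obtain ⟨H, d, _, h, _⟩ := h.exists_emb
  exact h.le

theorem Fits.mono {T F : Forest α} {i j x i' j' x' : ℕ} (h : Fits T F i j x) (hi : i' ≤ i)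
    (hj : j ≤ j') (hx : x' ≤ x) : Fits T F i' j' x' := by
  obtain ⟨H, d, he, h, hd⟩ := h.exists_emb
  exact .of_emb he (h.mono hi hj) (by omega)

theorem score_le (a b : α) : score a b ≤ 2 := by unfold score; split_ifs <;> omega

theorem Fits.le_two_mul {T F : Forest α} {i j x : ℕ} (h : Fits T F i j x) : x ≤ 2 * F.size := by
  induction F generalizing i j x with
  | nil => exact h.2.le
  | cons a c s ihc ihs =>
    obtain ⟨p, y, z, hx, h₁, h₂⟩ := h
    have := ihs h₂
    simp only [size_cons]
    rcases h₁ with h₁ | ⟨e, f, b, y', _, _, _, hy, h₁⟩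
    · have := ihc h₁
      omega
    · have := ihc h₁
      have := score_le a b
      omega

theorem fits_cons {T : Forest α} {a : α} {c s : Forest α} {i j x : ℕ} :
    Fits T (cons a c s) i j x ↔ ∃ p y z, x ≤ y + z ∧ Fits T (cons a c nil) i p y ∧
      Fits T s p j z := by
  constructor
  · rintro ⟨p, y, z, hx, h₁, h₂⟩
    exact ⟨p, y, z, hx, ⟨p, y, 0, le_rfl, h₁, le_rfl, rfl⟩, h₂⟩
  · rintro ⟨p, y, z, hx, ⟨q, y', z', hy, h₁, hq, rfl⟩, h₂⟩
    exact ⟨q, y', z, by omega, h₁, h₂.mono hq le_rfl le_rfl⟩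

/-- The similarity matrix of a concatenation is the max-plus product of the similarity matrices. -/
theorem fits_add {T F G : Forest α} {i j x : ℕ} :
    Fits T (F + G) i j x ↔ ∃ p y z, x ≤ y + z ∧ Fits T F i p y ∧ Fits T G p j z := by
  induction F generalizing i x with
  | nil =>
    constructor
    · intro h
      exact ⟨i, 0, x, by omega, ⟨le_rfl, rfl⟩, h⟩
    · rintro ⟨p, y, z, hx, ⟨hp, rfl⟩, h⟩
      exact h.mono hp le_rfl (by omega)
  | cons a c s _ ihs =>
    rw [cons_add, fits_cons]
    constructor
    · rintro ⟨p, y, z, hx, h₁, h₂⟩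
      obtain ⟨q, y', z', hz, h₂, h₃⟩ := ihs.1 h₂
      exact ⟨q, y + y', z', by omega, fits_cons.2 ⟨p, y, y', le_rfl, h₁, h₂⟩, h₃⟩
    · rintro ⟨q, y, z, hx, h₁, h₃⟩
      obtain ⟨p, y', z', hy, h₁, h₂⟩ := fits_cons.1 h₁
      exact ⟨p, y', z' + z, by omega, h₁, ihs.2 ⟨q, z', z, le_rfl, h₂, h₃⟩⟩

/-- `tab T F i x` is the least `j ≤ 2 |T|` for which the similarity of `F` and the subforest of `T`
on the positions in `[i, j)` is at least `x`, and `2 |T| + 1` if there is none.  Rows and columns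
are numbered from `0` here. -/
noncomputable def tab (T F : Forest α) (i x : ℕ) : ℕ :=
  sInf {j | Fits T F i j x ∨ j = 2 * T.size + 1}

theorem tab_le (T F : Forest α) (i x : ℕ) : tab T F i x ≤ 2 * T.size + 1 := Nat.sInf_le (.inr rfl)

theorem tab_le_iff {T F : Forest α} {i x j : ℕ} (hj : j ≤ 2 * T.size) :
    tab T F i x ≤ j ↔ Fits T F i j x := by
  constructor
  · intro h
    have hne : {j | Fits T F i j x ∨ j = 2 * T.size + 1}.Nonempty := ⟨_, .inr rfl⟩
    rcases Nat.sInf_mem hne with h' | h'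
    · exact h'.mono le_rfl h le_rfl
    · have : tab T F i x = 2 * T.size + 1 := h'
      omega
  · exact fun h => Nat.sInf_le (.inl h)

theorem eq_tab {T F : Forest α} {i x v : ℕ} (hv : v ≤ 2 * T.size + 1)
    (h : ∀ j ≤ 2 * T.size, v ≤ j ↔ Fits T F i j x) : v = tab T F i x := by
  have h' : ∀ j ≤ 2 * T.size, v ≤ j ↔ tab T F i x ≤ j := fun j hj => by rw [h j hj, tab_le_iff hj]
  have ht := tab_le T F i x
  rcases hv.lt_or_eq with hv | rfl
  · have h₁ := (h' v (by omega)).1 le_rfl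
    exact le_antisymm ((h' _ (by omega)).2 le_rfl) h₁
  · by_contra hne
    have := (h' (tab T F i x) (by omega)).2 le_rfl
    omega

theorem tab_zero {T : Forest α} (F : Forest α) {i : ℕ} (hi : i ≤ 2 * T.size) :
    tab T F i 0 = i :=
  (eq_tab (by omega) fun _ _ => ⟨Fits.zero, Fits.le⟩).symm

theorem tab_of_lt {T : Forest α} (F : Forest α) {i : ℕ} (x : ℕ) (hi : 2 * T.size < i) :
    tab T F i x = 2 * T.size + 1 :=
  (eq_tab le_rfl fun j hj => ⟨fun h => by omega, fun h => by have := h.le; omega⟩).symm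

theorem tab_of_size_lt (T : Forest α) {F : Forest α} (i : ℕ) {x : ℕ} (hx : 2 * F.size < x) :
    tab T F i x = 2 * T.size + 1 :=
  (eq_tab le_rfl fun j hj => ⟨fun h => by omega, fun h => by have := h.le_two_mul; omega⟩).symm

theorem tab_add_le_iff {T F G : Forest α} {i j x : ℕ} (hj : j ≤ 2 * T.size) :
    tab T (F + G) i x ≤ j ↔
      ∃ y, x - 2 * G.size ≤ y ∧ y ≤ 2 * F.size ∧ y ≤ x ∧ tab T G (tab T F i y) (x - y) ≤ j := by
  rw [tab_le_iff hj, fits_add]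
  constructor
  · rintro ⟨p, y, z, hx, h₁, h₂⟩
    have hp := h₂.le
    have := h₁.le_two_mul
    have := h₂.le_two_mul
    refine ⟨min x y, by omega, by omega, by omega, ?_⟩
    have h₁' := (tab_le_iff (by omega)).2 (h₁.mono le_rfl le_rfl (min_le_right x y))
    exact (tab_le_iff hj).2 (h₂.mono h₁' le_rfl (by omega))
  · rintro ⟨y, _, _, hyx, h⟩
    have h := (tab_le_iff hj).1 h
    have := h.le
    exact ⟨_, y, x - y, by omega, (tab_le_iff (by omega)).1 le_rfl, h⟩

theorem fits_tree {T : Forest α} {a : α} {c : Forest α} {i j x : ℕ} :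
    Fits T (cons a c nil) i j x ↔ Fits T c i j x ∨ ∃ e f b, NodeAt T e f b ∧ i ≤ e ∧ f + 1 ≤ j ∧
      Fits T c (e + 1) f (x - score a b) := by
  constructor
  · rintro ⟨p, y, z, hx, h, hp, rfl⟩
    rcases h with h | ⟨e, f, b, y', hn, he, hf, hy, h⟩
    · exact .inl (h.mono le_rfl hp hx)
    · exact .inr ⟨e, f, b, hn, he, by omega, h.mono le_rfl le_rfl (by omega)⟩
  · rintro (h | ⟨e, f, b, hn, he, hf, h⟩)
    · exact ⟨j, x, 0, le_rfl, .inl h, le_rfl, rfl⟩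
    · exact ⟨j, x, 0, le_rfl, .inr ⟨e, f, b, _, hn, he, hf, by omega, h⟩, le_rfl, rfl⟩

theorem tab_tree_le_iff {T : Forest α} {a : α} {c : Forest α} {i j x : ℕ} (hj : j ≤ 2 * T.size) :
    tab T (cons a c nil) i x ≤ j ↔ tab T c i x ≤ j ∨ tab T (cons a c nil) (i + 1) x ≤ j ∨
      ∃ f b, NodeAt T i f b ∧ f + 1 ≤ j ∧ tab T c (i + 1) (x - score a b) ≤ f := by
  rw [tab_le_iff hj, tab_le_iff hj, tab_le_iff hj, fits_tree]
  constructor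
  · rintro (h | ⟨e, f, b, hn, he, hf, h⟩)
    · exact .inl h
    · rcases he.lt_or_eq with he | rfl
      · exact .inr (.inl (fits_tree.2 (.inr ⟨e, f, b, hn, he, hf, h⟩)))
      · exact .inr (.inr ⟨f, b, hn, hf, (tab_le_iff hn.lt.2.le).2 h⟩)
  · rintro (h | h | ⟨f, b, hn, hf, h⟩)
    · exact .inl h
    · exact fits_tree.1 (h.mono (by omega) le_rfl le_rfl)
    · exact .inr ⟨i, f, b, hn, le_rfl, hf, (tab_le_iff hn.lt.2.le).1 h⟩

end

/-! ### Matching the brackets of an encoded forest -/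

/-- Read a list of tokens, which begins at position `p`, from right to left with a stack of the
positions of the pending `0`s.  The second component maps the position of a token other than `0` to
the position of the matching `0`. -/
def brackets : List ℕ → ℕ → List ℕ × (ℕ → ℕ)
  | [], _ => ([], fun _ => 0)
  | t :: ts, p =>
    if t = 0 then (p :: (brackets ts (p + 1)).1, (brackets ts (p + 1)).2)
    else ((brackets ts (p + 1)).1.tail,
      Function.update (brackets ts (p + 1)).2 p ((brackets ts (p + 1)).1.headD 0))

theorem length_brackets_le (ts : List ℕ) (p : ℕ) : (brackets ts p).1.length ≤ ts.length := by
  induction ts generalizing p with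
  | nil => simp [brackets]
  | cons t ts ih =>
    have := ih (p + 1)
    rw [brackets]
    split_ifs
    · simp; omega
    · simp; omega

variable {σ : ℕ}

@[simp] theorem length_encodeForest (F : Forest (Fin σ)) :
    (encodeForest F).length = 2 * F.size := by
  induction F with
  | nil => rfl
  | cons a c s ihc ihs => simp [encodeForest, ihc, ihs]; omega

theorem brackets_encodeForest_append (U : Forest (Fin σ)) (ts : List ℕ) (p : ℕ) :
    (brackets (encodeForest U ++ ts) p).1 = (brackets ts (p + 2 * U.size)).1 ∧
    (∀ q, p + 2 * U.size ≤ q → (brackets (encodeForest U ++ ts) p).2 q =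
      (brackets ts (p + 2 * U.size)).2 q) ∧
    ∀ e f b, NodeAt U e f b → (brackets (encodeForest U ++ ts) p).2 (p + e) = p + f := by
  induction U generalizing ts p with
  | nil => exact ⟨rfl, fun _ _ => rfl, fun _ _ _ h => h.elim⟩
  | cons a c s ihc ihs =>
    obtain ⟨hs₁, hs₂, hs₃⟩ := ihs ts (p + 2 * c.size + 2)
    obtain ⟨hc₁, hc₂, hc₃⟩ := ihc (0 :: (encodeForest s ++ ts)) (p + 1)
    rw [show p + 1 + 2 * c.size = p + 2 * c.size + 1 by omega] at hc₁ hc₂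
    simp only [brackets, if_true] at hc₁ hc₂
    rw [show p + 2 * c.size + 1 + 1 = p + 2 * c.size + 2 by omega] at hc₁ hc₂
    simp only [encodeForest, List.cons_append, List.append_assoc, brackets, Nat.succ_ne_zero,
      if_false, hc₁, List.tail_cons, List.headD_cons, size_cons]
    rw [show p + 2 * (c.size + s.size + 1) = p + 2 * c.size + 2 + 2 * s.size by omega]
    refine ⟨hs₁, fun q hq => ?_, ?_⟩
    · rw [Function.update_of_ne (by omega), hc₂ q (by omega), hs₂ q hq]
    · rintro e f b (⟨rfl, rfl, _⟩ | ⟨e', f', rfl, rfl, h⟩ | ⟨e', f', rfl, rfl, h⟩)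
      · simp; omega
      · rw [Function.update_of_ne (by omega), show p + (e' + 1) = p + 1 + e' by omega,
          hc₃ e' f' b h]
        omega
      · rw [Function.update_of_ne (by omega), hc₂ _ (by omega),
          show p + (e' + (2 * c.size + 2)) = p + 2 * c.size + 2 + e' by omega, hs₃ e' f' b h]
        omega

theorem NodeAt.getD_encodeForest {T : Forest (Fin σ)} {e f : ℕ} {b : Fin σ} (h : NodeAt T e f b) :
    (encodeForest T).getD e 0 = b + 1 := by
  induction T generalizing e f with
  | nil => exact h.elim
  | cons a c s ihc ihs =>
    rcases h with ⟨rfl, _, rfl⟩ | ⟨e', f', rfl, _, h⟩ | ⟨e', f', rfl, _, h⟩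
    · rfl
    · have := h.lt
      rw [encodeForest, List.getD_cons_succ, List.getD_append _ _ _ _ (by simp; omega), ihc h]
    · rw [encodeForest, show e' + (2 * c.size + 2) = e' + 1 + 2 * c.size + 1 by omega,
        List.getD_cons_succ, List.getD_append_right _ _ _ _ (by simp)]
      simp [← ihs h]

theorem exists_nodeAt {T : Forest (Fin σ)} {e : ℕ} (h : (encodeForest T).getD e 0 ≠ 0) :
    ∃ f b, NodeAt T e f b := by
  induction T generalizing e with
  | nil => simp [encodeForest] at h
  | cons a c s ihc ihs =>
    rcases e with _ | e
    · exact ⟨_, _, .inl ⟨rfl, rfl, rfl⟩⟩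
    · rw [encodeForest, List.getD_cons_succ] at h
      rcases lt_or_ge e (2 * c.size) with he | he
      · rw [List.getD_append _ _ _ _ (by simpa using he)] at h
        obtain ⟨f, b, h⟩ := ihc h
        exact ⟨_, b, nodeAt_child h⟩
      · rw [List.getD_append_right _ _ _ _ (by simpa using he)] at h
        rcases hd : e - 2 * c.size with _ | d
        · simp [hd] at h
        · rw [length_encodeForest, hd, List.getD_cons_succ] at h
          obtain ⟨f, b, h⟩ := ihs h
          have := nodeAt_sibling (a := a) (c := c) h
          rw [show d + (2 * c.size + 2) = e + 1 by omega] at this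
          exact ⟨_, b, this⟩

theorem NodeAt.brackets_eq {T : Forest (Fin σ)} {e f : ℕ} {b : Fin σ} (h : NodeAt T e f b) :
    (brackets (encodeForest T) 0).2 e = f := by
  have := (brackets_encodeForest_append T [] 0).2.2 e f b h
  simpa using this

/-! ### Reading an encoded forest with a stack -/

/-- The tokens of the encoding of a forest: `some a` for entering a node with label `a`, and `none`
for leaving a node. -/
def tokens : Forest (Fin σ) → List (Option (Fin σ))
  | nil => []
  | cons a c s => some a :: (tokens c ++ none :: tokens s)

/-- The number that encodes a token. -/
def tokenCode : Option (Fin σ) → ℕ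
  | none => 0
  | some a => a + 1

theorem map_tokens (F : Forest (Fin σ)) : (tokens F).map tokenCode = encodeForest F := by
  induction F with
  | nil => rfl
  | cons a c s ihc ihs => simp [tokens, encodeForest, tokenCode, ihc, ihs]

theorem length_tokens (F : Forest (Fin σ)) : (tokens F).length = 2 * F.size := by
  rw [← length_encodeForest, ← map_tokens, List.length_map]

/-- A reader of tokens: the forest that has been read last on the present level, and for every
node that has been entered and not left, from the inside to the outside, its label and the forest
to its left. -/
abbrev Reader (σ : ℕ) := List (Fin σ × Forest (Fin σ)) × Forest (Fin σ)

/-- Read a token. -/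
def Reader.step : Reader σ → Option (Fin σ) → Reader σ
  | (st, A), some a => ((a, A) :: st, nil)
  | ((a, A) :: st, C), none => (st, A + cons a C nil)
  | ([], C), none => ([], C)

/-- The cost of reading a token: a table of a concatenation takes time proportional to the product
of the sizes. -/
def Reader.cost : Reader σ → Option (Fin σ) → ℕ
  | _, some _ => 1
  | ((_, A) :: _, C), none => (A.size + 1) * (C.size + 1)
  | ([], _), none => 0

/-- The cost of reading a list of tokens. -/
def Reader.costs : List (Option (Fin σ)) → Reader σ → ℕ
  | [], _ => 0
  | t :: ts, r => r.cost t + Reader.costs ts (r.step t)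

theorem Reader.costs_append (ts us : List (Option (Fin σ))) (r : Reader σ) :
    Reader.costs (ts ++ us) r = Reader.costs ts r + Reader.costs us (ts.foldl Reader.step r) := by
  induction ts generalizing r with
  | nil => simp [costs]
  | cons t ts ih => simp [costs, ih, Nat.add_assoc]

theorem foldl_step_tokens (F : Forest (Fin σ)) (st : List (Fin σ × Forest (Fin σ)))
    (A : Forest (Fin σ)) : (tokens F).foldl Reader.step (st, A) = (st, A + F) := by
  induction F generalizing st A with
  | nil => simp [tokens]
  | cons a c s ihc ihs => simp [tokens, Reader.step, ihc, ihs, add_assoc]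

/-- Reading a forest of size `f` takes quadratic time, since the pairs of nodes that contribute to
the products of sizes are different. -/
theorem costs_tokens_le (F : Forest (Fin σ)) (st : List (Fin σ × Forest (Fin σ)))
    (A : Forest (Fin σ)) :
    Reader.costs (tokens F) (st, A) ≤ F.size * (F.size + 2 * A.size) + F.size := by
  induction F generalizing st A with
  | nil => simp [tokens, Reader.costs]
  | cons a c s ihc ihs =>
    have h₁ := ihc ((a, A) :: st) nil
    have h₂ := ihs st (A + cons a c nil)
    simp only [tokens, Reader.costs, Reader.costs_append, Reader.step, foldl_step_tokens,
      Reader.cost, nil_add, size_add, size_cons, size_nil] at h₁ h₂ ⊢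
    nlinarith [Nat.zero_le (A.size * c.size)]

end Forest

/-! ### Expressions and statements over the natural numbers -/

/-- A state of the machine with natural numbers in place of words.  The component `time` counts
steps. -/
structure NatState where
  reg : ℕ → ℕ
  mem : ℕ → ℕ
  time : ℕ

namespace NatState

/-- Write `v` to register `r` and spend `c` steps. -/
def upd (s : NatState) (r v c : ℕ) : NatState :=
  ⟨Function.update s.reg r v, s.mem, s.time + c⟩

/-- Write `v` to the memory cell `a` and spend `c` steps. -/
def put (s : NatState) (a v c : ℕ) : NatState :=
  ⟨s.reg, Function.update s.mem a v, s.time + c⟩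

/-- Spend `c` steps. -/
def tick (s : NatState) (c : ℕ) : NatState := ⟨s.reg, s.mem, s.time + c⟩

variable (s : NatState) (r v c a : ℕ)

@[simp] theorem reg_upd (r' : ℕ) : (s.upd r v c).reg r' = if r' = r then v else s.reg r' := by
  simp [upd, Function.update_apply]
@[simp] theorem mem_upd : (s.upd r v c).mem = s.mem := rfl
@[simp] theorem time_upd : (s.upd r v c).time = s.time + c := rfl
@[simp] theorem reg_put : (s.put a v c).reg = s.reg := rfl
@[simp] theorem mem_put : (s.put a v c).mem = Function.update s.mem a v := rfl
@[simp] theorem time_put : (s.put a v c).time = s.time + c := rfl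
@[simp] theorem reg_tick : (s.tick c).reg = s.reg := rfl
@[simp] theorem mem_tick : (s.tick c).mem = s.mem := rfl
@[simp] theorem time_tick : (s.tick c).time = s.time + c := rfl

end NatState

/-- Expressions: the variables are the registers below `100`. -/
inductive Expr where
  | var (r : ℕ) : Expr
  | lit (n : ℕ) : Expr
  | op (o : Arith) (e f : Expr) : Expr
  /-- the contents of a memory cell -/
  | get (e : Expr) : Expr

namespace Expr

instance : Add Expr := ⟨op .add⟩
instance : Sub Expr := ⟨op .sub⟩
instance : Mul Expr := ⟨op .mul⟩
instance : Div Expr := ⟨op .div⟩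
instance (n : ℕ) : OfNat Expr n := ⟨lit n⟩

/-- The value of an expression. -/
def eval (s : NatState) : Expr → ℕ
  | var r => s.reg r
  | lit n => n
  | op .add e f => e.eval s + f.eval s
  | op .sub e f => e.eval s - f.eval s
  | op .mul e f => e.eval s * f.eval s
  | op .div e f => e.eval s / f.eval s
  | get e => s.mem (e.eval s)

/-- The evaluation with words below `B` does not leave the range of words. -/
def Ok (B : ℕ) (s : NatState) : Expr → Prop
  | var r => r < 100
  | lit n => n < B
  | op .add e f => e.Ok B s ∧ f.Ok B s ∧ e.eval s + f.eval s < B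
  | op .sub e f => e.Ok B s ∧ f.Ok B s ∧ f.eval s ≤ e.eval s
  | op .mul e f => e.Ok B s ∧ f.Ok B s ∧ e.eval s * f.eval s < B
  | op .div e f => e.Ok B s ∧ f.Ok B s
  | get e => e.Ok B s

/-- The number of steps that the evaluation takes. -/
def cost : Expr → ℕ
  | var _ => 2
  | lit _ => 1
  | op _ e f => e.cost + (f.cost + 1)
  | get e => e.cost + 1

/-- Evaluate an expression into register `t`; only registers from `t` on are changed. -/
def code : Expr → ℕ → Program
  | var r, t => .seq (.const t 0) (.arith .add t r t)
  | lit n, t => .const t n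
  | op o e f, t => .seq (e.code t) (.seq (f.code (t + 1)) (.arith o t t (t + 1)))
  | get e, t => .seq (e.code t) (.load t t)

variable (B : ℕ) (s : NatState) (e f : Expr) (r n : ℕ)

@[simp] theorem eval_var : (var r).eval s = s.reg r := rfl
@[simp] theorem eval_lit : (ofNat(n) : Expr).eval s = OfNat.ofNat n := rfl
@[simp] theorem eval_add : (e + f).eval s = e.eval s + f.eval s := rfl
@[simp] theorem eval_sub : (e - f).eval s = e.eval s - f.eval s := rfl
@[simp] theorem eval_mul : (e * f).eval s = e.eval s * f.eval s := rfl
@[simp] theorem eval_div : (e / f).eval s = e.eval s / f.eval s := rfl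
@[simp] theorem eval_get : (get e).eval s = s.mem (e.eval s) := rfl
@[simp] theorem ok_var : (var r).Ok B s ↔ r < 100 := .rfl
@[simp] theorem ok_lit : (ofNat(n) : Expr).Ok B s ↔ OfNat.ofNat n < B := .rfl
@[simp] theorem ok_add : (e + f).Ok B s ↔ e.Ok B s ∧ f.Ok B s ∧ e.eval s + f.eval s < B := .rfl
@[simp] theorem ok_sub : (e - f).Ok B s ↔ e.Ok B s ∧ f.Ok B s ∧ f.eval s ≤ e.eval s := .rfl
@[simp] theorem ok_mul : (e * f).Ok B s ↔ e.Ok B s ∧ f.Ok B s ∧ e.eval s * f.eval s < B := .rfl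
@[simp] theorem ok_div : (e / f).Ok B s ↔ e.Ok B s ∧ f.Ok B s := .rfl
@[simp] theorem ok_get : (get e).Ok B s ↔ e.Ok B s := .rfl
@[simp] theorem cost_var : (var r).cost = 2 := rfl
@[simp] theorem cost_lit : (ofNat(n) : Expr).cost = 1 := rfl
@[simp] theorem cost_add : (e + f).cost = e.cost + (f.cost + 1) := rfl
@[simp] theorem cost_sub : (e - f).cost = e.cost + (f.cost + 1) := rfl
@[simp] theorem cost_mul : (e * f).cost = e.cost + (f.cost + 1) := rfl
@[simp] theorem cost_div : (e / f).cost = e.cost + (f.cost + 1) := rfl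
@[simp] theorem cost_get : (get e).cost = e.cost + 1 := rfl

end Expr

variable {w : ℕ}

namespace Expr

@[simp] theorem eval_tick (e : Expr) (s : NatState) (c : ℕ) : e.eval (s.tick c) = e.eval s := by
  induction e with
  | var => rfl
  | lit => rfl
  | op o _ _ ihe ihf => cases o <;> simp [eval, ihe, ihf]
  | get _ ih => simp [eval, ih]

@[simp] theorem ok_tick (e : Expr) (B : ℕ) (s : NatState) (c : ℕ) :
    e.Ok B (s.tick c) ↔ e.Ok B s := by
  induction e with
  | var => rfl
  | lit => rfl
  | op o _ _ ihe ihf => cases o <;> simp [Ok, ihe, ihf]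
  | get _ ih => exact ih

end Expr

/-- The number of words. -/
def wordCount (w : ℕ) : ℕ := 2 ^ w

/-- The state `σ` of the machine agrees with `s` on the memory and on the variables. -/
def Rel (s : NatState) (σ : State w) : Prop :=
  (∀ r < 100, (σ.reg r).toNat = s.reg r) ∧ ∀ a : BitVec w, (σ.mem a).toNat = s.mem a.toNat

theorem Rel.reg_lt {s : NatState} {σ : State w} (h : Rel s σ) {r : ℕ} (hr : r < 100) :
    s.reg r < wordCount w := by
  rw [← h.1 r hr]
  exact (σ.reg r).isLt

theorem Expr.runs_code {s : NatState} {e : Expr} (he : e.Ok (wordCount w) s) {t : ℕ} (ht : 100 ≤ t)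
    {σ : State w} (h : Rel s σ) : ∃ σ', Runs (e.code t) σ e.cost σ' ∧
      (σ'.reg t).toNat = e.eval s ∧ σ'.mem = σ.mem ∧ ∀ r < t, σ'.reg r = σ.reg r := by
  induction e generalizing t σ with
  | var r =>
    have hr : r < 100 := he
    refine ⟨_, .seq (.const ..) (.arith ..), ?_, rfl, fun r' hr' => ?_⟩
    · have hne : r ≠ t := by omega
      simp [State.setReg, Arith.eval, hne, h.1 r hr, Expr.eval]
    · simp [State.setReg, hr'.ne]
  | lit n =>
    have hn : n < 2 ^ w := he
    refine ⟨_, .const .., ?_, rfl, fun r' hr' => ?_⟩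
    · simp [State.setReg, Expr.eval, Nat.mod_eq_of_lt hn]
    · simp [State.setReg, hr'.ne]
  | op o e f ihe ihf =>
    have hef : e.Ok (wordCount w) s ∧ f.Ok (wordCount w) s := by
      cases o
      exacts [⟨he.1, he.2.1⟩, ⟨he.1, he.2.1⟩, ⟨he.1, he.2.1⟩, he]
    obtain ⟨σ₁, h₁, hv₁, hm₁, hr₁⟩ := ihe hef.1 ht h
    have hrel : Rel s σ₁ := ⟨fun r hr => by rw [hr₁ r (by omega), h.1 r hr],
      fun a => by rw [hm₁, h.2]⟩
    obtain ⟨σ₂, h₂, hv₂, hm₂, hr₂⟩ := ihf hef.2 (t := t + 1) (by omega) hrel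
    refine ⟨_, .seq h₁ (.seq h₂ (.arith ..)), ?_, hm₂.trans hm₁, fun r hr => ?_⟩
    · rw [← hr₂ t (by omega)] at hv₁
      cases o with
      | add =>
        have hlt : _ < 2 ^ w := he.2.2
        rw [← hv₁, ← hv₂] at hlt
        simp [State.setReg, Arith.eval, Expr.eval, ← hv₁, ← hv₂, Nat.mod_eq_of_lt hlt]
      | sub =>
        have hlt := he.2.2
        rw [← hv₁, ← hv₂] at hlt
        simp only [State.setReg, Arith.eval, Expr.eval, ← hv₁, ← hv₂, Function.update_self]
        exact BitVec.toNat_sub_of_le hlt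
      | mul =>
        have hlt : _ < 2 ^ w := he.2.2
        rw [← hv₁, ← hv₂] at hlt
        simp [State.setReg, Arith.eval, Expr.eval, ← hv₁, ← hv₂, Nat.mod_eq_of_lt hlt]
      | div => simp [State.setReg, Arith.eval, Expr.eval, ← hv₁, ← hv₂]
    · simp [State.setReg, hr.ne, hr₂ r (by omega), hr₁ r hr]
  | get e ih =>
    obtain ⟨σ₁, h₁, hv₁, hm₁, hr₁⟩ := ih he ht h
    refine ⟨_, .seq h₁ (.load ..), ?_, hm₁, fun r hr => ?_⟩
    · simp [State.setReg, Expr.eval, ← hv₁, hm₁, h.2]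
    · simp [State.setReg, hr.ne, hr₁ r hr]

theorem Rel.of_eq {s : NatState} {σ σ' : State w} (h : Rel s σ) {t : ℕ} (ht : 100 ≤ t)
    (hm : σ'.mem = σ.mem) (hr : ∀ r < t, σ'.reg r = σ.reg r) : Rel s σ' :=
  ⟨fun r h' => by rw [hr r (by omega), h.1 r h'], fun a => by rw [hm, h.2]⟩

theorem Rel.of_tick {s s' : NatState} {σ : State w} (h : Rel s σ) (hr : s'.reg = s.reg)
    (hm : s'.mem = s.mem) : Rel s' σ := by
  unfold Rel
  rw [hr, hm]
  exact h

namespace Program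

/-- `r := e` -/
def assign (r : ℕ) (e : Expr) : Program :=
  .seq (e.code 100) (.seq (.const r 0) (.arith .add r 100 r))

/-- `mem[e] := f` -/
def write (e f : Expr) : Program := .seq (e.code 100) (.seq (f.code 101) (.store 100 101))

/-- if `e < f` then `p` else `q` -/
def ifLt (e f : Expr) (p q : Program) : Program :=
  .seq (e.code 100) (.seq (f.code 101) (.ite 100 101 p q))

/-- while `e < f` do `p` -/
def whileLt (e f : Expr) (p : Program) : Program :=
  .seq (e.code 100) (.seq (f.code 101) (.while 100 101 (.seq p (.seq (e.code 100) (f.code 101)))))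

/-- while `i < b` do `p` and increase `i`, for variables `i` and `b` -/
def forLt (i b : ℕ) (p : Program) : Program :=
  whileLt (.var i) (.var b) (.seq p (assign i (.var i + 1)))

/-- Whether the program may change register `r`. -/
def sets : Program → ℕ → Bool
  | skip, _ => false
  | const r _, r' => r' == r
  | arith _ r _ _, r' => r' == r
  | load r _, r' => r' == r
  | store _ _, _ => false
  | seq p q, r' => p.sets r' || q.sets r'
  | ite _ _ p q, r' => p.sets r' || q.sets r'
  | .while _ _ p, r' => p.sets r'

/-- Whether the program may write to the memory. -/
def stores : Program → Bool
  | store _ _ => true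
  | seq p q => p.stores || q.stores
  | ite _ _ p q => p.stores || q.stores
  | .while _ _ p => p.stores
  | _ => false

end Program

open Program Forest

theorem sets_code (e : Expr) {t r : ℕ} (ht : r < t) : (e.code t).sets r = false := by
  induction e generalizing t with
  | var => simp [Expr.code, sets, ht.ne]
  | lit => simp [Expr.code, sets, ht.ne]
  | op _ _ _ ihe ihf => simp [Expr.code, sets, ht.ne, ihe ht, ihf (t := t + 1) (by omega)]
  | get _ ih => simp [Expr.code, sets, ht.ne, ih ht]

theorem sets_seq (p q : Program) (r : ℕ) : (Program.seq p q).sets r = (p.sets r || q.sets r) := rfl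

theorem sets_assign (r' : ℕ) (e : Expr) {r : ℕ} (hr : r < 100) :
    (assign r' e).sets r = (r == r') := by
  simp [assign, sets, sets_code e hr]

theorem sets_write (e f : Expr) {r : ℕ} (hr : r < 100) : (write e f).sets r = false := by
  simp [write, sets, sets_code e hr, sets_code f (t := 101) (show r < 101 by omega)]

theorem sets_ifLt (e f : Expr) (p q : Program) {r : ℕ} (hr : r < 100) :
    (ifLt e f p q).sets r = (p.sets r || q.sets r) := by
  simp [ifLt, sets, sets_code e hr, sets_code f (t := 101) (show r < 101 by omega)]

theorem sets_whileLt (e f : Expr) (p : Program) {r : ℕ} (hr : r < 100) :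
    (whileLt e f p).sets r = p.sets r := by
  simp [whileLt, sets, sets_code e hr, sets_code f (t := 101) (show r < 101 by omega)]

theorem sets_forLt (i b : ℕ) (p : Program) {r : ℕ} (hr : r < 100) :
    (forLt i b p).sets r = (p.sets r || r == i) := by
  rw [forLt, sets_whileLt _ _ _ hr, sets_seq, sets_assign _ _ hr]

theorem Runs.reg_eq {p : Program} {σ σ' : State w} {t : ℕ} (h : Runs p σ t σ') {r : ℕ}
    (hr : p.sets r = false) : σ'.reg r = σ.reg r := by
  induction h with
  | skip | store | while_false => rfl
  | const | arith | load =>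
    simp only [sets, beq_eq_false_iff_ne] at hr
    simp [State.setReg, hr]
  | seq _ _ ih₁ ih₂ =>
    simp only [sets, Bool.or_eq_false_iff] at hr
    rw [ih₂ hr.2, ih₁ hr.1]
  | ite_true _ _ ih =>
    simp only [sets, Bool.or_eq_false_iff] at hr
    exact ih hr.1
  | ite_false _ _ ih =>
    simp only [sets, Bool.or_eq_false_iff] at hr
    exact ih hr.2
  | while_true _ _ _ ih₁ ih₂ => rw [ih₂ hr, ih₁ hr]

theorem Runs.mem_eq {p : Program} {σ σ' : State w} {t : ℕ} (h : Runs p σ t σ')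
    (hp : p.stores = false) : σ'.mem = σ.mem := by
  induction h with
  | skip | const | arith | load | while_false => rfl
  | store => simp [stores] at hp
  | seq _ _ ih₁ ih₂ =>
    simp only [stores, Bool.or_eq_false_iff] at hp
    rw [ih₂ hp.2, ih₁ hp.1]
  | ite_true _ _ ih =>
    simp only [stores, Bool.or_eq_false_iff] at hp
    exact ih hp.1
  | ite_false _ _ ih =>
    simp only [stores, Bool.or_eq_false_iff] at hp
    exact ih hp.2
  | while_true _ _ _ ih₁ ih₂ => rw [ih₂ hp, ih₁ hp]

/-! ### A program logic -/

/-- The program, started in a state of the machine that agrees with `s`, halts in a state that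
agrees with some `s'` such that `Q s'`, and the component `time` has grown by at least the number of
steps.  So an upper bound for `time` in `Q` bounds the running time. -/
def Wp (w : ℕ) (p : Program) (Q : NatState → Prop) (s : NatState) : Prop :=
  ∀ σ : State w, Rel s σ → ∃ t σ' s', Runs p σ t σ' ∧ Rel s' σ' ∧ s.time + t ≤ s'.time ∧ Q s'

/-- The variables that `p` does not assign to have the same values in both states. -/
def Frame (p : Program) (s s' : NatState) : Prop :=
  ∀ r < 100, p.sets r = false → s'.reg r = s.reg r

theorem Frame.refl (p : Program) (s : NatState) : Frame p s s := fun _ _ _ => rfl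

theorem Frame.trans {p : Program} {s s' s'' : NatState} (h : Frame p s s') (h' : Frame p s' s'') :
    Frame p s s'' := fun r hr hp => (h' r hr hp).trans (h r hr hp)

theorem Wp.mono {p : Program} {Q R : NatState → Prop} {s : NatState} (h : Wp w p Q s)
    (hQR : ∀ s', Q s' → R s') : Wp w p R s := fun σ hσ => by
  obtain ⟨t, σ', s', h₁, h₂, h₃, h₄⟩ := h σ hσ
  exact ⟨t, σ', s', h₁, h₂, h₃, hQR s' h₄⟩

theorem Wp.frame {p : Program} {Q : NatState → Prop} {s : NatState} (h : Wp w p Q s) :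
    Wp w p (fun s' => Frame p s s' ∧ Q s') s := fun σ hσ => by
  obtain ⟨t, σ', s', h₁, h₂, h₃, h₄⟩ := h σ hσ
  exact ⟨t, σ', s', h₁, h₂, h₃, fun r hr hp => by
    rw [← h₂.1 r hr, h₁.reg_eq hp, hσ.1 r hr], h₄⟩

/-- In a proof about a program one may use that the values of the variables are words. -/
theorem Wp.of_lt {p : Program} {Q : NatState → Prop} {s : NatState}
    (h : (∀ r < 100, s.reg r < wordCount w) → Wp w p Q s) : Wp w p Q s :=
  fun σ hσ => h (fun _ hr => hσ.reg_lt hr) σ hσ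

theorem Wp.seq {p q : Program} {Q : NatState → Prop} {s : NatState}
    (h : Wp w p (fun s' => Wp w q Q s') s) : Wp w (.seq p q) Q s := fun σ hσ => by
  obtain ⟨t, σ', s', h₁, h₂, h₃, h₄⟩ := h σ hσ
  obtain ⟨t', σ'', s'', h₅, h₆, h₇, h₈⟩ := h₄ σ' h₂
  exact ⟨_, σ'', s'', .seq h₁ h₅, h₆, by omega, h₈⟩

theorem Wp.skip {Q : NatState → Prop} {s : NatState} (h : Q (s.tick 1)) : Wp w .skip Q s :=
  fun σ hσ => ⟨1, σ, s.tick 1, .skip σ, hσ, le_rfl, h⟩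

theorem Wp.assign {r : ℕ} {e : Expr} {Q : NatState → Prop} {s : NatState} (hr : r < 100)
    (he : e.Ok (wordCount w) s) (h : Q (s.upd r (e.eval s) (e.cost + 2))) :
    Wp w (.assign r e) Q s := fun σ hσ => by
  obtain ⟨σ₁, h₁, hv₁, hm₁, hr₁⟩ := e.runs_code he le_rfl hσ
  refine ⟨_, _, _, .seq h₁ (.seq (.const ..) (.arith ..)), ⟨fun r' hr' => ?_, fun a => ?_⟩,
    le_rfl, h⟩
  · have : (100 : ℕ) ≠ r := by omega
    by_cases hrr : r' = r
    · subst hrr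
      simp [State.setReg, Arith.eval, this, hv₁]
    · simp [State.setReg, hrr, hr₁ r' hr', hσ.1 r' hr']
  · simp [State.setReg, hm₁, hσ.2]

theorem Wp.write {e f : Expr} {Q : NatState → Prop} {s : NatState} (he : e.Ok (wordCount w) s)
    (hf : f.Ok (wordCount w) s) (h : Q (s.put (e.eval s) (f.eval s) (e.cost + (f.cost + 1)))) :
    Wp w (.write e f) Q s := fun σ hσ => by
  obtain ⟨σ₁, h₁, hv₁, hm₁, hr₁⟩ := e.runs_code he le_rfl hσ
  obtain ⟨σ₂, h₂, hv₂, hm₂, hr₂⟩ := f.runs_code hf (t := 101) (by omega)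
    (hσ.of_eq le_rfl hm₁ hr₁)
  refine ⟨_, _, _, .seq h₁ (.seq h₂ (.store ..)), ⟨fun r' hr' => ?_, fun a => ?_⟩, le_rfl, h⟩
  · simp [State.setMem, hr₂ r' (by omega), hr₁ r' hr', hσ.1 r' hr']
  · have ha : a = σ₂.reg 100 ↔ a.toNat = e.eval s := by
      rw [hr₂ 100 (by omega), ← hv₁, BitVec.toNat_inj]
    by_cases haa : a = σ₂.reg 100
    · simp only [State.setMem, NatState.mem_put, haa, Function.update_self, hv₂, ← ha.1 haa]
    · simp [State.setMem, haa, mt ha.2 haa, hm₂, hm₁, hσ.2]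

theorem Wp.ifLt {e f : Expr} {p q : Program} {Q : NatState → Prop} {s : NatState}
    (he : e.Ok (wordCount w) s) (hf : f.Ok (wordCount w) s)
    (hp : e.eval s < f.eval s → Wp w p Q (s.tick (e.cost + f.cost + 1)))
    (hq : f.eval s ≤ e.eval s → Wp w q Q (s.tick (e.cost + f.cost + 1))) :
    Wp w (.ifLt e f p q) Q s := fun σ hσ => by
  obtain ⟨σ₁, h₁, hv₁, hm₁, hr₁⟩ := e.runs_code he le_rfl hσ
  have hσ₁ := hσ.of_eq le_rfl hm₁ hr₁
  obtain ⟨σ₂, h₂, hv₂, hm₂, hr₂⟩ := f.runs_code hf (t := 101) (by omega) hσ₁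
  have hσ₂ := hσ₁.of_eq (by omega) hm₂ hr₂
  have hlt : σ₂.reg 100 < σ₂.reg 101 ↔ e.eval s < f.eval s := by
    rw [BitVec.lt_def, hv₂, hr₂ 100 (by omega), hv₁]
  by_cases hc : e.eval s < f.eval s
  · obtain ⟨t, σ', s', h₃, h₄, h₅, h₆⟩ := hp hc σ₂ (hσ₂.of_tick rfl rfl)
    exact ⟨_, σ', s', .seq h₁ (.seq h₂ (.ite_true (hlt.2 hc) h₃)), h₄,
      by simp only [NatState.time_tick] at h₅; omega, h₆⟩
  · obtain ⟨t, σ', s', h₃, h₄, h₅, h₆⟩ := hq (not_lt.1 hc) σ₂ (hσ₂.of_tick rfl rfl)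
    exact ⟨_, σ', s', .seq h₁ (.seq h₂ (.ite_false (mt hlt.1 hc) h₃)), h₄,
      by simp only [NatState.time_tick] at h₅; omega, h₆⟩

/-- `I` is an invariant of the loop and `μ` a measure that decreases. -/
theorem Wp.whileLt {e f : Expr} {p : Program} {Q : NatState → Prop} {s : NatState}
    (I : NatState → Prop) (μ : NatState → ℕ) (hI : I s)
    (hok : ∀ s', Frame p s s' → I s' → e.Ok (wordCount w) s' ∧ f.Ok (wordCount w) s')
    (step : ∀ s', Frame p s s' → I s' → e.eval s' < f.eval s' →
      Wp w p (fun s'' => I s'' ∧ μ s'' < μ s') (s'.tick (e.cost + f.cost + 1)))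
    (exit : ∀ s', Frame p s s' → I s' → f.eval s' ≤ e.eval s' →
      Q (s'.tick (e.cost + f.cost + 1))) :
    Wp w (.whileLt e f p) Q s := by
  have test : ∀ s', Frame p s s' → I s' → ∀ σ : State w, Rel s' σ → ∃ σ₁ σ₂,
      Runs (e.code 100) σ e.cost σ₁ ∧ Runs (f.code 101) σ₁ f.cost σ₂ ∧ Rel s' σ₂ ∧
      (σ₂.reg 100 < σ₂.reg 101 ↔ e.eval s' < f.eval s') := by
    intro s' hs' hI' σ hσ
    obtain ⟨he, hf⟩ := hok s' hs' hI'
    obtain ⟨σ₁, h₁, hv₁, hm₁, hr₁⟩ := e.runs_code he le_rfl hσ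
    have hσ₁ := hσ.of_eq le_rfl hm₁ hr₁
    obtain ⟨σ₂, h₂, hv₂, hm₂, hr₂⟩ := f.runs_code hf (t := 101) (by omega) hσ₁
    exact ⟨σ₁, σ₂, h₁, h₂, hσ₁.of_eq (by omega) hm₂ hr₂,
      by rw [BitVec.lt_def, hv₂, hr₂ 100 (by omega), hv₁]⟩
  have main : ∀ n s', μ s' < n → Frame p s s' → I s' → ∀ σ : State w, Rel s' σ →
      (σ.reg 100 < σ.reg 101 ↔ e.eval s' < f.eval s') → ∃ t σ' s'',
        Runs (.while 100 101 (.seq p (.seq (e.code 100) (f.code 101)))) σ t σ' ∧ Rel s'' σ' ∧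
        s'.time + (e.cost + f.cost) + t ≤ s''.time ∧ Q s'' := by
    intro n
    induction n with
    | zero => intro s' h; omega
    | succ n ih =>
      intro s' hμ hs' hI' σ hσ hlt
      by_cases hc : e.eval s' < f.eval s'
      · obtain ⟨t₁, σ₁, s₁, hr, hrel, ht, hfr, hI₁, hμ₁⟩ :=
          (step s' hs' hI' hc).frame σ (hσ.of_tick rfl rfl)
        have hs₁ : Frame p s s₁ := hs'.trans hfr
        obtain ⟨σ₂, σ₃, h₂, h₃, hrel', hlt'⟩ := test s₁ hs₁ hI₁ σ₁ hrel
        obtain ⟨t', σ', s'', hr', h₄, h₅, h₆⟩ := ih s₁ (by omega) hs₁ hI₁ σ₃ hrel' hlt'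
        refine ⟨_, σ', s'', .while_true (hlt.2 hc) (.seq hr (.seq h₂ h₃)) hr', h₄, ?_, h₆⟩
        simp only [NatState.time_tick] at ht
        omega
      · exact ⟨_, σ, s'.tick (e.cost + f.cost + 1), .while_false (mt hlt.1 hc),
          hσ.of_tick rfl rfl, le_rfl,
          exit s' hs' hI' (not_lt.1 hc)⟩
  intro σ hσ
  obtain ⟨σ₁, σ₂, h₁, h₂, hrel, hlt⟩ := test s (.refl p s) hI σ hσ
  obtain ⟨t, σ', s', hr, h₄, h₅, h₆⟩ := main _ s (Nat.lt_succ_self _) (.refl p s) hI σ₂ hrel hlt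
  exact ⟨_, σ', s', .seq h₁ (.seq h₂ hr), h₄, by omega, h₆⟩

/-- A counting loop: `I k` holds before the pass with `i = k`. -/
theorem Wp.forLt {i b : ℕ} {p : Program} {Q : NatState → Prop} {s : NatState}
    (I : ℕ → NatState → Prop) (hi : i < 100) (hb : b < 100) (hib : i ≠ b)
    (hpi : p.sets i = false) (hpb : p.sets b = false) (hle : s.reg i ≤ s.reg b)
    (hI : I (s.reg i) s)
    (step : ∀ k s', s.reg i ≤ k → k < s.reg b → s'.reg i = k →
      Frame (.seq p (.assign i (.var i + 1))) s s' → I k s' →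
      Wp w p (fun s'' => I (k + 1) (s''.upd i (k + 1) 6)) (s'.tick 5))
    (exit : ∀ s', s'.reg i = s.reg b → Frame (.seq p (.assign i (.var i + 1))) s s' →
      I (s.reg b) s' → Q (s'.tick 5)) :
    Wp w (.forLt i b p) Q s := by
  have hset : (Program.seq p (.assign i (.var i + 1))).sets b = false := by
    simp [sets_seq, sets_assign, hb, hpb, hib.symm]
  refine Wp.whileLt (fun s' => s.reg i ≤ s'.reg i ∧ s'.reg i ≤ s.reg b ∧ I (s'.reg i) s')
    (fun s' => s.reg b - s'.reg i) ⟨le_rfl, hle, hI⟩ (fun s' _ _ => ⟨hi, hb⟩) ?_ ?_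
  · rintro s' hs' ⟨h₁, h₂, h₃⟩ hlt
    have hsb := hs' b hb hset
    simp only [Expr.eval_var] at hlt
    refine Wp.seq ?_
    refine (step _ s' h₁ (by omega) rfl hs' h₃).frame.mono ?_
    rintro s'' ⟨hfr, hs''⟩
    have hsi : s''.reg i = s'.reg i := hfr i hi hpi
    refine Wp.of_lt fun hw => ?_
    have h₄ : s.reg b < wordCount w := by
      have := hw b hb
      have h₅ : s''.reg b = s'.reg b := hfr b hb hpb
      omega
    refine Wp.assign hi ⟨hi, ?_, ?_⟩ ?_
    · show 1 < wordCount w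
      omega
    · show s''.reg i + 1 < wordCount w
      omega
    · simp only [Expr.eval_add, Expr.eval_var, Expr.eval_lit, Expr.cost_add, Expr.cost_var,
        Expr.cost_lit, hsi, NatState.reg_upd, if_true]
      exact ⟨⟨by omega, by omega, hs''⟩, by omega⟩
  · rintro s' hs' ⟨h₁, h₂, h₃⟩ hlt
    have hsb := hs' b hb hset
    simp only [Expr.eval_var] at hlt
    have : s'.reg i = s.reg b := by omega
    exact exit s' this hs' (this ▸ h₃)

/-- The count of steps may be rounded up. -/
theorem Wp.pad {p : Program} {Q : NatState → Prop} {s : NatState}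
    (h : Wp w p (fun s' => ∃ s'', s''.reg = s'.reg ∧ s''.mem = s'.mem ∧ s'.time ≤ s''.time ∧ Q s'')
      s) : Wp w p Q s := fun σ hσ => by
  obtain ⟨t, σ', s', h₁, h₂, h₃, s'', hr, hm, ht, h₄⟩ := h σ hσ
  exact ⟨t, σ', s'', h₁, h₂.of_tick hr hm, by omega, h₄⟩

/-- A conditional assignment, where `v` is the assigned value in both cases. -/
theorem Wp.ifAssign {e f e₁ e₂ : Expr} {r : ℕ} {Q : NatState → Prop} {s : NatState} (v : ℕ)
    (hr : r < 100) (he : e.Ok (wordCount w) s) (hf : f.Ok (wordCount w) s)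
    (h₁ : e.eval s < f.eval s → e₁.Ok (wordCount w) s ∧ e₁.eval s = v)
    (h₂ : f.eval s ≤ e.eval s → e₂.Ok (wordCount w) s ∧ e₂.eval s = v)
    (h : Q (s.upd r v (e.cost + f.cost + e₁.cost + e₂.cost + 3))) :
    Wp w (Program.ifLt e f (Program.assign r e₁) (Program.assign r e₂)) Q s := by
  refine Wp.pad (Wp.ifLt he hf (fun hlt => ?_) (fun hle => ?_))
  · obtain ⟨hok, hv⟩ := h₁ hlt
    refine Wp.assign hr (by simpa) ⟨_, ?_, ?_, ?_, h⟩
    · ext; simp [hv]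
    · simp
    · simp; omega
  · obtain ⟨hok, hv⟩ := h₂ hle
    refine Wp.assign hr (by simpa) ⟨_, ?_, ?_, ?_, h⟩
    · ext; simp [hv]
    · simp
    · simp; omega

/-! ### Memory layout -/

/-- The address of the cell `x` in row `i` of block `q`, for `i, x < L`.  The blocks from `1` on
contain tables.  The rows of block `0` contain the input (row `0`), the matching closing brackets of
the tree (row `1`) and the stack used to find them (row `2`), the block of the table of every matrix
(row `3`), the stack of the reader of a forest, with blocks of tables (row `4`) and codes of labels
(row `5`), the number of columns of every table (row `6`), and the positions of the forests in the
input (row `7`). -/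
def ad (L q i x : ℕ) : ℕ := (q * L + i) * L + x

theorem ad_zero (L x : ℕ) : ad L 0 0 x = x := by simp [ad]

theorem ad_inj {L q i x q' i' x' : ℕ} (hi : i < L) (hx : x < L) (hi' : i' < L) (hx' : x' < L) :
    ad L q i x = ad L q' i' x' ↔ q = q' ∧ i = i' ∧ x = x' := by
  constructor
  · intro h
    have hL : 0 < L := by omega
    have h₁ := congrArg (· / L) h
    have h₂ := congrArg (· % L) h
    simp only [ad, Nat.add_comm _ x, Nat.add_comm _ x', Nat.add_mul_div_right _ _ hL,
      Nat.add_mul_mod_self_right, Nat.div_eq_of_lt hx, Nat.div_eq_of_lt hx', Nat.mod_eq_of_lt hx,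
      Nat.mod_eq_of_lt hx', zero_add] at h₁ h₂
    have h₃ := congrArg (· / L) h₁
    have h₄ := congrArg (· % L) h₁
    simp only [Nat.add_comm _ i, Nat.add_comm _ i', Nat.add_mul_div_right _ _ hL,
      Nat.add_mul_mod_self_right, Nat.div_eq_of_lt hi, Nat.div_eq_of_lt hi', Nat.mod_eq_of_lt hi,
      Nat.mod_eq_of_lt hi', zero_add] at h₃ h₄
    exact ⟨h₃, h₄, h₂⟩
  · rintro ⟨rfl, rfl, rfl⟩
    rfl

theorem update_ad (mem : ℕ → ℕ) {L q i x q' i' x' : ℕ} (v : ℕ) (hi : i < L) (hx : x < L)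
    (hi' : i' < L) (hx' : x' < L) : Function.update mem (ad L q i x) v (ad L q' i' x') =
      if q' = q ∧ i' = i ∧ x' = x then v else mem (ad L q' i' x') := by
  rw [Function.update_apply]
  simp only [ad_inj hi' hx' hi hx]

/-- The expression for an address; register `10` holds `L`. -/
def adE (q i x : Expr) : Expr := (q * .var 10 + i) * .var 10 + x

@[simp] theorem eval_adE (q i x : Expr) (s : NatState) :
    (adE q i x).eval s = ad (s.reg 10) (q.eval s) (i.eval s) (x.eval s) := rfl

@[simp] theorem cost_adE (q i x : Expr) : (adE q i x).cost = q.cost + i.cost + x.cost + 8 := by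
  simp [adE]
  omega

/-- What all parts of the program use: register `10` holds the width `L` of a row, register `11`
holds `E = 2 |T|`, and the addresses of all cells of the blocks up to `L` are words. -/
structure Env (w L E : ℕ) (s : NatState) : Prop where
  regL : s.reg 10 = L
  regE : s.reg 11 = E
  le : 10 ≤ L
  lt : E + 5 < L
  cap : (L + 1) * L * L ≤ wordCount w

theorem Env.of_reg {w L E : ℕ} {s s' : NatState} (h : Env w L E s) (h₁ : s'.reg 10 = s.reg 10)
    (h₂ : s'.reg 11 = s.reg 11) : Env w L E s' :=
  ⟨h₁.trans h.regL, h₂.trans h.regE, h.le, h.lt, h.cap⟩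

theorem Env.lt_pow {w L E : ℕ} {s : NatState} (h : Env w L E s) : 10 * L + 10 < wordCount w := by
  have h₁ := h.cap
  have h₂ := h.le
  nlinarith [Nat.mul_le_mul h₂ h₂]

theorem Env.ok_adE {w L E : ℕ} {s s' : NatState} (h : Env w L E s) (hs : s'.reg 10 = s.reg 10)
    {q i x : Expr} (hq : q.Ok (wordCount w) s' ∧ i.Ok (wordCount w) s' ∧ x.Ok (wordCount w) s' ∧
      q.eval s' ≤ L ∧ i.eval s' < L ∧ x.eval s' < L) : (adE q i x).Ok (wordCount w) s' := by
  obtain ⟨hq, hi, hx, hqL, hiL, hxL⟩ := hq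
  have h₁ := h.cap
  have h₃ := hs.trans h.regL
  have h₂ := h.le
  have h₄ : q.eval s' * L ≤ L * L := Nat.mul_le_mul_right L hqL
  have h₅ : q.eval s' * L + i.eval s' + 1 ≤ (L + 1) * L := by nlinarith
  have h₆ : (q.eval s' * L + i.eval s' + 1) * L ≤ (L + 1) * L * L := Nat.mul_le_mul_right L h₅
  have h₇ : q.eval s' * L + i.eval s' + 1 ≤ (q.eval s' * L + i.eval s' + 1) * L :=
    Nat.le_mul_of_pos_right _ (by omega)
  have h₈ : (q.eval s' * L + i.eval s') * L + L = (q.eval s' * L + i.eval s' + 1) * L := by ring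
  simp only [adE, Expr.ok_add, Expr.ok_mul, Expr.ok_var, Expr.eval_add, Expr.eval_mul,
    Expr.eval_var, h₃]
  exact ⟨⟨⟨⟨hq, by norm_num, by omega⟩, hi, by omega⟩, by norm_num, by omega⟩, hx, by omega⟩

theorem Env.ok_get {w L E : ℕ} {s s' : NatState} (h : Env w L E s) (hs : s'.reg 10 = s.reg 10)
    {q i x : Expr} (hq : q.Ok (wordCount w) s' ∧ i.Ok (wordCount w) s' ∧ x.Ok (wordCount w) s' ∧
      q.eval s' ≤ L ∧ i.eval s' < L ∧ x.eval s' < L) :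
    (Expr.get (adE q i x)).Ok (wordCount w) s' :=
  (Expr.ok_get ..).2 (h.ok_adE hs hq)

/-- The memory contains the table of `F` in block `q`: twice the size of `F` is in cell `q` of row
`6` of block `0`, and `tab T F i x` is in cell `x` of row `i`, for `x > 0`.  Block `0` is used for
the empty forest only, whose table has no entries. -/
structure IsTab {α : Type*} [DecidableEq α] (L : ℕ) (T : Forest α) (mem : ℕ → ℕ) (q : ℕ)
    (F : Forest α) : Prop where
  lt : q < L
  size_lt : 2 * F.size < L
  zero : q = 0 → F.size = 0
  size_eq : mem (ad L 0 6 q) = 2 * F.size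
  entry : ∀ i ≤ 2 * T.size, ∀ x, 1 ≤ x → x ≤ 2 * F.size → mem (ad L q i x) = tab T F i x

theorem IsTab.congr {α : Type*} [DecidableEq α] {T F : Forest α} {L q : ℕ} {mem mem' : ℕ → ℕ}
    (h : IsTab L T mem q F) (hE : 2 * T.size < L) (h6 : mem' (ad L 0 6 q) = mem (ad L 0 6 q))
    (hq : q ≠ 0 → ∀ i x, i < L → x < L → mem' (ad L q i x) = mem (ad L q i x)) :
    IsTab L T mem' q F := by
  obtain ⟨h₁, h₂, hz, h₃, h₄⟩ := h
  refine ⟨h₁, h₂, hz, h6.trans h₃, fun i hi x hx hx' => ?_⟩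
  -- the table in block `0` has no entries
  have hq0 : q ≠ 0 := fun h => by
    have := hz h
    omega
  rw [hq hq0 i x (by omega) (by omega), h₄ i hi x hx hx']

/-- `r := tab T F i x`, for variables `q`, `i`, `x` and the forest `F` with the table in block
`q`. -/
def look (q i x r : ℕ) : Program :=
  ifLt (.var 11) (.var i) (assign r (.var 11 + 1))
    (ifLt 0 (.var x)
      (ifLt (.get (adE 0 6 (.var q))) (.var x) (assign r (.var 11 + 1))
        (assign r (.get (adE (.var q) (.var i) (.var x)))))
      (assign r (.var i)))

theorem Wp.look {α : Type*} [DecidableEq α] {T F : Forest α} {L : ℕ} {q i x r : ℕ}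
    {Q : NatState → Prop} {s : NatState} (he : Env w L (2 * T.size) s) (hq : q < 100)
    (hi : i < 100) (hx : x < 100) (hr : r < 100) (hF : IsTab L T s.mem (s.reg q) F)
    (h : Q (s.upd r (tab T F (s.reg i) (s.reg x)) 60)) :
    Wp w (look q i x r) Q s := by
  obtain ⟨hqL, hFL, -, hX, htab⟩ := hF
  have hB := he.lt_pow
  have hL := he.regL
  have hE := he.regE
  have hlt := he.lt
  have h10 := he.le
  refine Wp.pad (Wp.ifLt (by simp) (by simpa) (fun hlt' => ?_) (fun hle => ?_))
  · simp only [Expr.eval_var, hE] at hlt'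
    refine Wp.assign hr (by simp [hE]; omega) ⟨_, ?_, ?_, ?_, h⟩
    · ext
      simp [hE, tab_of_lt F _ hlt']
    · simp
    · simp
  simp only [Expr.eval_var, hE] at hle
  refine Wp.ifLt (by simp; omega) (by simpa) (fun hpos => ?_) (fun h0 => ?_)
  · simp only [Expr.eval_var, Expr.eval_lit, NatState.reg_tick] at hpos
    refine Wp.ifLt ?_ (by simpa) (fun hlt' => ?_) (fun hle' => ?_)
    · exact he.ok_get (by simp) (by simp; omega)
    · simp only [Expr.eval_get, eval_adE, Expr.eval_var, Expr.eval_lit, NatState.reg_tick,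
        NatState.mem_tick, hL, hX] at hlt'
      refine Wp.assign hr (by simp [hE]; omega) ⟨_, ?_, ?_, ?_, h⟩
      · ext
        simp [hE, tab_of_size_lt T _ hlt']
      · simp
      · simp
    · simp only [Expr.eval_get, eval_adE, Expr.eval_var, Expr.eval_lit, NatState.reg_tick,
        NatState.mem_tick, hL, hX] at hle'
      refine Wp.assign hr ?_ ⟨_, ?_, ?_, ?_, h⟩
      · exact he.ok_get (by simp) (by simp; omega)
      · ext
        simp [hL, htab _ hle _ hpos hle']
      · simp
      · simp
  · simp only [Expr.eval_var, Expr.eval_lit, NatState.reg_tick] at h0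
    refine Wp.assign hr (by simpa) ⟨_, ?_, ?_, ?_, h⟩
    · ext
      simp [Nat.le_zero.1 h0, tab_zero F hle]
    · simp
    · simp

/-! ### Filling a table -/

/-- The memories agree outside block `q`. -/
def Agree (L q : ℕ) (mem mem' : ℕ → ℕ) : Prop :=
  ∀ q' i x, i < L → x < L → q' ≠ q → mem' (ad L q' i x) = mem (ad L q' i x)

theorem Agree.isTab {α : Type*} [DecidableEq α] {T F : Forest α} {L q q' : ℕ} {mem mem' : ℕ → ℕ}
    (h : Agree L q mem mem') (hF : IsTab L T mem q' F) (hq : q' ≠ q) (h0 : q ≠ 0) (hL : 10 ≤ L)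
    (hE : 2 * T.size < L) : IsTab L T mem' q' F :=
  hF.congr hE (h _ _ _ (by omega) hF.lt h0.symm) fun _ i x hi hx => h q' i x hi hx hq

/-- Fill the columns `1, …, X - 1` of block `d`, where the registers `22` and `23` hold `d` and `X`.
For every cell, `body` computes the entry in register `27`; the registers `26` and `24` hold the row
and the column, and the rows are processed from below. -/
def fill (body : Program) : Program :=
  .seq (assign 28 (.var 11 + 1)) (.seq (assign 24 1) (forLt 24 23 (.seq (assign 25 0)
    (forLt 25 28 (.seq (assign 26 (.var 11 - .var 25)) (.seq body
      (write (adE (.var 22) (.var 26) (.var 24)) (.var 27))))))))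

/-- The body `body` computes the entries of `g`, and it may use the entry in the row below.  The
memory outside of the new table is not changed. -/
theorem wp_fill {body : Program} {C : ℕ} {g : ℕ → ℕ → ℕ} {s : NatState} {L E : ℕ}
    (he : Env w L E s) (hd : s.reg 22 < L) (hX : 1 ≤ s.reg 23) (hXL : s.reg 23 ≤ L)
    (hb : ∀ r ∈ [10, 11, 22, 23, 24, 25, 26, 28], body.sets r = false)
    (hbody : ∀ s', Frame (fill body) s s' → Agree L (s.reg 22) s.mem s'.mem → 1 ≤ s'.reg 24 →
      s'.reg 24 < s.reg 23 → s'.reg 25 ≤ E → s'.reg 26 = E - s'.reg 25 → s'.reg 28 = E + 1 →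
      (0 < s'.reg 25 → s'.reg 27 = g (s'.reg 26 + 1) (s'.reg 24)) →
      Wp w body (fun s'' => s''.mem = s'.mem ∧ s''.reg 27 = g (s'.reg 26) (s'.reg 24) ∧
        s''.time ≤ s'.time + C) s') :
    Wp w (fill body) (fun s' => Agree L (s.reg 22) s.mem s'.mem ∧
      (∀ i ≤ E, ∀ x, 1 ≤ x → x < s.reg 23 → s'.mem (ad L (s.reg 22) i x) = g i x) ∧
      s'.time ≤ s.time + s.reg 23 * ((E + 1) * (C + 100))) s := by
  have hB := he.lt_pow
  have hL := he.regL
  have hE := he.regE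
  have hlt := he.lt
  have h10 := he.le
  simp only [List.mem_cons, List.not_mem_nil, or_false, forall_eq_or_imp, forall_eq] at hb
  obtain ⟨hb10, hb11, hb22, hb23, hb24, hb25, hb26, hb28⟩ := hb
  have hsets : ∀ r < 100, (fill body).sets r = false →
      body.sets r = false ∧ r ≠ 24 ∧ r ≠ 25 ∧ r ≠ 26 ∧ r ≠ 28 := by
    intro r hr
    simp only [fill, sets_seq, sets_assign _ _ hr, sets_forLt _ _ _ hr, sets_write _ _ hr]
    simp +contextual
  set D := (E + 1) * (C + 80) with hD
  refine .seq (.assign (by norm_num) (by simp; omega) ?_)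
  refine .seq (.assign (by norm_num) (by simp; omega) ?_)
  refine Wp.forLt (fun x s' => Agree L (s.reg 22) s.mem s'.mem ∧
      (∀ i ≤ E, ∀ x', 1 ≤ x' → x' < x → s'.mem (ad L (s.reg 22) i x') = g i x') ∧
      s'.time + D ≤ s.time + 20 + x * D)
    (by norm_num) (by norm_num) (by norm_num) ?_ ?_ (by simpa) ?_ ?_ ?_
  · simp [sets_seq, sets_assign, sets_forLt, sets_write, hb24]
  · simp [sets_seq, sets_assign, sets_forLt, sets_write, hb23]
  · refine ⟨fun _ _ _ _ _ _ => rfl, fun i _ x' h₁ h₂ => ?_, ?_⟩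
    · simp at h₂; omega
    · simp
  · intro x s₁ hx1 hxX hx hfr ⟨hag, hcol, ht⟩
    -- variables that the loops do not change
    have hf : ∀ s₂ : NatState, (∀ r < 100, body.sets r = false → r ≠ 25 → r ≠ 26 →
        s₂.reg r = s₁.reg r) → Frame (fill body) s s₂ := by
      intro s₂ h r hr hset
      obtain ⟨h₁, h₂, h₃, h₄, h₅⟩ := hsets r hr hset
      rw [h r hr h₁ h₃ h₄, hfr r hr (by
        simp [sets_seq, sets_assign, sets_forLt, sets_write, hr, h₁, h₂, h₃, h₄])]
      simp [h₂, h₅]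
    have r10 : s₁.reg 10 = L := by
      rw [hfr 10 (by norm_num) (by simp [sets_seq, sets_assign, sets_forLt, sets_write, hb10])]
      simpa
    have r11 : s₁.reg 11 = E := by
      rw [hfr 11 (by norm_num) (by simp [sets_seq, sets_assign, sets_forLt, sets_write, hb11])]
      simpa
    have r22 : s₁.reg 22 = s.reg 22 := by
      rw [hfr 22 (by norm_num) (by simp [sets_seq, sets_assign, sets_forLt, sets_write, hb22])]
      simp
    have r23 : s₁.reg 23 = s.reg 23 := by
      rw [hfr 23 (by norm_num) (by simp [sets_seq, sets_assign, sets_forLt, sets_write, hb23])]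
      simp
    have r28 : s₁.reg 28 = E + 1 := by
      rw [hfr 28 (by norm_num) (by simp [sets_seq, sets_assign, sets_forLt, sets_write, hb28])]
      simpa
    simp only [NatState.reg_upd] at hx1 hxX
    simp at hx1 hxX
    refine .seq (.assign (by norm_num) (by simp; omega) ?_)
    refine Wp.forLt (fun r s' => Agree L (s.reg 22) s.mem s'.mem ∧
        (∀ i ≤ E, ∀ x', 1 ≤ x' → x' < x → s'.mem (ad L (s.reg 22) i x') = g i x') ∧
        (∀ i ≤ E, E - i < r → s'.mem (ad L (s.reg 22) i x) = g i x) ∧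
        (0 < r → s'.reg 27 = g (E + 1 - r) x) ∧
        s'.time ≤ s₁.time + 10 + r * (C + 50))
      (by norm_num) (by norm_num) (by norm_num) ?_ ?_ (by simp) ?_ ?_ ?_
    · simp [sets_seq, sets_assign, sets_write, hb25]
    · simp [sets_seq, sets_assign, sets_write, hb28]
    · refine ⟨hag, hcol, fun i _ h => ?_, fun h => ?_, ?_⟩
      · simp at h
      · simp at h
      · simp
    · intro r s₂ hr0 hrE hr hfr₂ ⟨hag₂, hcol₂, hrow₂, hbest₂, ht₂⟩
      simp only [NatState.reg_upd, NatState.reg_tick] at hrE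
      simp [r28] at hrE
      have hf₂ : ∀ r < 100, body.sets r = false → r ≠ 25 → r ≠ 26 → s₂.reg r = s₁.reg r := by
        intro r hr h₁ h₂ h₃
        rw [hfr₂ r hr (by simp [sets_seq, sets_assign, sets_write, hr, h₁, h₂, h₃])]
        simp [h₂]
      have r10' := (hf₂ 10 (by norm_num) hb10 (by norm_num) (by norm_num)).trans r10
      have r11' := (hf₂ 11 (by norm_num) hb11 (by norm_num) (by norm_num)).trans r11
      have r22' := (hf₂ 22 (by norm_num) hb22 (by norm_num) (by norm_num)).trans r22
      have r24' := (hf₂ 24 (by norm_num) hb24 (by norm_num) (by norm_num)).trans hx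
      have r28' := (hf₂ 28 (by norm_num) hb28 (by norm_num) (by norm_num)).trans r28
      refine .seq (.assign (by norm_num) (by simp; omega) (.seq ?_))
      refine (hbody _ (hf _ fun r hr h₁ h₂ h₃ => ?_) (by simpa using hag₂) (by simp; omega)
        (by simp; omega) (by simp; omega) (by simp; omega) (by simpa) ?_).frame.mono ?_
      · simp [h₃, hf₂ r hr h₁ h₂ h₃]
      · simp only [NatState.reg_upd, NatState.reg_tick]
        simp only [hr, r24', if_true]
        simpa [hr, r11', show E + 1 - r = E - r + 1 by omega] using hbest₂
      · rintro s₃ ⟨hfr₃, hm₃, hb₃, ht₃⟩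
        have hf₃ : ∀ r < 100, body.sets r = false → s₃.reg r = _ := hfr₃
        have r10'' := hf₃ 10 (by norm_num) hb10
        have r22'' := hf₃ 22 (by norm_num) hb22
        have r24'' := hf₃ 24 (by norm_num) hb24
        have r26'' := hf₃ 26 (by norm_num) hb26
        simp [r10', r22', r24', r11', hr] at r10'' r22'' r24'' r26'' hb₃ hm₃ ht₃
        refine .write ?_ (by simp) ?_
        · exact he.ok_adE (by rw [r10'', hL]) (by simp; omega)
        simp only [NatState.reg_upd, NatState.mem_upd, NatState.time_upd, NatState.reg_put,
          NatState.mem_put, NatState.time_put, eval_adE, Expr.eval_var, r10'', r22'', r24'', r26'',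
          hb₃, hm₃]
        refine ⟨fun q' i x' hi hx' hq => ?_, fun i hi x' h₁ h₂ => ?_, fun i hi h => ?_, fun _ => ?_,
          ?_⟩
        · rw [update_ad _ _ (by omega) (by omega) hi hx', if_neg (by tauto)]
          exact hag₂ q' i x' hi hx' hq
        · rw [update_ad _ _ (by omega) (by omega) (by omega) (by omega), if_neg (by omega)]
          exact hcol₂ i hi x' h₁ h₂
        · rw [update_ad _ _ (by omega) (by omega) (by omega) (by omega)]
          split_ifs with h'
          · rw [h'.2.1]
          · exact hrow₂ i hi (by omega)
        · simp only [show (27 : ℕ) ≠ 25 by norm_num, if_false]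
          rw [show E + 1 - (r + 1) = E - r by omega]
        · simp
          rw [Nat.add_mul]
          omega
    · intro s₂ hr hfr₂ ⟨hag₂, hcol₂, hrow₂, hbest₂, ht₂⟩
      simp only [NatState.reg_upd] at hrow₂ ht₂
      simp [r28] at hrow₂ ht₂
      refine ⟨by simpa using hag₂, fun i hi x' h₁ h₂ => ?_, ?_⟩
      · rcases Nat.lt_succ_iff_lt_or_eq.1 h₂ with h₂ | rfl
        · exact hcol₂ i hi x' h₁ h₂
        · exact hrow₂ i hi
      · simp only [NatState.time_upd, NatState.time_tick]
        have : D = (E + 1) * (C + 50) + (E + 1) * 30 := by rw [hD]; ring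
        have : (x + 1) * D = x * D + D := by ring
        omega
  · intro s₁ hx hfr ⟨hag, hcol, ht⟩
    simp only [NatState.mem_tick, NatState.time_tick]
    simp only [NatState.reg_upd] at hcol ht
    refine ⟨hag, by simpa using hcol, ?_⟩
    simp at ht
    have : s.reg 23 * ((E + 1) * (C + 100)) = s.reg 23 * D + s.reg 23 * ((E + 1) * 20) := by
      rw [hD]; ring
    have h₁ : 1 * (1 * 20) ≤ s.reg 23 * ((E + 1) * 20) :=
      Nat.mul_le_mul hX (Nat.mul_le_mul (by omega) le_rfl)
    have h₂ : 1 * 60 ≤ D := Nat.mul_le_mul (by omega) (by omega)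
    omega

/-! ### The table of a concatenation -/

/-- Compute an entry of the table of a concatenation into register `27`, as the minimum over all
ways to write `x` as a sum `y + z`.  The registers `20` and `21` hold the blocks of the tables of
the two forests, and `37` and `38` hold twice the sizes. -/
def concatEntry : Program :=
  .seq (assign 27 (.var 11 + 1)) (.seq
    (ifLt (.var 38) (.var 24) (assign 30 (.var 24 - .var 38)) (assign 30 0)) (.seq
    (ifLt (.var 37) (.var 24) (assign 31 (.var 37 + 1)) (assign 31 (.var 24 + 1)))
    (forLt 30 31 (.seq (look 20 26 30 32) (.seq (assign 33 (.var 24 - .var 30))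
      (.seq (look 21 32 33 34) (ifLt (.var 34) (.var 27) (assign 27 (.var 34))
        (assign 27 (.var 27)))))))))

theorem wp_concatEntry {α : Type*} [DecidableEq α] {T F G : Forest α} {L : ℕ} {s : NatState}
    (he : Env w L (2 * T.size) s) (hF : IsTab L T s.mem (s.reg 20) F)
    (hG : IsTab L T s.mem (s.reg 21) G) (h37 : s.reg 37 = 2 * F.size)
    (h38 : s.reg 38 = 2 * G.size) (hx : s.reg 24 ≤ 2 * F.size + 2 * G.size) :
    Wp w concatEntry (fun s' => s'.mem = s.mem ∧
      s'.reg 27 = tab T (F + G) (s.reg 26) (s.reg 24) ∧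
      s'.time ≤ s.time + (200 + (2 * min F.size G.size + 1) * 200)) s := by
  have hB := he.lt_pow
  have hE := he.regE
  have hlt := he.lt
  have hFL := hF.size_lt
  have hGL := hG.size_lt
  set x := s.reg 24 with hxdef
  set i := s.reg 26 with hidef
  refine .seq (.assign (by norm_num) (by simp; omega) ?_)
  refine .seq (.ifAssign (x - 2 * G.size) (by norm_num) (by simp) (by simp) ?_ ?_ ?_)
  · simp [h38, ← hxdef]; omega
  · simp [h38, ← hxdef]; omega
  refine .seq (.ifAssign (min (2 * F.size) x + 1) (by norm_num) (by simp) (by simp) ?_ ?_ ?_)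
  · simp [h37, ← hxdef]; omega
  · simp [h37, ← hxdef]; omega
  refine Wp.forLt (fun y s' => s'.mem = s.mem ∧ s'.reg 27 ≤ 2 * T.size + 1 ∧
      (∀ j ≤ 2 * T.size, s'.reg 27 ≤ j ↔ ∃ y', x - 2 * G.size ≤ y' ∧ y' < y ∧
        tab T G (tab T F i y') (x - y') ≤ j) ∧
      s'.time + (x - 2 * G.size) * 200 ≤ s.time + 100 + y * 200)
    (by norm_num) (by norm_num) (by norm_num) (by decide) (by decide) (by simp; omega) ?_ ?_ ?_
  · refine ⟨rfl, by simp [hE], fun j hj => ?_, by simp⟩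
    simp only [NatState.reg_upd]
    simp [hE]
    constructor
    · omega
    · rintro ⟨y', h₁, h₂, _⟩
      omega
  · rintro y s₁ hy1 hy2 hy hfr ⟨hm, hbE, hbest, ht⟩
    simp at hy1 hy2
    have hf := fun r hr h => hfr r hr h
    have r10 : s₁.reg 10 = s.reg 10 := hfr 10 (by norm_num) (by decide)
    have r11 : s₁.reg 11 = s.reg 11 := hfr 11 (by norm_num) (by decide)
    have r20 : s₁.reg 20 = s.reg 20 := hfr 20 (by norm_num) (by decide)
    have r21 : s₁.reg 21 = s.reg 21 := hfr 21 (by norm_num) (by decide)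
    have r24 : s₁.reg 24 = x := hfr 24 (by norm_num) (by decide)
    have r26 : s₁.reg 26 = i := hfr 26 (by norm_num) (by decide)
    refine .seq (.look (F := F) (he.of_reg r10 r11) (by norm_num) (by norm_num) (by norm_num)
      (by norm_num) (by simpa [hm, r20] using hF) ?_)
    refine .seq (.assign (by norm_num) (by simp [r24, hy]; omega) ?_)
    refine .seq (.look (F := G) (he.of_reg (by simpa) (by simpa)) (by norm_num) (by norm_num)
      (by norm_num) (by norm_num) (by simpa [hm, r21] using hG) ?_)
    refine .ifAssign (min (tab T G (tab T F i y) (x - y)) (s₁.reg 27)) (by norm_num) (by simp)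
      (by simp) ?_ ?_ ?_
    · simp [r24, r26, hy]; omega
    · simp [r24, r26, hy]
    · refine ⟨by simpa using hm, by simp [hbE], fun j hj => ?_, by simp; omega⟩
      simp only [NatState.reg_upd]
      simp [hbest j hj]
      constructor
      · rintro (h | ⟨y', h₁, h₂, h⟩)
        · exact ⟨y, by omega, by omega, h⟩
        · exact ⟨y', h₁, by omega, h⟩
      · rintro ⟨y', h₁, h₂, h⟩
        rcases Nat.le_iff_lt_or_eq.1 h₂ with h₂ | rfl
        · exact .inr ⟨y', h₁, h₂, h⟩
        · exact .inl h
  · rintro s₁ - - ⟨hm, hbE, hbest, ht⟩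
    simp only [NatState.reg_upd, if_true] at hbest ht
    refine ⟨hm, eq_tab hbE fun j hj => ?_, ?_⟩
    · rw [NatState.reg_tick, hbest j hj, ← tab_le_iff hj, tab_add_le_iff hj]
      refine exists_congr fun y => ?_
      constructor
      · rintro ⟨h₁, h₂, h⟩
        exact ⟨h₁, by omega, by omega, h⟩
      · rintro ⟨h₁, h₂, h₃, h⟩
        exact ⟨h₁, by omega, h⟩
    · simp only [NatState.time_tick]
      omega

/-- The memories agree on what survives the computation of a table in block `d`: all of the other
blocks except the rows `1` and `2` of block `0`, which are used for the brackets of the tree, and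
the size of the new table. -/
def Keeps (L d : ℕ) (mem mem' : ℕ → ℕ) : Prop :=
  ∀ q i x, i < L → x < L → q ≠ d → ¬ (q = 0 ∧ (i = 1 ∨ i = 2 ∨ i = 6 ∧ x = d)) →
    mem' (ad L q i x) = mem (ad L q i x)

theorem Keeps.isTab {α : Type*} [DecidableEq α] {T F : Forest α} {L d q : ℕ} {mem mem' : ℕ → ℕ}
    (h : Keeps L d mem mem') (hF : IsTab L T mem q F) (hq : q ≠ d) (h0 : d ≠ 0) (hL : 10 ≤ L)
    (hE : 2 * T.size < L) : IsTab L T mem' q F :=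
  hF.congr hE (h _ _ _ (by omega) hF.lt h0.symm (by omega))
    fun hq0 i x hi hx => h q i x hi hx hq (by omega)

/-- Compute the table of a concatenation in the block in register `22` from the tables in the blocks
in the registers `20` and `21`. -/
def concat : Program :=
  .seq (assign 37 (.get (adE 0 6 (.var 20)))) (.seq (assign 38 (.get (adE 0 6 (.var 21))))
    (.seq (assign 23 (.var 37 + .var 38 + 1))
      (.seq (write (adE 0 6 (.var 22)) (.var 37 + .var 38)) (fill concatEntry))))

/-- A max-plus product takes time proportional to the product of the sizes of the forests. -/
theorem wp_concat {α : Type*} [DecidableEq α] {T F G : Forest α} {L : ℕ} {s : NatState}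
    (he : Env w L (2 * T.size) s) (hF : IsTab L T s.mem (s.reg 20) F)
    (hG : IsTab L T s.mem (s.reg 21) G) (hd : s.reg 22 < L) (hd0 : s.reg 22 ≠ 0)
    (hdF : s.reg 20 ≠ s.reg 22) (hdG : s.reg 21 ≠ s.reg 22)
    (hL : 2 * F.size + 2 * G.size < L) :
    Wp w concat (fun s' => IsTab L T s'.mem (s.reg 22) (F + G) ∧ Keeps L (s.reg 22) s.mem s'.mem ∧
      s'.time ≤ s.time + 10000 * ((2 * T.size + 1) * ((F.size + 1) * (G.size + 1)))) s := by
  have hB := he.lt_pow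
  have hE := he.regE
  have hlt := he.lt
  have h10 := he.regL
  have hle := he.le
  have hFX := hF.size_eq
  have hGX := hG.size_eq
  have hFL := hF.lt
  have hGL := hG.lt
  refine .seq (.assign (by norm_num) (he.ok_get (by simp) (by simp; omega)) ?_)
  refine .seq (.assign (by norm_num) (he.ok_get (by simp) (by simp; omega)) ?_)
  refine .seq (.assign (by norm_num) (by simp [h10, hFX, hGX]; omega) ?_)
  refine .seq (.write (he.ok_adE (by simp) (by simp; omega)) (by simp [h10, hFX, hGX]; omega) ?_)
  generalize hs₁ : NatState.put _ _ _ _ = s₁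
  have hreg : ∀ r, r ≠ 37 → r ≠ 38 → r ≠ 23 → s₁.reg r = s.reg r := by
    intro r h₁ h₂ h₃
    rw [← hs₁]
    simp [h₁, h₂, h₃]
  have r37 : s₁.reg 37 = 2 * F.size := by rw [← hs₁]; simp [h10, hFX]
  have r38 : s₁.reg 38 = 2 * G.size := by rw [← hs₁]; simp [h10, hGX]
  have r23 : s₁.reg 23 = 2 * F.size + 2 * G.size + 1 := by rw [← hs₁]; simp [h10, hFX, hGX]
  have r20 : s₁.reg 20 = s.reg 20 := hreg 20 (by norm_num) (by norm_num) (by norm_num)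
  have r21 : s₁.reg 21 = s.reg 21 := hreg 21 (by norm_num) (by norm_num) (by norm_num)
  have r22 : s₁.reg 22 = s.reg 22 := hreg 22 (by norm_num) (by norm_num) (by norm_num)
  have hm : s₁.mem = Function.update s.mem (ad L 0 6 (s.reg 22)) (2 * F.size + 2 * G.size) := by
    rw [← hs₁]; simp [h10, hFX, hGX]
  have ht : s₁.time ≤ s.time + 100 := by rw [← hs₁]; simp
  clear hs₁
  have he₁ : Env w L (2 * T.size) s₁ := he.of_reg (hreg 10 (by norm_num) (by norm_num) (by norm_num))
    (hreg 11 (by norm_num) (by norm_num) (by norm_num))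
  have hk₁ : Keeps L (s.reg 22) s.mem s₁.mem := by
    intro q i x hi hx hq h
    rw [hm, update_ad _ _ (by omega) hd hi hx, if_neg (by tauto)]
  have hF₁ := hk₁.isTab hF hdF hd0 hle (by omega)
  have hG₁ := hk₁.isTab hG hdG hd0 hle (by omega)
  have hfill := wp_fill (body := concatEntry) (C := 200 + (2 * min F.size G.size + 1) * 200)
    (g := fun i x => tab T (F + G) i x) he₁ (by omega) (by omega) (by omega) (by decide)
    fun s₂ hfr hag h₁ h₂ h₃ h₄ h₅ h₆ => by
      have hF₂ := hag.isTab hF₁ (r22 ▸ hdF) (r22 ▸ hd0) hle (by omega)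
      have hG₂ := hag.isTab hG₁ (r22 ▸ hdG) (r22 ▸ hd0) hle (by omega)
      have f (r : ℕ) (hr : r < 100) (h : (fill concatEntry).sets r = false) := hfr r hr h
      exact wp_concatEntry
        (he₁.of_reg (f 10 (by norm_num) (by decide)) (f 11 (by norm_num) (by decide)))
        (by rwa [f 20 (by norm_num) (by decide), r20]) (by rwa [f 21 (by norm_num) (by decide), r21])
        ((f 37 (by norm_num) (by decide)).trans r37) ((f 38 (by norm_num) (by decide)).trans r38)
        (by omega)
  refine hfill.mono fun s₂ ⟨hag, hent, ht₂⟩ => ?_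
  rw [r22] at hag hent
  refine ⟨⟨hd, by simp; omega, fun h => (hd0 h).elim, ?_,
    fun i hi x hx hx' => hent i hi x hx (by simp at hx'; omega)⟩,
    fun q i x hi hx hq h => ?_, ?_⟩
  · rw [hag _ _ _ (by omega) hd hd0.symm, hm, Function.update_self, size_add]
    ring
  · rw [hag _ _ _ hi hx hq, hk₁ q i x hi hx hq h]
  · -- an entry in column `x` is a minimum over `x - 2 |G| ≤ y ≤ min x (2 |F|)`, so the number of
    -- terms is bounded by the smaller of the two sizes, and that of columns by their sum
    rw [r23] at ht₂
    have h₁ : (2 * F.size + 2 * G.size + 1) * (2 * min F.size G.size + 2) ≤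
        8 * ((F.size + 1) * (G.size + 1)) := by
      rcases le_total F.size G.size with h | h
      · rw [min_eq_left h]; nlinarith
      · rw [min_eq_right h]; nlinarith
    have h₂ : (2 * F.size + 2 * G.size + 1) * ((2 * T.size + 1) *
        (200 + (2 * min F.size G.size + 1) * 200 + 100)) ≤
        300 * ((2 * T.size + 1) * (8 * ((F.size + 1) * (G.size + 1)))) := by
      calc _ ≤ 300 * ((2 * T.size + 1) * ((2 * F.size + 2 * G.size + 1) *
            (2 * min F.size G.size + 2))) := by
            have : 200 + (2 * min F.size G.size + 1) * 200 + 100 ≤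
              300 * (2 * min F.size G.size + 2) := by omega
            calc _ ≤ (2 * F.size + 2 * G.size + 1) * ((2 * T.size + 1) *
                  (300 * (2 * min F.size G.size + 2))) := by gcongr
              _ = _ := by ring
        _ ≤ _ := by gcongr
    have h₃ : 1 ≤ (2 * T.size + 1) * ((F.size + 1) * (G.size + 1)) := Nat.mul_pos (by omega)
      (Nat.mul_pos (by omega) (by omega))
    have h₄ : (2 * T.size + 1) * (8 * ((F.size + 1) * (G.size + 1))) =
      8 * ((2 * T.size + 1) * ((F.size + 1) * (G.size + 1))) := by ring
    omega

/-! ### The recursion for a tree, row by row -/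

namespace Forest

variable {σ : ℕ}

theorem brackets_drop (ts : List ℕ) {p i e : ℕ} (h : p + i ≤ e) :
    (brackets (ts.drop i) (p + i)).2 e = (brackets ts p).2 e := by
  induction ts generalizing p i with
  | nil => simp [brackets]
  | cons t ts ih =>
    rcases i with _ | i
    · simp
    · rw [List.drop_succ_cons, show p + (i + 1) = p + 1 + i by omega, ih (by omega), brackets]
      split_ifs
      · rfl
      · exact (Function.update_of_ne (by omega) _ _).symm

theorem NodeAt.unique {T : Forest (Fin σ)} {e f f' : ℕ} {b b' : Fin σ} (h : NodeAt T e f b)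
    (h' : NodeAt T e f' b') : f = f' ∧ b = b' := by
  refine ⟨h.brackets_eq.symm.trans h'.brackets_eq, ?_⟩
  have := h.getD_encodeForest.symm.trans h'.getD_encodeForest
  exact Fin.ext (by omega)

theorem tab_tree_of_forall_not {T : Forest (Fin σ)} {i : ℕ} (h : ∀ f b, ¬ NodeAt T i f b)
    (a : Fin σ) (c : Forest (Fin σ)) (x : ℕ) :
    tab T (cons a c nil) i x = min (tab T c i x) (tab T (cons a c nil) (i + 1) x) := by
  symm
  refine eq_tab (min_le_of_left_le (tab_le _ _ _ _)) fun j hj => ?_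
  rw [← tab_le_iff hj, tab_tree_le_iff hj, min_le_iff]
  simp only [h, false_and, exists_false, or_false]

theorem tab_tree_of_nodeAt {T : Forest (Fin σ)} {i f : ℕ} {b : Fin σ} (h : NodeAt T i f b)
    (a : Fin σ) (c : Forest (Fin σ)) (x : ℕ) :
    tab T (cons a c nil) i x = min (if f < tab T c (i + 1) (x - score a b) then 2 * T.size + 1
      else f + 1) (min (tab T c i x) (tab T (cons a c nil) (i + 1) x)) := by
  symm
  refine eq_tab (min_le_of_right_le (min_le_of_left_le (tab_le _ _ _ _))) fun j hj => ?_
  rw [← tab_le_iff hj, tab_tree_le_iff hj, min_le_iff, min_le_iff]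
  have : (∃ f b, NodeAt T i f b ∧ f + 1 ≤ j ∧ tab T c (i + 1) (x - score a b) ≤ f) ↔
      f + 1 ≤ j ∧ tab T c (i + 1) (x - score a b) ≤ f := by
    constructor
    · rintro ⟨f', b', h', hf⟩
      obtain ⟨rfl, rfl⟩ := h.unique h'
      exact hf
    · exact fun hf => ⟨f, b, h, hf⟩
  rw [this]
  split_ifs with hlt <;> omega

end Forest

/-! ### The brackets of the tree -/

/-- The memory contains the encoding of `T`. -/
def HasTree {σ : ℕ} (mem : ℕ → ℕ) (T : Forest (Fin σ)) : Prop :=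
  ∀ e < 2 * T.size, mem (e + 2) = (encodeForest T).getD e 0

/-- The list `l` is stored as a stack, with its last element at the bottom in cell `0`. -/
def IsStack (mem : ℕ → ℕ) : List ℕ → Prop
  | [] => True
  | p :: ps => mem ps.length = p ∧ IsStack mem ps

theorem IsStack.congr {mem mem' : ℕ → ℕ} {l : List ℕ} (h : IsStack mem l)
    (hm : ∀ x < l.length, mem' x = mem x) : IsStack mem' l := by
  induction l with
  | nil => trivial
  | cons p ps ih =>
    exact ⟨(hm _ (by simp)).trans h.1, ih h.2 fun x hx => hm x (by simp; omega)⟩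

/-- Read the tree from right to left with a stack in row `2` of block `0`, and store the position of
the matching closing bracket for every opening bracket in row `1`. -/
def matchBrackets : Program :=
  .seq (assign 41 0) (.seq (assign 40 0) (forLt 40 11 (.seq (assign 42 (.var 11 - .var 40 - 1))
    (.seq (assign 43 (.get (.var 42 + 2)))
      (ifLt 0 (.var 43)
        (.seq (assign 41 (.var 41 - 1)) (write (adE 0 1 (.var 42)) (.get (adE 0 2 (.var 41)))))
        (.seq (write (adE 0 2 (.var 41)) (.var 42)) (assign 41 (.var 41 + 1))))))))

theorem wp_matchBrackets {σ : ℕ} {T : Forest (Fin σ)} {L : ℕ} {s : NatState}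
    (he : Env w L (2 * T.size) s) (hT : HasTree s.mem T) :
    Wp w matchBrackets (fun s' => (∀ e f b, NodeAt T e f b → s'.mem (ad L 0 1 e) = f) ∧
      (∀ q i x, i < L → x < L → ¬ (q = 0 ∧ (i = 1 ∨ i = 2)) →
        s'.mem (ad L q i x) = s.mem (ad L q i x)) ∧
      s'.time ≤ s.time + 100 * (2 * T.size + 1)) s := by
  have hB := he.lt_pow
  have hE := he.regE
  have hlt := he.lt
  have h10 := he.regL
  have hle := he.le
  set ts := encodeForest T with hts
  have hlen : ts.length = 2 * T.size := length_encodeForest T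
  refine .seq (.assign (by norm_num) (by simp; omega) ?_)
  refine .seq (.assign (by norm_num) (by simp; omega) ?_)
  refine Wp.forLt (fun r s' =>
      s'.reg 41 = (brackets (ts.drop (2 * T.size - r)) (2 * T.size - r)).1.length ∧
      IsStack (fun x => s'.mem (ad L 0 2 x))
        (brackets (ts.drop (2 * T.size - r)) (2 * T.size - r)).1 ∧
      (∀ e f b, NodeAt T e f b → 2 * T.size - r ≤ e → s'.mem (ad L 0 1 e) = f) ∧
      (∀ q i x, i < L → x < L → ¬ (q = 0 ∧ (i = 1 ∨ i = 2)) →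
        s'.mem (ad L q i x) = s.mem (ad L q i x)) ∧ s'.time ≤ s.time + 10 + r * 100)
    (by norm_num) (by norm_num) (by norm_num) (by decide) (by decide) (by simp) ?_ ?_ ?_
  · have : ts.drop (2 * T.size - 0) = [] := List.drop_eq_nil_of_le (by omega)
    simp only [NatState.reg_upd, if_true, Expr.eval_lit, this, brackets]
    refine ⟨by simp, trivial, fun e f b h hle => ?_, fun _ _ _ _ _ _ => rfl, by simp⟩
    have := h.lt
    omega
  · rintro r s₁ - hr hr' hfr ⟨hd, hst, hex, hm, ht⟩
    simp [hE] at hr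
    have r10 : s₁.reg 10 = L := (hfr 10 (by norm_num) (by decide)).trans h10
    have r11 : s₁.reg 11 = 2 * T.size := (hfr 11 (by norm_num) (by decide)).trans hE
    obtain ⟨i, hi⟩ : ∃ i, 2 * T.size - r = i + 1 := ⟨2 * T.size - r - 1, by omega⟩
    have hi' : 2 * T.size - (r + 1) = i := by omega
    have hi1 : 2 * T.size - r - 1 = i := by omega
    rw [hi] at hd hst hex
    rw [hi']
    have hdrop : ts.drop i = ts.getD i 0 :: ts.drop (i + 1) := by
      rw [List.drop_eq_getElem_cons (by omega)]
      congr 1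
      rw [List.getD_eq_getElem _ _ (by omega)]
    have hdL : s₁.reg 41 ≤ 2 * T.size - 1 - i := by
      have := length_brackets_le (ts.drop (i + 1)) (i + 1)
      rw [List.length_drop] at this
      omega
    obtain ⟨tok, htok⟩ : ∃ tok, ts.getD i 0 = tok := ⟨_, rfl⟩
    have hget : s₁.mem (i + 2) = tok := by
      have := hm 0 0 (i + 2) (by omega) (by omega) (by omega)
      rw [ad_zero] at this
      rw [this, hT i (by omega), ← hts, htok]
    rw [htok] at hdrop
    refine .seq (.assign (by norm_num) (by simp [r11, hr']; omega) ?_)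
    refine .seq (.assign (by norm_num) (by simp [r11, hr', hi1]; omega) ?_)
    generalize hs₂ : NatState.upd _ _ _ _ = s₂
    have t10 : s₂.reg 10 = L := by rw [← hs₂]; simp [r10]
    have t41 : s₂.reg 41 = s₁.reg 41 := by rw [← hs₂]; simp
    have t42 : s₂.reg 42 = i := by rw [← hs₂]; simp [r11, hr', hi1]
    have t43 : s₂.reg 43 = tok := by rw [← hs₂]; simp [r11, hr', hi1, hget]
    have tm : s₂.mem = s₁.mem := by rw [← hs₂]; simp
    have tt : s₂.time ≤ s₁.time + 30 := by rw [← hs₂]; simp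
    clear hs₂
    refine .ifLt (by simp; omega) (by simp) (fun hpos => ?_) (fun hzero => ?_)
    · simp [t43] at hpos
      obtain ⟨f, b, hn⟩ := exists_nodeAt (T := T) (e := i) (by rw [← hts, htok]; omega)
      have hnlt := hn.lt
      have hf : (brackets (ts.drop (i + 1)) (i + 1)).1.headD 0 = f := by
        rw [← hn.brackets_eq, ← hts, ← brackets_drop ts (p := 0) (i := i) (by omega), hdrop,
          zero_add, brackets, if_neg (by omega)]
        simp
      rw [hdrop, brackets, if_neg (by omega)]
      obtain ⟨ps, hps⟩ : ∃ ps, (brackets (ts.drop (i + 1)) (i + 1)).1 = f :: ps := by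
        rcases hb : (brackets (ts.drop (i + 1)) (i + 1)).1 with _ | ⟨p, ps⟩
        · rw [hb] at hf
          simp at hf
          omega
        · rw [hb] at hf
          simp at hf
          exact ⟨ps, by rw [hf]⟩
      rw [hps] at hd hst
      rw [hps]
      simp at hd
      refine .seq (.assign (by norm_num) (by simp [t41, hd]; omega) ?_)
      refine .write (he.ok_adE (by simp [t10, h10]) (by simp [t42]; omega))
        (he.ok_get (by simp [t10, h10]) (by simp [t41, hd]; omega)) ?_
      have hst1 : s₁.mem (ad L 0 2 ps.length) = f := hst.1
      simp [t10, t41, t42, hd, tm, hst1]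
      refine ⟨?_, ?_, ?_, ?_⟩
      · refine hst.2.congr fun x hx => ?_
        rw [update_ad _ _ (by omega) (by omega) (by omega) (by omega), if_neg (by omega)]
      · intro e f' b' hn' hle'
        have hnlt' := hn'.lt
        rw [update_ad _ _ (by omega) (by omega) (by omega) (by omega)]
        rcases Nat.lt_or_eq_of_le hle' with hlt' | rfl
        · rw [if_neg (by omega)]
          exact hex e f' b' hn' hlt'
        · rw [if_pos (by simp)]
          exact (hn.unique hn').1
      · intro q i' x hi' hx h
        rw [update_ad _ _ (by omega) (by omega) (by omega) (by omega), if_neg (by omega)]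
        exact hm q i' x hi' hx (by omega)
      · omega
    · simp [t43] at hzero
      rw [hdrop, brackets, if_pos hzero]
      refine .seq (.write (he.ok_adE (by simp [t10, h10]) (by simp [t41]; omega)) (by simp) ?_)
      refine .assign (by norm_num) (by simp [t41]; omega) ?_
      simp [t10, t41, t42, tm]
      refine ⟨hd, ⟨?_, ?_⟩, ?_, ?_, ?_⟩
      · simp [← hd]
      · refine hst.congr fun x hx => ?_
        rw [update_ad _ _ (by omega) (by omega) (by omega) (by omega), if_neg (by omega)]
      · intro e f' b' hn' hle'
        have hnlt' := hn'.lt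
        rw [update_ad _ _ (by omega) (by omega) (by omega) (by omega), if_neg (by omega)]
        rcases Nat.lt_or_eq_of_le hle' with hlt' | rfl
        · exact hex e f' b' hn' hlt'
        · have := hn'.getD_encodeForest
          rw [← hts, htok] at this
          omega
      · intro q i' x hi' hx h
        rw [update_ad _ _ (by omega) (by omega) (by omega) (by omega), if_neg (by omega)]
        exact hm q i' x hi' hx (by omega)
      · omega
  · rintro s₁ - - ⟨-, -, hex, hm, ht⟩
    simp only [NatState.reg_upd] at hex ht
    simp [hE] at hex ht
    exact ⟨fun e f b h => hex e f b h, hm, by simp; omega⟩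

/-! ### The table of a tree -/

/-- Compute an entry of the table of a tree into register `27`, which holds the entry in the row
below, unless this is the last row.  Register `29` holds the code of the label of the root, and
register `21` the block of the table of the forest below the root. -/
def treeEntry : Program :=
  .seq (ifLt (.var 25) 1 (assign 27 (.var 11 + 1)) (assign 27 (.var 27))) (.seq
    (look 21 26 24 32) (.seq
    (ifLt (.var 32) (.var 27) (assign 27 (.var 32)) (assign 27 (.var 27)))
    (ifLt (.var 26) (.var 11) (.seq (assign 35 (.get (.var 26 + 2))) (ifLt 0 (.var 35)
      (.seq (assign 36 2) (.seq
        (ifLt (.var 35) (.var 29) (assign 36 1) (assign 36 (.var 36))) (.seq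
        (ifLt (.var 29) (.var 35) (assign 36 1) (assign 36 (.var 36))) (.seq
        (ifLt (.var 36) (.var 24) (assign 33 (.var 24 - .var 36)) (assign 33 0)) (.seq
        (assign 39 (.var 26 + 1)) (.seq
        (look 21 39 33 34) (.seq
        (assign 44 (.get (adE 0 1 (.var 26)))) (.seq
        (ifLt (.var 44) (.var 34) (assign 45 (.var 11 + 1)) (assign 45 (.var 44 + 1)))
        (ifLt (.var 45) (.var 27) (assign 27 (.var 45)) (assign 27 (.var 27))))))))))) .skip))
      .skip)))

theorem wp_treeEntry {σ : ℕ} {T c : Forest (Fin σ)} {a : Fin σ} {L : ℕ} {s : NatState}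
    (he : Env w L (2 * T.size) s) (hT : HasTree s.mem T)
    (hN : ∀ e f b, NodeAt T e f b → s.mem (ad L 0 1 e) = f) (hc : IsTab L T s.mem (s.reg 21) c)
    (h29 : s.reg 29 = a + 1) (h25 : s.reg 25 ≤ 2 * T.size) (h26 : s.reg 26 = 2 * T.size - s.reg 25)
    (h27 : 0 < s.reg 25 → s.reg 27 = tab T (cons a c nil) (s.reg 26 + 1) (s.reg 24)) :
    Wp w treeEntry (fun s' => s'.mem = s.mem ∧
      s'.reg 27 = tab T (cons a c nil) (s.reg 26) (s.reg 24) ∧ s'.time ≤ s.time + 500) s := by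
  have hB := he.lt_pow
  have hE := he.regE
  have hlt := he.lt
  have h10 := he.regL
  set x := s.reg 24 with hx
  set i := s.reg 26 with hi
  -- in the last row, the entry below counts as infinite
  refine .seq (.ifAssign (tab T (cons a c nil) (i + 1) x) (by norm_num) (by simp)
    (by simp; omega) ?_ ?_ ?_)
  · intro h
    simp at h
    rw [tab_of_lt _ _ (by omega)]
    simp [hE]; omega
  · intro h
    simp at h
    simp [h27 (by omega)]
  refine .seq (.look (F := c) (he.of_reg (by simp) (by simp)) (by norm_num) (by norm_num)
    (by norm_num) (by norm_num) (by simpa using hc) ?_)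
  refine .seq (.ifAssign (min (tab T c i x) (tab T (cons a c nil) (i + 1) x)) (by norm_num)
    (by simp) (by simp) ?_ ?_ ?_)
  · simp [← hx, ← hi]; omega
  · simp [← hx, ← hi]
  generalize hs₁ : NatState.upd _ _ _ _ = s₁
  have hreg : ∀ r, r ≠ 27 → r ≠ 32 → s₁.reg r = s.reg r := by
    intro r h₁ h₂
    rw [← hs₁]
    simp [h₁, h₂]
  have t10 : s₁.reg 10 = s.reg 10 := hreg 10 (by norm_num) (by norm_num)
  have t11 : s₁.reg 11 = s.reg 11 := hreg 11 (by norm_num) (by norm_num)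
  have t21 : s₁.reg 21 = s.reg 21 := hreg 21 (by norm_num) (by norm_num)
  have t24 : s₁.reg 24 = x := hreg 24 (by norm_num) (by norm_num)
  have t26 : s₁.reg 26 = i := hreg 26 (by norm_num) (by norm_num)
  have t29 : s₁.reg 29 = a + 1 := (hreg 29 (by norm_num) (by norm_num)).trans h29
  have t27 : s₁.reg 27 = min (tab T c i x) (tab T (cons a c nil) (i + 1) x) := by
    rw [← hs₁]; simp
  have tm : s₁.mem = s.mem := by rw [← hs₁]; simp
  have tt : s₁.time ≤ s.time + 120 := by rw [← hs₁]; simp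
  clear hs₁
  have hend : (∀ f b, ¬ NodeAt T i f b) → ∀ n ≤ 100, (s₁.tick n).mem = s.mem ∧
      (s₁.tick n).reg 27 = tab T (cons a c nil) i x ∧ (s₁.tick n).time ≤ s.time + 500 := by
    intro h n hn
    refine ⟨tm, ?_, by simp; omega⟩
    rw [tab_tree_of_forall_not h, ← t27, NatState.reg_tick]
  refine .ifLt (by simp) (by simp) (fun hlti => ?_) (fun hge => ?_)
  swap
  · refine .skip ?_
    simp [t26, t11, hE] at hge
    have := hend (fun f b h => by have := h.lt; omega)
    simp
    refine ⟨tm, (this 0 (by omega)).2.1, by omega⟩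
  simp [t26, t11, hE] at hlti
  refine .seq (.assign (by norm_num) (by simp [t26]; omega) ?_)
  simp only [Expr.eval_get, Expr.eval_add, Expr.eval_var, Expr.eval_lit, NatState.reg_tick,
    NatState.mem_tick, t26, tm, hT i hlti]
  refine .ifLt (by simp; omega) (by simp) (fun hpos => ?_) (fun hzero => ?_)
  swap
  · refine .skip ?_
    simp only [Expr.eval_lit, Expr.eval_var, NatState.reg_upd, if_true] at hzero
    have := hend (fun f b h => by have := h.getD_encodeForest; omega)
    simp
    refine ⟨tm, (this 0 (by omega)).2.1, by omega⟩
  simp only [Expr.eval_lit, Expr.eval_var, NatState.reg_upd, if_true] at hpos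
  obtain ⟨f, b, hn⟩ := exists_nodeAt (T := T) (e := i) (by omega)
  have hnlt := hn.lt
  simp only [hn.getD_encodeForest]
  have hab : a = b ↔ (a : ℕ) = b := Fin.ext_iff
  refine .seq (.assign (by norm_num) (by simp; omega) ?_)
  refine .seq (.ifAssign (if (b : ℕ) < a then 1 else 2) (by norm_num) (by simp) (by simp) ?_ ?_ ?_)
  · simp +contextual [t29]; omega
  · simp +contextual [t29]
  refine .seq (.ifAssign (score a b) (by norm_num) (by simp) (by simp) ?_ ?_ ?_)
  · intro h
    simp [t29] at h
    unfold score
    rw [if_neg (by omega)]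
    simp; omega
  · intro h
    simp [t29] at h
    unfold score
    simp only [Expr.ok_var, Expr.eval_var, NatState.reg_upd, if_true, hab]
    refine ⟨by norm_num, ?_⟩
    split_ifs <;> omega
  refine .seq (.ifAssign (x - score a b) (by norm_num) (by simp) (by simp) ?_ ?_ ?_)
  · simp [t24]; omega
  · simp [t24]; omega
  refine .seq (.assign (by norm_num) (by simp [t26]; omega) ?_)
  refine .seq (.look (F := c) (he.of_reg (by simp [t10]) (by simp [t11])) (by norm_num)
    (by norm_num) (by norm_num) (by norm_num) (by simpa [tm, t21] using hc) ?_)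
  refine .seq (.assign (by norm_num) (he.ok_get (by simp [t10]) (by simp [t26]; omega)) ?_)
  refine .seq (.ifAssign (if f < tab T c (i + 1) (x - score a b) then 2 * T.size + 1 else f + 1)
    (by norm_num) (by simp) (by simp) ?_ ?_ ?_)
  · intro h
    simp [t26, t10, h10, tm, hN i f b hn] at h
    simp [h, t11, hE]; omega
  · intro h
    simp [t26, t10, h10, tm, hN i f b hn] at h
    simp [t26, t10, h10, tm, hN i f b hn, not_lt.2 h]; omega
  refine .ifAssign (tab T (cons a c nil) i x) (by norm_num) (by simp) (by simp) ?_ ?_ ?_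
  · rw [tab_tree_of_nodeAt hn, ← t27]
    simp; omega
  · rw [tab_tree_of_nodeAt hn, ← t27]
    simp
  · simp [tm]; omega

/-- Compute the table of a tree in the block in register `22`. -/
def tree : Program :=
  .seq matchBrackets (.seq (assign 23 (.get (adE 0 6 (.var 21)) + 3))
    (.seq (write (adE 0 6 (.var 22)) (.var 23 - 1)) (fill treeEntry)))

theorem wp_tree {σ : ℕ} {T c : Forest (Fin σ)} {a : Fin σ} {L : ℕ} {s : NatState}
    (he : Env w L (2 * T.size) s) (hT : HasTree s.mem T) (hc : IsTab L T s.mem (s.reg 21) c)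
    (h29 : s.reg 29 = a + 1) (hd : s.reg 22 < L) (hd0 : s.reg 22 ≠ 0)
    (hdc : s.reg 21 ≠ s.reg 22) (hL : 2 * c.size + 2 < L) :
    Wp w tree (fun s' => IsTab L T s'.mem (s.reg 22) (cons a c nil) ∧
      Keeps L (s.reg 22) s.mem s'.mem ∧
      s'.time ≤ s.time + 10000 * ((2 * T.size + 1) * (c.size + 1))) s := by
  have hB := he.lt_pow
  have hE := he.regE
  have hlt := he.lt
  have h10 := he.regL
  have hle := he.le
  have hcL := hc.lt
  refine .seq ((wp_matchBrackets he hT).frame.mono fun s₁ ⟨hfr₁, hN₁, hm₁, ht₁⟩ => ?_)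
  have u10 : s₁.reg 10 = s.reg 10 := hfr₁ 10 (by norm_num) (by decide)
  have u11 : s₁.reg 11 = s.reg 11 := hfr₁ 11 (by norm_num) (by decide)
  have u21 : s₁.reg 21 = s.reg 21 := hfr₁ 21 (by norm_num) (by decide)
  have u22 : s₁.reg 22 = s.reg 22 := hfr₁ 22 (by norm_num) (by decide)
  have u29 : s₁.reg 29 = s.reg 29 := hfr₁ 29 (by norm_num) (by decide)
  have hcX : s₁.mem (ad L 0 6 (s.reg 21)) = 2 * c.size := by
    rw [hm₁ _ _ _ (by omega) hcL (by omega), hc.size_eq]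
  refine .seq (.assign (by norm_num) ?_ ?_)
  · refine (Expr.ok_add ..).2 ⟨he.ok_get u10 (by simp [u21]; omega), by simp; omega, ?_⟩
    simp [u10, u21, h10, hcX]; omega
  refine .seq (.write (he.ok_adE (by simp [u10]) (by simp [u22]; omega))
    (by simp [u10, u21, h10, hcX]; omega) ?_)
  generalize hs₂ : NatState.put _ _ _ _ = s₂
  have hreg : ∀ r, r ≠ 23 → s₂.reg r = s₁.reg r := by
    intro r h₁
    rw [← hs₂]
    simp [h₁]
  have t10 : s₂.reg 10 = s.reg 10 := (hreg 10 (by norm_num)).trans u10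
  have t11 : s₂.reg 11 = s.reg 11 := (hreg 11 (by norm_num)).trans u11
  have t21 : s₂.reg 21 = s.reg 21 := (hreg 21 (by norm_num)).trans u21
  have t22 : s₂.reg 22 = s.reg 22 := (hreg 22 (by norm_num)).trans u22
  have t29 : s₂.reg 29 = s.reg 29 := (hreg 29 (by norm_num)).trans u29
  have t23 : s₂.reg 23 = 2 * c.size + 3 := by rw [← hs₂]; simp [u10, u21, h10, hcX]
  have hm₂ : s₂.mem = Function.update s₁.mem (ad L 0 6 (s.reg 22)) (2 * c.size + 2) := by
    rw [← hs₂]; simp [u10, u21, u22, h10, hcX]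
  have ht₂ : s₂.time ≤ s₁.time + 100 := by rw [← hs₂]; simp
  clear hs₂
  have he₂ : Env w L (2 * T.size) s₂ := he.of_reg t10 t11
  have hk₂ : Keeps L (s.reg 22) s.mem s₂.mem := by
    intro q i x hi hx hq h
    rw [hm₂, update_ad _ _ (by omega) hd hi hx, if_neg (by tauto), hm₁ q i x hi hx (by tauto)]
  have hN₂ : ∀ e f b, NodeAt T e f b → s₂.mem (ad L 0 1 e) = f := by
    intro e f b h
    have := h.lt
    rw [hm₂, update_ad _ _ (by omega) hd (by omega) (by omega), if_neg (by omega), hN₁ e f b h]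
  have hc₂ := hk₂.isTab hc hdc hd0 hle (by omega)
  have hT₂ : HasTree s₂.mem T := by
    intro e h
    have := hk₂ 0 0 (e + 2) (by omega) (by omega) hd0.symm (by omega)
    rw [ad_zero] at this
    rw [this, hT e h]
  have hfill := wp_fill (body := treeEntry) (C := 500) (g := fun i x => tab T (cons a c nil) i x)
    he₂ (by omega) (by omega) (by omega) (by decide)
    fun s₃ hfr hag h₁ h₂ h₃ h₄ h₅ h₆ => by
      have hc₃ := hag.isTab hc₂ (t22 ▸ hdc) (t22 ▸ hd0) hle (by omega)
      have f (r : ℕ) (hr : r < 100) (h : (fill treeEntry).sets r = false) := hfr r hr h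
      refine wp_treeEntry
        (he₂.of_reg (f 10 (by norm_num) (by decide)) (f 11 (by norm_num) (by decide)))
        ?_ ?_ (by rwa [f 21 (by norm_num) (by decide), t21])
        ((f 29 (by norm_num) (by decide)).trans (t29.trans h29)) h₃ h₄ h₆
      · intro e h
        have := hag 0 0 (e + 2) (by omega) (by omega) (by omega)
        rw [ad_zero] at this
        rw [this, hT₂ e h]
      · intro e f b h
        have := h.lt
        rw [hag _ _ _ (by omega) (by omega) (by omega), hN₂ e f b h]
  refine hfill.mono fun s₃ ⟨hag, hent, ht₃⟩ => ?_
  rw [t22] at hag hent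
  refine ⟨⟨hd, by simp; omega, fun h => (hd0 h).elim, ?_, fun i hi x hx hx' =>
    hent i hi x hx (by simp at hx'; omega)⟩, fun q i x hi hx hq h => ?_, ?_⟩
  · rw [hag _ _ _ (by omega) hd hd0.symm, hm₂, Function.update_self]
    simp
    ring
  · rw [hag _ _ _ hi hx hq, hk₂ q i x hi hx hq h]
  · rw [t23] at ht₃
    nlinarith [Nat.zero_le (T.size * c.size)]

/-! ### Tables of an encoded forest -/

namespace Forest

variable {σ : ℕ}

/-- The reader never leaves a node that it has not entered. -/
def Reader.Safe : List (Option (Fin σ)) → Reader σ → Prop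
  | [], _ => True
  | t :: ts, r => (t = none → r.1 ≠ []) ∧ Safe ts (r.step t)

theorem Reader.safe_append {ts us : List (Option (Fin σ))} {r : Reader σ} (h : Safe ts r)
    (h' : Safe us (ts.foldl Reader.step r)) : Safe (ts ++ us) r := by
  induction ts generalizing r with
  | nil => exact h'
  | cons t ts ih => exact ⟨h.1, ih h.2 h'⟩

theorem safe_tokens (F : Forest (Fin σ)) (st : List (Fin σ × Forest (Fin σ)))
    (A : Forest (Fin σ)) : Reader.Safe (tokens F) (st, A) := by
  induction F generalizing st A with
  | nil => trivial
  | cons a c s ihc ihs =>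
    refine ⟨by simp, Reader.safe_append (ihc _ _) ⟨fun _ => ?_, ?_⟩⟩
    · simp [Reader.step, foldl_step_tokens]
    · simpa only [Reader.step, foldl_step_tokens] using ihs _ _

/-- The number of nodes that the reader has entered. -/
def Reader.entered (r : Reader σ) : ℕ := (r.1.map fun p => p.2.size + 1).sum + r.2.size

theorem Reader.length_add_size_le_entered (r : Reader σ) : r.1.length + r.2.size ≤ r.entered := by
  obtain ⟨st, C⟩ := r
  induction st with
  | nil => simp [entered]
  | cons p st ih => simp [entered] at ih ⊢; omega

theorem Reader.entered_step_le (r : Reader σ) (t : Option (Fin σ)) :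
    (r.step t).entered ≤ r.entered + 1 := by
  obtain ⟨st, A⟩ := r
  rcases t with _ | a
  · rcases st with _ | ⟨⟨a, B⟩, st⟩
    · simp [Reader.step, Reader.entered]
    · simp [Reader.step, Reader.entered]
      omega
  · simp [Reader.step, Reader.entered]
    omega

end Forest

/-- The memories agree on the blocks below `n`, except for the brackets and the stacks in block `0`
and the sizes of the tables in the blocks from `n` on. -/
def Below (L n : ℕ) (mem mem' : ℕ → ℕ) : Prop :=
  ∀ q i x, i < L → x < L → q < n →
    ¬ (q = 0 ∧ (i = 1 ∨ i = 2 ∨ i = 4 ∨ i = 5 ∨ i = 6 ∧ n ≤ x)) →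
    mem' (ad L q i x) = mem (ad L q i x)

theorem Below.refl (L n : ℕ) (mem : ℕ → ℕ) : Below L n mem mem := fun _ _ _ _ _ _ _ => rfl

theorem Below.trans {L n n' : ℕ} {mem mem' mem'' : ℕ → ℕ} (h : Below L n mem mem')
    (h' : Below L n' mem' mem'') (hn : n ≤ n') : Below L n mem mem'' := fun q i x hi hx hq hne => by
  rw [h' q i x hi hx (by omega) (by omega), h q i x hi hx hq hne]

theorem Keeps.below {L d n : ℕ} {mem mem' : ℕ → ℕ} (h : Keeps L d mem mem') (hn : n ≤ d) :
    Below L n mem mem' := fun q i x hi hx hq hne => h q i x hi hx (by omega) (by omega)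

theorem Below.isTab {α : Type*} [DecidableEq α] {T F : Forest α} {L n q : ℕ} {mem mem' : ℕ → ℕ}
    (h : Below L n mem mem') (hF : IsTab L T mem q F) (hq : q < n) (hL : 10 ≤ L)
    (hE : 2 * T.size < L) : IsTab L T mem' q F :=
  hF.congr hE (h _ _ _ (by omega) hF.lt (by omega) (by omega))
    fun hq0 i x hi hx => h q i x hi hx hq (by omega)

theorem Below.hasTree {σ : ℕ} {T : Forest (Fin σ)} {L n : ℕ} {mem mem' : ℕ → ℕ}
    (h : Below L n mem mem') (hT : HasTree mem T) (hn : 0 < n) (hE : 2 * T.size + 5 < L) :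
    HasTree mem' T := by
  intro e he
  have := h 0 0 (e + 2) (by omega) (by omega) hn (by omega)
  rw [ad_zero] at this
  rw [this, hT e he]

/-- The state of a reader is stored on a stack: the row `4` of block `0` contains the blocks of the
tables of the forests, which are below `n`, and the row `5` contains the codes of the labels. -/
def IsReader {σ : ℕ} (L : ℕ) (T : Forest (Fin σ)) (mem : ℕ → ℕ) (n : ℕ) :
    List (Fin σ × Forest (Fin σ)) → Forest (Fin σ) → Prop
  | [], A => IsTab L T mem (mem (ad L 0 4 0)) A ∧ mem (ad L 0 4 0) < n
  | (a, A) :: st, C => (IsTab L T mem (mem (ad L 0 4 (st.length + 1))) C ∧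
      mem (ad L 0 4 (st.length + 1)) < n) ∧ mem (ad L 0 5 (st.length + 1)) = a + 1 ∧
      IsReader L T mem n st A

theorem IsReader.top {σ : ℕ} {L n : ℕ} {T : Forest (Fin σ)} {mem : ℕ → ℕ}
    {st : List (Fin σ × Forest (Fin σ))} {A : Forest (Fin σ)} (h : IsReader L T mem n st A) :
    IsTab L T mem (mem (ad L 0 4 st.length)) A ∧ mem (ad L 0 4 st.length) < n := by
  rcases st with _ | ⟨⟨a, B⟩, st⟩
  · exact h
  · exact h.1

theorem IsReader.congr {σ : ℕ} {L n n' : ℕ} {T : Forest (Fin σ)} {mem mem' : ℕ → ℕ}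
    {st : List (Fin σ × Forest (Fin σ))} {A : Forest (Fin σ)} (h : IsReader L T mem n st A)
    (hb : Below L n mem mem') (hn : n ≤ n') (hL : 10 ≤ L) (hE : 2 * T.size < L)
    (h4 : ∀ x ≤ st.length, mem' (ad L 0 4 x) = mem (ad L 0 4 x))
    (h5 : ∀ x ≤ st.length, mem' (ad L 0 5 x) = mem (ad L 0 5 x)) : IsReader L T mem' n' st A := by
  induction st generalizing A with
  | nil =>
    obtain ⟨h₁, h₂⟩ := h
    simp only [IsReader, h4 0 (by simp)]
    exact ⟨hb.isTab h₁ h₂ hL hE, by omega⟩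
  | cons p st ih =>
    obtain ⟨⟨h₁, h₂⟩, h₃, h⟩ := h
    simp only [IsReader, h4 (st.length + 1) (by simp), h5 (st.length + 1) (by simp)]
    exact ⟨⟨hb.isTab h₁ h₂ hL hE, by omega⟩, h₃,
      ih h (fun x hx => h4 x (by simp; omega)) fun x hx => h5 x (by simp; omega)⟩

/-- The table on the top of the stack may be replaced. -/
theorem IsReader.replace {σ : ℕ} {L n n' : ℕ} {T : Forest (Fin σ)} {mem mem' : ℕ → ℕ}
    {st : List (Fin σ × Forest (Fin σ))} {A B : Forest (Fin σ)} (h : IsReader L T mem n st A)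
    (hb : Below L n mem mem') (hn : n ≤ n') (hL : 10 ≤ L) (hE : 2 * T.size < L)
    (h4 : ∀ x < st.length, mem' (ad L 0 4 x) = mem (ad L 0 4 x))
    (h5 : ∀ x ≤ st.length, mem' (ad L 0 5 x) = mem (ad L 0 5 x))
    (hB : IsTab L T mem' (mem' (ad L 0 4 st.length)) B) (hBn : mem' (ad L 0 4 st.length) < n') :
    IsReader L T mem' n' st B := by
  rcases st with _ | ⟨p, st⟩
  · exact ⟨hB, hBn⟩
  · obtain ⟨-, h₃, h⟩ := h
    exact ⟨⟨hB, hBn⟩, (h5 _ (by simp)).trans h₃,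
      h.congr hb hn hL hE (fun x hx => h4 x (by simp; omega)) fun x hx => h5 x (by simp; omega)⟩

/-- Read the token at the position in register `51`.  Register `50` holds the height of the stack
and register `13` the first free block. -/
def scanToken : Program :=
  .seq (assign 53 (.get (.var 51))) (ifLt 0 (.var 53)
    (.seq (assign 50 (.var 50 + 1)) (.seq (write (adE 0 4 (.var 50)) 0)
      (write (adE 0 5 (.var 50)) (.var 53))))
    (.seq (assign 21 (.get (adE 0 4 (.var 50)))) (.seq (assign 29 (.get (adE 0 5 (.var 50))))
      (.seq (assign 50 (.var 50 - 1)) (.seq (assign 22 (.var 13)) (.seq tree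
      (.seq (assign 20 (.get (adE 0 4 (.var 50)))) (.seq (assign 21 (.var 22))
      (.seq (assign 22 (.var 22 + 1)) (.seq concat (.seq (write (adE 0 4 (.var 50)) (.var 22))
      (assign 13 (.var 22 + 1)))))))))))))

set_option maxHeartbeats 1000000 in
/-- The program follows the reader: when a node is entered, the empty forest in block `0` is pushed;
when it is left, the table of its tree and then that of the forest up to this tree are computed in
two new blocks. -/
theorem wp_scanToken {σ : ℕ} {T : Forest (Fin σ)} {L : ℕ} {s : NatState} {r : Reader σ}
    {t : Option (Fin σ)} (he : Env w L (2 * T.size) s) (hT : HasTree s.mem T)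
    (hr : IsReader L T s.mem (s.reg 13) r.1 r.2) (h50 : s.reg 50 = r.1.length)
    (htok : s.mem (s.reg 51) = tokenCode t) (hsafe : t = none → r.1 ≠ [])
    (h13 : 0 < s.reg 13) (h13L : s.reg 13 + 3 < L) (hX : s.mem (ad L 0 6 0) = 0)
    (hrL : 2 * r.entered + 4 < L) :
    Wp w scanToken (fun s' => IsReader L T s'.mem (s'.reg 13) (r.step t).1 (r.step t).2 ∧
      s'.reg 50 = (r.step t).1.length ∧ s.reg 13 ≤ s'.reg 13 ∧ s'.reg 13 ≤ s.reg 13 + 2 ∧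
      Below L (s.reg 13) s.mem s'.mem ∧
      s'.time ≤ s.time + 40000 * ((2 * T.size + 1) * r.cost t)) s := by
  have hB := he.lt_pow
  have hE := he.regE
  have hlt := he.lt
  have h10 := he.regL
  have hle := he.le
  obtain ⟨st, C⟩ := r
  refine .seq (.assign (by norm_num) (by simp) ?_)
  refine .ifLt (by simp; omega) (by simp) (fun hpos => ?_) (fun hzero => ?_)
  · simp [htok] at hpos
    obtain ⟨a, rfl⟩ : ∃ a, t = some a := by
      rcases t with _ | a
      · simp [tokenCode] at hpos
      · exact ⟨a, rfl⟩
    have hst : st.length + C.size ≤ Reader.entered (st, C) :=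
      Reader.length_add_size_le_entered (st, C)
    refine .seq (.assign (by norm_num) (by simp [h50]; omega) ?_)
    refine .seq (.write (he.ok_adE (by simp) (by simp [h50]; omega)) (by simp; omega) ?_)
    refine .write (he.ok_adE (by simp) (by simp [h50]; omega)) (by simp) ?_
    simp [h10, h50, htok, Reader.step, tokenCode, Reader.cost]
    set mem' := Function.update (Function.update s.mem (ad L 0 4 (st.length + 1)) 0)
      (ad L 0 5 (st.length + 1)) (a + 1) with hmem'
    have hb : Below L (s.reg 13) s.mem mem' := by
      intro q i x hi hx hq h
      rw [hmem', update_ad _ _ (by omega) (by omega) hi hx, if_neg (by omega),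
        update_ad _ _ (by omega) (by omega) hi hx, if_neg (by omega)]
    have h4 : mem' (ad L 0 4 (st.length + 1)) = 0 := by
      rw [hmem', update_ad _ _ (by omega) (by omega) (by omega) (by omega), if_neg (by omega),
        Function.update_self]
    refine ⟨⟨⟨?_, by omega⟩, by rw [hmem', Function.update_self], hr.congr hb le_rfl hle (by omega)
      (fun x hx => ?_) (fun x hx => ?_)⟩, hb, by omega⟩
    · rw [h4]
      refine ⟨by omega, by simp; omega, by simp, ?_, fun i _ x hx hx' => ?_⟩
      · rw [hb _ _ _ (by omega) (by omega) h13 (by omega), hX, size_nil]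
      · simp at hx'
        omega
    · simp only at hx
      rw [hmem', update_ad _ _ (by omega) (by omega) (by omega) (by omega), if_neg (by omega),
        update_ad _ _ (by omega) (by omega) (by omega) (by omega), if_neg (by omega)]
    · simp only at hx
      rw [hmem', update_ad _ _ (by omega) (by omega) (by omega) (by omega), if_neg (by omega),
        update_ad _ _ (by omega) (by omega) (by omega) (by omega), if_neg (by omega)]
  · simp [htok] at hzero
    obtain rfl : t = none := by
      rcases t with _ | a
      · rfl
      · simp [tokenCode] at hzero
    rcases st with _ | ⟨⟨a, A⟩, st⟩
    · exact (hsafe rfl rfl).elim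
    have hst : st.length + A.size + C.size + 1 ≤ Reader.entered ((a, A) :: st, C) := by
      have := Reader.length_add_size_le_entered (st, C)
      simp only [Reader.entered, List.map_cons, List.sum_cons] at this ⊢
      omega
    obtain ⟨⟨hC, hCn⟩, hlab, hA⟩ := hr
    have hAtop := hA.top
    simp only [List.length_cons] at h50 hC hCn hlab
    refine .seq (.assign (by norm_num) (he.ok_get (by simp) (by simp [h50]; omega)) ?_)
    refine .seq (.assign (by norm_num) (he.ok_get (by simp) (by simp [h50]; omega)) ?_)
    refine .seq (.assign (by norm_num) (by simp [h50]; omega) ?_)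
    refine .seq (.assign (by norm_num) (by simp) ?_)
    generalize hs₁ : NatState.upd _ _ _ _ = s₁
    have hreg : ∀ r, r ≠ 53 → r ≠ 21 → r ≠ 29 → r ≠ 50 → r ≠ 22 → s₁.reg r = s.reg r := by
      intro r h₁ h₂ h₃ h₄ h₅
      rw [← hs₁]
      simp [h₁, h₂, h₃, h₄, h₅]
    have t10 : s₁.reg 10 = s.reg 10 := by apply hreg <;> norm_num
    have t11 : s₁.reg 11 = s.reg 11 := by apply hreg <;> norm_num
    have t21 : s₁.reg 21 = s.mem (ad L 0 4 (st.length + 1)) := by rw [← hs₁]; simp [h10, h50]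
    have t29 : s₁.reg 29 = a + 1 := by rw [← hs₁]; simp [h10, h50, hlab]
    have t50 : s₁.reg 50 = st.length := by rw [← hs₁]; simp [h50]
    have t22 : s₁.reg 22 = s.reg 13 := by rw [← hs₁]; simp
    have tm : s₁.mem = s.mem := by rw [← hs₁]; simp
    have tt : s₁.time ≤ s.time + 100 := by rw [← hs₁]; simp
    clear hs₁
    have he₁ : Env w L (2 * T.size) s₁ := he.of_reg t10 t11
    refine .seq ((wp_tree (a := a) (c := C) he₁ (by rwa [tm]) (by rwa [tm, t21]) t29 (by omega)
      (by omega) (by omega) (by omega)).frame.mono fun s₂ ⟨hfr, hnew, hk, ht⟩ => ?_)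
    have u10 : s₂.reg 10 = s.reg 10 := (hfr 10 (by norm_num) (by decide)).trans t10
    have u11 : s₂.reg 11 = s.reg 11 := (hfr 11 (by norm_num) (by decide)).trans t11
    have u22 : s₂.reg 22 = s.reg 13 := (hfr 22 (by norm_num) (by decide)).trans t22
    have u50 : s₂.reg 50 = st.length := (hfr 50 (by norm_num) (by decide)).trans t50
    rw [t22] at hnew hk
    rw [tm] at hk
    have hb₂ : Below L (s.reg 13) s.mem s₂.mem := hk.below le_rfl
    have hA₂ := hA.congr hb₂ le_rfl hle (by omega)
      (fun x hx => hk _ _ _ (by omega) (by omega) (by omega) (by omega))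
      (fun x hx => hk _ _ _ (by omega) (by omega) (by omega) (by omega))
    have hAtop₂ := hA₂.top
    refine .seq (.assign (by norm_num) (he.ok_get u10 (by simp [u50]; omega)) ?_)
    refine .seq (.assign (by norm_num) (by simp) ?_)
    refine .seq (.assign (by norm_num) (by simp [u22]; omega) ?_)
    generalize hs₃ : NatState.upd _ _ _ _ = s₃
    have v10 : s₃.reg 10 = s.reg 10 := by rw [← hs₃]; simp [u10]
    have v11 : s₃.reg 11 = s.reg 11 := by rw [← hs₃]; simp [u11]
    have v20 : s₃.reg 20 = s₂.mem (ad L 0 4 st.length) := by rw [← hs₃]; simp [u10, h10, u50]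
    have v21 : s₃.reg 21 = s.reg 13 := by rw [← hs₃]; simp [u22]
    have v22 : s₃.reg 22 = s.reg 13 + 1 := by rw [← hs₃]; simp [u22]
    have v50 : s₃.reg 50 = st.length := by rw [← hs₃]; simp [u50]
    have vm : s₃.mem = s₂.mem := by rw [← hs₃]; simp
    have vt : s₃.time ≤ s₂.time + 100 := by rw [← hs₃]; simp
    clear hs₃
    have he₃ : Env w L (2 * T.size) s₃ := he.of_reg v10 v11
    refine .seq ((wp_concat (F := A) (G := cons a C nil) he₃ (by rw [vm, v20]; exact hAtop₂.1)
      (by rwa [vm, v21]) (by omega) (by omega) (by omega) (by omega)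
      (by simp; omega)).frame.mono fun s₄ ⟨hfr₄, hnew₄, hk₄, ht₄⟩ => ?_)
    have w10 : s₄.reg 10 = s.reg 10 := (hfr₄ 10 (by norm_num) (by decide)).trans v10
    have w22 : s₄.reg 22 = s.reg 13 + 1 := (hfr₄ 22 (by norm_num) (by decide)).trans v22
    have w50 : s₄.reg 50 = st.length := (hfr₄ 50 (by norm_num) (by decide)).trans v50
    rw [v22] at hnew₄ hk₄
    rw [vm] at hk₄
    have hb₄ : Below L (s.reg 13) s₂.mem s₄.mem := hk₄.below (by omega)
    refine .seq (.write (he.ok_adE w10 (by simp [w50]; omega)) (by simp) ?_)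
    refine .assign (by norm_num) (by simp [w22]; omega) ?_
    simp [w10, h10, w22, w50, Reader.step, Reader.cost]
    set mem' := Function.update s₄.mem (ad L 0 4 st.length) (s.reg 13 + 1) with hmem'
    have hb' : Below L (s.reg 13 + 2) s₄.mem mem' := by
      intro q i x hi hx hq h
      rw [hmem', update_ad _ _ (by omega) (by omega) hi hx, if_neg (by omega)]
    have h4 : mem' (ad L 0 4 st.length) = s.reg 13 + 1 := by rw [hmem', Function.update_self]
    refine ⟨?_, by omega, (hb₂.trans hb₄ le_rfl).trans hb' (by omega), ?_⟩
    · refine hA₂.replace (hb₄.trans hb' (by omega)) (by omega) hle (by omega)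
        (fun x hx => ?_) (fun x hx => ?_) ?_ ?_
      · rw [hmem', update_ad _ _ (by omega) (by omega) (by omega) (by omega), if_neg (by omega),
          hk₄ _ _ _ (by omega) (by omega) (by omega) (by omega)]
      · rw [hmem', update_ad _ _ (by omega) (by omega) (by omega) (by omega), if_neg (by omega),
          hk₄ _ _ _ (by omega) (by omega) (by omega) (by omega)]
      · rw [h4]
        exact hb'.isTab hnew₄ (by omega) hle (by omega)
      · omega
    · simp at ht₄
      have h₁ : C.size + 1 ≤ (A.size + 1) * (C.size + 1) := Nat.le_mul_of_pos_left _ (by omega)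
      have h₂ : (A.size + 1) * (C.size + 1 + 1) ≤ 2 * ((A.size + 1) * (C.size + 1)) := by nlinarith
      have h₃ := Nat.mul_le_mul_left (2 * T.size + 1) h₁
      have h₄ := Nat.mul_le_mul_left (2 * T.size + 1) h₂
      rw [show (2 * T.size + 1) * (2 * ((A.size + 1) * (C.size + 1))) =
        2 * ((2 * T.size + 1) * ((A.size + 1) * (C.size + 1))) by ring] at h₄
      have h₅ : 1 ≤ (2 * T.size + 1) * ((A.size + 1) * (C.size + 1)) :=
        Nat.mul_pos (by omega) (Nat.mul_pos (by omega) (by omega))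
      omega

/-- Compute the table of the forest whose encoding is between the positions in the registers `51`
and `52`.  Its block is put into cell `0` of row `4` of block `0`. -/
def scan : Program :=
  .seq (assign 50 0) (.seq (write (adE 0 4 0) 0) (forLt 51 52 scanToken))

theorem wp_scan {σ : ℕ} {T F : Forest (Fin σ)} {L : ℕ} {s : NatState}
    (he : Env w L (2 * T.size) s) (hT : HasTree s.mem T)
    (hin : ∀ e < 2 * F.size, s.mem (s.reg 51 + e) = (encodeForest F).getD e 0)
    (h52 : s.reg 52 = s.reg 51 + 2 * F.size) (h52L : s.reg 52 < L) (h13 : 0 < s.reg 13)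
    (h13L : s.reg 13 + 4 * F.size + 3 < L) (hX : s.mem (ad L 0 6 0) = 0) :
    Wp w scan (fun s' => IsTab L T s'.mem (s'.mem (ad L 0 4 0)) F ∧
      s'.mem (ad L 0 4 0) < s'.reg 13 ∧ s.reg 13 ≤ s'.reg 13 ∧
      s'.reg 13 ≤ s.reg 13 + 4 * F.size ∧ Below L (s.reg 13) s.mem s'.mem ∧
      s'.time ≤ s.time + 100000 * ((2 * T.size + 1) * (F.size * F.size + F.size + 1))) s := by
  have hB := he.lt_pow
  have hE := he.regE
  have hlt := he.lt
  have h10 := he.regL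
  have hle := he.le
  have hlen := length_tokens F
  refine .seq (.assign (by norm_num) (by simp; omega) ?_)
  refine .seq (.write (he.ok_adE (by simp) (by simp; omega)) (by simp; omega) ?_)
  simp only [eval_adE, Expr.eval_lit, NatState.reg_upd, h10]
  set mem₀ := Function.update s.mem (ad L 0 4 0) 0 with hmem₀
  have hb₀ : Below L (s.reg 13) s.mem mem₀ := by
    intro q i x hi hx hq h
    rw [hmem₀, update_ad _ _ (by omega) (by omega) hi hx, if_neg (by omega)]
  have h40 : mem₀ (ad L 0 4 0) = 0 := by rw [hmem₀, Function.update_self]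
  refine Wp.forLt (fun k s' => ∃ r : Reader σ,
      Reader.Safe ((tokens F).drop (k - s.reg 51)) r ∧
      ((tokens F).drop (k - s.reg 51)).foldl Reader.step r = ([], F) ∧
      r.entered ≤ k - s.reg 51 ∧ IsReader L T s'.mem (s'.reg 13) r.1 r.2 ∧
      s'.reg 50 = r.1.length ∧ s.reg 13 ≤ s'.reg 13 ∧
      s'.reg 13 ≤ s.reg 13 + 2 * (k - s.reg 51) ∧ Below L (s.reg 13) s.mem s'.mem ∧
      s'.time + 40100 * ((2 * T.size + 1) *
        Reader.costs ((tokens F).drop (k - s.reg 51)) r) ≤ s.time + 50 +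
        40100 * ((2 * T.size + 1) * Reader.costs (tokens F) ([], nil)))
    (by norm_num) (by norm_num) (by norm_num) (by decide) (by decide) (by simp; omega) ?_ ?_ ?_
  · simp only [NatState.reg_put, NatState.reg_upd, NatState.mem_put, NatState.mem_upd,
      NatState.time_put, NatState.time_upd, show (51 : ℕ) ≠ 50 by norm_num,
      show (13 : ℕ) ≠ 50 by norm_num, show (10 : ℕ) ≠ 50 by norm_num, if_false, Nat.sub_self,
      List.drop_zero]
    rw [← hmem₀]
    refine ⟨([], nil), safe_tokens _ _ _, by rw [foldl_step_tokens, nil_add],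
      by simp [Reader.entered], ⟨?_, by omega⟩, by simp, le_rfl, by omega, hb₀, by simp⟩
    rw [h40]
    refine ⟨by omega, by simp; omega, by simp, ?_, fun i _ x hx hx' => ?_⟩
    · rw [hb₀ _ _ _ (by omega) (by omega) h13 (by omega), hX, size_nil]
    · simp at hx'
      omega
  · rintro k s₁ hk0 hk1 hk hfr ⟨r, hsafe, hfold, hent, hr, h50, h13', h13'', hbel, ht⟩
    simp at hk0 hk1
    have r10 : s₁.reg 10 = L := (hfr 10 (by norm_num) (by decide)).trans (by simp [h10])
    have r11 : s₁.reg 11 = 2 * T.size := (hfr 11 (by norm_num) (by decide)).trans (by simp [hE])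
    obtain ⟨e, rfl⟩ : ∃ e, k = s.reg 51 + e := ⟨k - s.reg 51, by omega⟩
    rw [show s.reg 51 + e - s.reg 51 = e by omega] at *
    rw [show s.reg 51 + e + 1 - s.reg 51 = e + 1 by omega]
    have he' : e < (tokens F).length := by omega
    rw [List.drop_eq_getElem_cons he'] at hsafe hfold ht
    set t := (tokens F)[e] with htdef
    have htok : s₁.mem (s₁.reg 51) = tokenCode t := by
      have := hbel 0 0 (s.reg 51 + e) (by omega) (by omega) h13 (by omega)
      rw [ad_zero] at this
      rw [hk, this, hin e (by omega), ← map_tokens, List.getD_eq_getElem _ _ (by simpa)]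
      simp [htdef]
    refine (wp_scanToken (s := s₁.tick 5) (r := r) (t := t) (he.of_reg (by simp [r10, h10]) (by simp [r11, hE]))
      (hbel.hasTree hT h13 hlt) hr h50 htok hsafe.1 (by simp; omega) (by simp; omega) ?_
      (by omega)).mono ?_
    · simp only [NatState.mem_tick]
      rw [hbel _ _ _ (by omega) (by omega) h13 (by omega), hX]
    · rintro s₂ ⟨hr₂, h50₂, hm₁, hm₂, hb₂, ht₂⟩
      simp only [NatState.reg_tick, NatState.mem_tick, NatState.time_tick] at hm₁ hm₂ hb₂ ht₂
      refine ⟨r.step t, hsafe.2, hfold, (Reader.entered_step_le _ _).trans (by omega), ?_, ?_, ?_,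
        ?_, hbel.trans hb₂ h13', ?_⟩
      · simpa using hr₂
      · simpa using h50₂
      · simp; omega
      · simp; omega
      · have hc : 1 ≤ r.cost t := by
          rcases r with ⟨_ | ⟨⟨a, A⟩, st⟩, C⟩ <;> rcases t with _ | b
          · exact (hsafe.1 rfl rfl).elim
          · exact le_rfl
          · exact Nat.mul_pos (Nat.succ_pos _) (Nat.succ_pos _)
          · exact le_rfl
        have h₁ : 1 ≤ (2 * T.size + 1) * r.cost t := Nat.mul_pos (by omega) hc
        simp only [Reader.costs, Nat.mul_add] at ht
        simp only [NatState.time_upd]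
        omega
  · rintro s₁ - - ⟨r, -, hfold, -, hr, -, h13', h13'', hbel, ht⟩
    simp [h52] at hfold h13'' ht
    rw [List.drop_eq_nil_of_le (by omega)] at hfold ht
    simp only [List.foldl_nil] at hfold
    subst hfold
    refine ⟨hr.1, hr.2, h13', by simp; omega, hbel, ?_⟩
    have h₁ := costs_tokens_le F [] nil
    simp only [size_nil, Nat.mul_zero, Nat.add_zero] at h₁
    have h₂ := Nat.mul_le_mul_left (2 * T.size + 1) h₁
    have h₃ : (2 * T.size + 1) * (F.size * F.size + F.size + 1) =
      (2 * T.size + 1) * (F.size * F.size + F.size) + (2 * T.size + 1) := by ring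
    simp only [NatState.time_tick]
    simp only [Reader.costs] at ht
    omega

/-! ### Reading the input -/

namespace Forest

/-- The position of the `i`-th forest in the input, counted from `0`; for `i = k` this is the length
of the input. -/
def start {α : Type*} (T : Forest α) (Fs : List (Forest α)) (i : ℕ) : ℕ :=
  2 + 2 * T.size + i + 2 * (sum (Fs.take i)).size

theorem sum_append {α : Type*} (Fs Gs : List (Forest α)) : sum (Fs ++ Gs) = sum Fs + sum Gs := by
  induction Fs with
  | nil => rfl
  | cons F Fs ih => simp only [List.cons_append, sum, ih, add_assoc]

theorem sum_take_succ {α : Type*} {Fs : List (Forest α)} {i : ℕ} (h : i < Fs.length) :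
    sum (Fs.take (i + 1)) = sum (Fs.take i) + Fs[i] := by
  rw [List.take_succ_eq_append_getElem h, sum_append]
  simp [sum]

theorem sum_drop {α : Type*} {Fs : List (Forest α)} {i : ℕ} (h : i < Fs.length) :
    sum (Fs.drop i) = Fs[i] + sum (Fs.drop (i + 1)) := by
  rw [List.drop_eq_getElem_cons h]
  rfl

theorem start_zero {α : Type*} (T : Forest α) (Fs : List (Forest α)) :
    start T Fs 0 = 2 + 2 * T.size := by
  simp [start, sum]

theorem start_succ {α : Type*} (T : Forest α) {Fs : List (Forest α)} {i : ℕ} (h : i < Fs.length) :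
    start T Fs (i + 1) = start T Fs i + 1 + 2 * Fs[i].size := by
  simp only [start, sum_take_succ h, size_add]
  omega

theorem start_mono {α : Type*} (T : Forest α) {Fs : List (Forest α)} {i j : ℕ} (hij : i ≤ j)
    (h : j ≤ Fs.length) : start T Fs i ≤ start T Fs j := by
  induction j with
  | zero =>
    obtain rfl : i = 0 := by omega
    exact le_rfl
  | succ j ih =>
    rcases Nat.le_succ_iff.1 hij with hij | rfl
    · have := ih hij (by omega)
      have := start_succ T (Fs := Fs) (i := j) (by omega)
      omega
    · exact le_rfl

end Forest

/-- The memory contains the input. -/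
structure IsInput {σ : ℕ} (mem : ℕ → ℕ) (Fs : List (Forest (Fin σ))) (T : Forest (Fin σ)) :
    Prop where
  length : mem 0 = Fs.length
  size : mem 1 = T.size
  tree : HasTree mem T
  header : ∀ i (h : i < Fs.length), mem (start T Fs i) = Fs[i].size
  forest : ∀ i (h : i < Fs.length), ∀ e < 2 * Fs[i].size,
    mem (start T Fs i + 1 + e) = (encodeForest Fs[i]).getD e 0

theorem length_flatMap_encodeForest {σ : ℕ} (Fs : List (Forest (Fin σ))) :
    (Fs.flatMap fun F => F.size :: encodeForest F).length = Fs.length + 2 * (sum Fs).size := by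
  induction Fs with
  | nil => rfl
  | cons F Fs ih => simp [sum] at ih ⊢; omega

theorem length_encodeInput {σ : ℕ} (Fs : List (Forest (Fin σ))) (T : Forest (Fin σ)) :
    (encodeInput Fs T).length = start T Fs Fs.length := by
  simp only [encodeInput, List.length_cons, List.length_append, length_flatMap_encodeForest,
    length_encodeForest, start, List.take_length]
  omega

theorem isInput_encodeInput {σ : ℕ} (Fs : List (Forest (Fin σ))) (T : Forest (Fin σ)) :
    IsInput (fun a => (encodeInput Fs T).getD a 0) Fs T := by
  have hsplit : ∀ i (h : i < Fs.length), ∀ e, (encodeInput Fs T).getD (start T Fs i + e) 0 =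
      (Fs[i].size :: (encodeForest Fs[i] ++
        (Fs.drop (i + 1)).flatMap fun F => F.size :: encodeForest F)).getD e 0 := by
    intro i h e
    have hFs : encodeInput Fs T = (Fs.length :: T.size :: (encodeForest T ++
        (Fs.take i).flatMap fun F => F.size :: encodeForest F)) ++ (Fs[i].size ::
        (encodeForest Fs[i] ++ (Fs.drop (i + 1)).flatMap fun F => F.size :: encodeForest F)) := by
      have hFs : Fs = Fs.take i ++ Fs[i] :: Fs.drop (i + 1) := by
        rw [← List.drop_eq_getElem_cons h, List.take_append_drop]
      have hf : (Fs.flatMap fun F => F.size :: encodeForest F) =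
          (Fs.take i).flatMap (fun F => F.size :: encodeForest F) ++ Fs[i].size ::
          (encodeForest Fs[i] ++ (Fs.drop (i + 1)).flatMap fun F => F.size :: encodeForest F) := by
        conv_lhs => rw [hFs]
        rw [List.flatMap_append, List.flatMap_cons, List.cons_append]
      rw [encodeInput, hf]
      simp only [List.cons_append, List.append_assoc]
    have hl : (Fs.length :: T.size :: (encodeForest T ++
        (Fs.take i).flatMap fun F => F.size :: encodeForest F)).length = start T Fs i := by
      simp only [List.length_cons, List.length_append, length_flatMap_encodeForest,
        length_encodeForest, List.length_take, start]
      omega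
    rw [hFs, List.getD_append_right _ _ _ _ (by omega), hl, Nat.add_sub_cancel_left]
  refine ⟨rfl, rfl, fun e he => ?_, fun i h => by simpa using hsplit i h 0, fun i h e he => ?_⟩
  · simp only [encodeInput, List.getD_cons_succ]
    rw [List.getD_append _ _ _ _ (by simpa using he)]
  · rw [show start T Fs i + 1 + e = start T Fs i + (e + 1) by omega, hsplit i h,
      List.getD_cons_succ, List.getD_append _ _ _ _ (by simpa using he)]

theorem IsInput.congr {σ : ℕ} {Fs : List (Forest (Fin σ))} {T : Forest (Fin σ)} {mem mem' : ℕ → ℕ}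
    (h : IsInput mem Fs T) (hm : ∀ a < start T Fs Fs.length, mem' a = mem a) :
    IsInput mem' Fs T := by
  have h₀ := start_mono T (Fs := Fs) (Nat.zero_le _) le_rfl
  rw [start_zero] at h₀
  refine ⟨(hm 0 (by omega)).trans h.length, (hm 1 (by omega)).trans h.size,
    fun e he => (hm _ (by omega)).trans (h.tree e he), fun i hi => ?_, fun i hi e he => ?_⟩
  all_goals
    have h₁ := start_succ T hi
    have h₂ := start_mono T (Fs := Fs) (i := i + 1) hi le_rfl
  · exact (hm _ (by omega)).trans (h.header i hi)
  · exact (hm _ (by omega)).trans (h.forest i hi e he)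

/-- Step from a forest in the input to the next one. -/
def skipForest : Program := assign 14 (.var 14 + 2 * .get (.var 14) + 1)

/-- Put the number of forests into register `12`, find the length of the input, choose the width of
the rows, and store the positions of the forests in row `7` of block `0`. -/
def readHeaders : Program :=
  .seq (assign 12 (.get 0)) (.seq (assign 11 (2 * .get 1)) (.seq (assign 14 (2 + .var 11))
    (.seq (assign 15 0) (.seq (forLt 15 12 skipForest) (.seq (assign 10 (2 * .var 14 + 10))
    (.seq (assign 14 (2 + .var 11)) (.seq (assign 15 0)
    (forLt 15 12 (.seq (write (adE 0 7 (.var 15)) (.var 14)) skipForest)))))))))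

theorem wp_readHeaders {σ : ℕ} {T : Forest (Fin σ)} {Fs : List (Forest (Fin σ))} {L : ℕ}
    {s : NatState} (hin : IsInput s.mem Fs T) (hL : L = 2 * start T Fs Fs.length + 10)
    (hcap : (L + 1) * L * L ≤ wordCount w) :
    Wp w readHeaders (fun s' => Env w L (2 * T.size) s' ∧ s'.reg 12 = Fs.length ∧
      (∀ i < Fs.length, s'.mem (ad L 0 7 i) = start T Fs i) ∧
      (∀ i x, i < L → x < L → i ≠ 7 → s'.mem (ad L 0 i x) = s.mem (ad L 0 i x)) ∧
      s'.time ≤ s.time + 100 * (Fs.length + 1)) s := by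
  have h₀ := start_mono T (Fs := Fs) (Nat.zero_le _) le_rfl
  rw [start_zero] at h₀
  have hk : Fs.length < start T Fs Fs.length := by rw [start]; omega
  have hB : 10 * L < wordCount w := by
    have h₁ : 11 * 10 * L ≤ (L + 1) * L * L :=
      Nat.mul_le_mul_right L (Nat.mul_le_mul (by omega) (by omega))
    omega
  have hs0 := hin.length
  have hs1 := hin.size
  have hnext : ∀ i < Fs.length, ∀ s' : NatState, (∀ a < start T Fs Fs.length, s'.mem a = s.mem a) →
      s'.reg 14 = start T Fs i → ∀ Q : NatState → Prop, Q (s'.upd 14 (start T Fs (i + 1)) 12) →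
      Wp w skipForest Q s' := by
    intro i hi s' hm h14 Q hQ
    have h₁ := start_succ T hi
    have h₂ := start_mono T (Fs := Fs) (i := i + 1) hi le_rfl
    have h₃ := (hin.congr hm).header i hi
    refine .assign (by norm_num) (by simp [h14, h₃]; omega) ?_
    rw [show start T Fs (i + 1) = start T Fs i + 2 * Fs[i].size + 1 by omega] at hQ
    simpa [h14, h₃] using hQ
  refine .seq (.assign (by norm_num) (by simp; omega) ?_)
  refine .seq (.assign (by norm_num) (by simp [hs1]; omega) ?_)
  refine .seq (.assign (by norm_num) (by simp [hs1]; omega) ?_)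
  refine .seq (.assign (by norm_num) (by simp; omega) ?_)
  refine .seq (Wp.forLt (fun i s' => s'.mem = s.mem ∧ s'.reg 14 = start T Fs i ∧
    s'.time ≤ s.time + 30 + 30 * i) (by norm_num) (by norm_num) (by norm_num) (by decide)
    (by decide) (by simp) ?_ ?_ ?_)
  · simp [hs1, start_zero]
  · rintro i s₁ - hi - hfr ⟨hm, h14, ht⟩
    simp [hs0] at hi
    refine hnext i hi _ (by simp [hm]) (by simpa) _ ⟨by simpa, by simp, ?_⟩
    simp
    omega
  rintro s₁ - hfr₁ ⟨hm₁, h14, ht₁⟩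
  simp [hs0] at h14 ht₁
  have u11 : s₁.reg 11 = 2 * T.size :=
    (hfr₁ 11 (by norm_num) (by decide)).trans (by simp [hs1])
  have u12 : s₁.reg 12 = Fs.length := (hfr₁ 12 (by norm_num) (by decide)).trans (by simp [hs0])
  refine .seq (.assign (by norm_num) (by simp [h14]; omega) ?_)
  refine .seq (.assign (by norm_num) (by simp [u11]; omega) ?_)
  refine .seq (.assign (by norm_num) (by simp; omega) ?_)
  generalize hs₂ : NatState.upd _ _ _ _ = s₂
  have v10 : s₂.reg 10 = L := by rw [← hs₂]; simp [h14, hL]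
  have v11 : s₂.reg 11 = 2 * T.size := by rw [← hs₂]; simp [u11]
  have v12 : s₂.reg 12 = Fs.length := by rw [← hs₂]; simp [u12]
  have v14 : s₂.reg 14 = start T Fs 0 := by rw [← hs₂]; simp [u11, start_zero]
  have v15 : s₂.reg 15 = 0 := by rw [← hs₂]; simp
  have vm : s₂.mem = s.mem := by rw [← hs₂]; simp [hm₁]
  have vt : s₂.time ≤ s₁.time + 30 := by rw [← hs₂]; simp
  clear hs₂
  have he : Env w L (2 * T.size) s₂ := ⟨v10, v11, by omega, by omega, hcap⟩
  refine Wp.forLt (fun i s' => s'.reg 14 = start T Fs i ∧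
    (∀ j < i, s'.mem (ad L 0 7 j) = start T Fs j) ∧
    (∀ i x, i < L → x < L → i ≠ 7 → s'.mem (ad L 0 i x) = s.mem (ad L 0 i x)) ∧
    s'.time ≤ s₂.time + 60 * i) (by norm_num) (by norm_num) (by norm_num) (by decide)
    (by decide) (by omega) ?_ ?_ ?_
  · rw [v15, vm]
    exact ⟨v14, by simp, fun _ _ _ _ _ => rfl, by omega⟩
  · rintro i s₃ - hi hi' hfr ⟨h14', hhdr, hm, ht⟩
    rw [v12] at hi
    have r10 : s₃.reg 10 = L := (hfr 10 (by norm_num) (by decide)).trans v10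
    refine .seq (.write (he.ok_adE (by simp [r10, v10]) (by simp [hi']; omega)) (by simp) ?_)
    simp only [eval_adE, Expr.eval_lit, Expr.eval_var, NatState.reg_tick, r10, hi', h14']
    have hm' : ∀ i' x, i' < L → x < L → i' ≠ 7 → Function.update s₃.mem (ad L 0 7 i)
        (start T Fs i) (ad L 0 i' x) = s.mem (ad L 0 i' x) := by
      intro i' x h₁ h₂ h₃
      rw [update_ad _ _ (by omega) (by omega) h₁ h₂, if_neg (by omega), hm i' x h₁ h₂ h₃]
    refine hnext i hi _ (fun a ha => ?_) (by simpa) _ ⟨by simp, fun j hj => ?_, hm', ?_⟩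
    · have := hm' 0 a (by omega) (by omega) (by omega)
      rwa [ad_zero] at this
    · simp only [NatState.mem_upd, NatState.mem_put, NatState.mem_tick]
      rw [update_ad _ _ (by omega) (by omega) (by omega) (by omega)]
      split_ifs with h
      · rw [h.2.2]
      · exact hhdr j (by omega)
    · simp
      omega
  · rintro s₃ - hfr ⟨-, hhdr, hm, ht⟩
    rw [v12] at hhdr ht
    exact ⟨he.of_reg (hfr 10 (by norm_num) (by decide)) (hfr 11 (by norm_num) (by decide)),
      (hfr 12 (by norm_num) (by decide)).trans v12, hhdr, hm, by simp; omega⟩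

/-! ### The tables of the prefix and suffix sums -/

theorem IsTab.update {α : Type*} [DecidableEq α] {T F : Forest α} {L q i x v : ℕ} {mem : ℕ → ℕ}
    (h : IsTab L T mem q F) (hi : i < L) (hx : x < L) (hi6 : i ≠ 6) (hL : 10 ≤ L)
    (hE : 2 * T.size < L) : IsTab L T (Function.update mem (ad L 0 i x) v) q F := by
  have hq := h.lt
  refine h.congr hE ?_ fun hq0 i' x' hi' hx' => ?_
  · rw [update_ad _ _ hi hx (by omega) hq, if_neg (by omega)]
  · rw [update_ad _ _ hi hx hi' hx', if_neg (by omega)]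

/-- Add the next forest to the sum whose table is in the block in register `14`: the forest with
number `t` from the left or, if `d` is true, from the right, where register `16` holds `t`. -/
def addForest (d : Bool) : Program :=
  .seq (assign 17 (if d then .var 12 - .var 16 - 1 else .var 16))
    (.seq (assign 18 (.get (adE 0 7 (.var 17)))) (.seq (assign 19 (.get (.var 18)))
    (.seq (ifLt 0 (.var 19) (.seq (assign 51 (.var 18 + 1))
      (.seq (assign 52 (.var 51 + 2 * .var 19)) (.seq scan
      (.seq (assign 20 (if d then .get (adE 0 4 0) else .var 14))
      (.seq (assign 21 (if d then .var 14 else .get (adE 0 4 0)))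
      (.seq (assign 22 (.var 13)) (.seq concat (.seq (assign 14 (.var 22))
      (assign 13 (.var 22 + 1))))))))))
      .skip) (write (adE 0 3 (.var 17 + 1)) (.var 14)))))

/-- The number of the forest that is added in step `t`, counted from `0`. -/
def index (d : Bool) (k t : ℕ) : ℕ := if d then k - t - 1 else t

/-- Add the forest `F` to the sum `A` on the right or, if `d` is true, on the left. -/
def join {α : Type*} (d : Bool) (A F : Forest α) : Forest α := if d then F + A else A + F

theorem size_join {α : Type*} (d : Bool) (A F : Forest α) :
    (join d A F).size = A.size + F.size := by
  cases d <;> simp [join, Nat.add_comm]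

set_option maxHeartbeats 1000000 in
/-- The time is accounted for by the growth of the square of the size of the sum.  An empty forest
costs a constant only, since the tree is not read then. -/
theorem wp_addForest {σ : ℕ} {T A F : Forest (Fin σ)} {L i p : ℕ} {s : NatState} (d : Bool)
    (he : Env w L (2 * T.size) s) (hT : HasTree s.mem T) (hA : IsTab L T s.mem (s.reg 14) A)
    (h14 : s.reg 14 < s.reg 13) (h13L : s.reg 13 + 4 * F.size + 4 < L)
    (h16 : s.reg 16 < s.reg 12) (hi : i = index d (s.reg 12) (s.reg 16)) (hiL : i + 1 < L)
    (hp : s.mem (ad L 0 7 i) = p) (hpL : p + 1 + 2 * F.size < L) (hsize : s.mem p = F.size)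
    (hF : ∀ e < 2 * F.size, s.mem (p + 1 + e) = (encodeForest F).getD e 0)
    (hX : s.mem (ad L 0 6 0) = 0) (hAL : 2 * A.size + 2 * F.size < L) :
    Wp w (addForest d) (fun s' => IsTab L T s'.mem (s'.reg 14) (join d A F) ∧
      s'.reg 14 < s'.reg 13 ∧ s.reg 13 ≤ s'.reg 13 ∧ s'.reg 13 ≤ s.reg 13 + 4 * F.size + 1 ∧
      (∃ mem', Below L (s.reg 13) s.mem mem' ∧
        s'.mem = Function.update mem' (ad L 0 3 (i + 1)) (s'.reg 14)) ∧
      s'.time + 400000 * ((2 * T.size + 1) * A.size ^ 2) ≤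
        s.time + 200 + 400000 * ((2 * T.size + 1) * (A.size + F.size) ^ 2)) s := by
  have hB := he.lt_pow
  have hE := he.regE
  have hlt := he.lt
  have h10 := he.regL
  have hle := he.le
  refine .of_lt fun hw => ?_
  have hw12 := hw 12 (by norm_num)
  refine .seq (.assign (by norm_num) (by cases d <;> simp; omega) ?_)
  rw [show Expr.eval s (if d = true then .var 12 - .var 16 - 1 else .var 16) = i by
    rw [hi]; cases d <;> rfl]
  refine .seq (.assign (by norm_num) (he.ok_get (by simp) (by simp; omega)) ?_)
  refine .seq (.assign (by norm_num) (by simp) ?_)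
  generalize hs₁ : NatState.upd _ _ _ _ = s₁
  have hreg : ∀ r, r ≠ 17 → r ≠ 18 → r ≠ 19 → s₁.reg r = s.reg r := by
    intro r h₁ h₂ h₃
    rw [← hs₁]
    simp [h₁, h₂, h₃]
  have t10 : s₁.reg 10 = s.reg 10 := by apply hreg <;> norm_num
  have t11 : s₁.reg 11 = s.reg 11 := by apply hreg <;> norm_num
  have t13 : s₁.reg 13 = s.reg 13 := by apply hreg <;> norm_num
  have t14 : s₁.reg 14 = s.reg 14 := by apply hreg <;> norm_num
  have t17 : s₁.reg 17 = i := by rw [← hs₁]; simp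
  have t18 : s₁.reg 18 = p := by rw [← hs₁]; simp [h10, hp]
  have t19 : s₁.reg 19 = F.size := by rw [← hs₁]; simp [h10, hp, hsize]
  have tm : s₁.mem = s.mem := by rw [← hs₁]; simp
  have tt : s₁.time ≤ s.time + 40 := by rw [← hs₁]; cases d <;> simp
  clear hs₁
  refine .seq (Wp.mono (Q := fun s' => IsTab L T s'.mem (s'.reg 14) (join d A F) ∧
      s'.reg 10 = s.reg 10 ∧ s'.reg 17 = i ∧
      s'.reg 14 < s'.reg 13 ∧ s.reg 13 ≤ s'.reg 13 ∧ s'.reg 13 ≤ s.reg 13 + 4 * F.size + 1 ∧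
      Below L (s.reg 13) s.mem s'.mem ∧
      s'.time + 400000 * ((2 * T.size + 1) * A.size ^ 2) ≤
        s.time + 100 + 400000 * ((2 * T.size + 1) * (A.size + F.size) ^ 2)) ?_ ?_)
  swap
  · rintro s₂ ⟨hB, u10, u17, h₁, h₂, h₃, h₄, h₅⟩
    refine .write (he.ok_adE u10 (by simp [u17]; omega)) (by simp) ?_
    simp only [eval_adE, Expr.eval_lit, Expr.eval_add, Expr.eval_var, u10, h10, u17]
    exact ⟨hB.update (by omega) (by omega) (by omega) hle (by omega), h₁, h₂, h₃, ⟨_, h₄, rfl⟩,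
      by simp; omega⟩
  refine .ifLt (by simp; omega) (by simp) (fun hpos => ?_) (fun hzero => ?_)
  swap
  · simp [t19] at hzero
    obtain rfl : F = nil := by
      cases F with
      | nil => rfl
      | cons => simp at hzero
    refine .skip ?_
    have : join d A nil = A := by cases d <;> simp [join]
    simp [this, t10, t14, t13, t17, tm, hA, h14]
    exact ⟨.refl _ _ _, by omega⟩
  simp [t19] at hpos
  refine .seq (.assign (by norm_num) (by simp [t18]; omega) ?_)
  refine .seq (.assign (by norm_num) (by simp [t18, t19]; omega) ?_)
  generalize hs₂ : NatState.upd _ _ _ _ = s₂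
  have hreg : ∀ r, r ≠ 51 → r ≠ 52 → s₂.reg r = s₁.reg r := by
    intro r h₁ h₂
    rw [← hs₂]
    simp [h₁, h₂]
  have u10 : s₂.reg 10 = s.reg 10 := by rw [← t10]; apply hreg <;> norm_num
  have u11 : s₂.reg 11 = s.reg 11 := by rw [← t11]; apply hreg <;> norm_num
  have u13 : s₂.reg 13 = s.reg 13 := by rw [← t13]; apply hreg <;> norm_num
  have u14 : s₂.reg 14 = s.reg 14 := by rw [← t14]; apply hreg <;> norm_num
  have u17 : s₂.reg 17 = i := by rw [← t17]; apply hreg <;> norm_num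
  have u51 : s₂.reg 51 = p + 1 := by rw [← hs₂]; simp [t18]
  have u52 : s₂.reg 52 = p + 1 + 2 * F.size := by rw [← hs₂]; simp [t18, t19]
  have um : s₂.mem = s.mem := by rw [← hs₂]; simp [tm]
  have ut : s₂.time ≤ s.time + 70 := by rw [← hs₂]; simp; omega
  clear hs₂
  refine .seq ((wp_scan (F := F) (he.of_reg u10 u11) (by rwa [um]) (by rwa [um, u51])
    (by rw [u51, u52]) (by omega) (by omega) (by omega)
    (by rwa [um])).frame.mono fun s₃ ⟨hfr₃, hF₃, hF₃', hn₃, hn₃', hb₃, ht₃⟩ => ?_)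
  rw [u13] at hn₃ hn₃' hb₃
  rw [um] at hb₃
  have v10 : s₃.reg 10 = s.reg 10 := (hfr₃ 10 (by norm_num) (by decide)).trans u10
  have v11 : s₃.reg 11 = s.reg 11 := (hfr₃ 11 (by norm_num) (by decide)).trans u11
  have v14 : s₃.reg 14 = s.reg 14 := (hfr₃ 14 (by norm_num) (by decide)).trans u14
  have v17 : s₃.reg 17 = i := (hfr₃ 17 (by norm_num) (by decide)).trans u17
  have hA₃ := hb₃.isTab hA h14 hle (by omega)
  have hok : (Expr.get (adE 0 4 0)).Ok (wordCount w) s₃ := he.ok_get v10 (by simp; omega)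
  refine .seq (.assign (by norm_num) (by cases d; exacts [by simp, hok]) ?_)
  refine .seq (.assign (by norm_num) (by
    cases d
    · exact he.ok_get (by simp [v10]) (by simp; omega)
    · simp) ?_)
  refine .seq (.assign (by norm_num) (by simp) ?_)
  generalize hs₄ : NatState.upd _ _ _ _ = s₄
  have hreg : ∀ r, r ≠ 20 → r ≠ 21 → r ≠ 22 → s₄.reg r = s₃.reg r := by
    intro r h₁ h₂ h₃
    rw [← hs₄]
    simp [h₁, h₂, h₃]
  have x10 : s₄.reg 10 = s.reg 10 := by rw [← v10]; apply hreg <;> norm_num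
  have x11 : s₄.reg 11 = s.reg 11 := by rw [← v11]; apply hreg <;> norm_num
  have x17 : s₄.reg 17 = i := by rw [← v17]; apply hreg <;> norm_num
  have x20 : s₄.reg 20 = if d then s₃.mem (ad L 0 4 0) else s.reg 14 := by
    rw [← hs₄]; cases d <;> simp [v10, h10, v14]
  have x21 : s₄.reg 21 = if d then s.reg 14 else s₃.mem (ad L 0 4 0) := by
    rw [← hs₄]; cases d <;> simp [v10, h10, v14]
  have x22 : s₄.reg 22 = s₃.reg 13 := by rw [← hs₄]; simp
  have xm : s₄.mem = s₃.mem := by rw [← hs₄]; simp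
  have xt : s₄.time ≤ s₃.time + 40 := by rw [← hs₄]; cases d <;> simp
  clear hs₄
  have hconcat : Wp w concat (fun s' => IsTab L T s'.mem (s₄.reg 22) (join d A F) ∧
      Keeps L (s₄.reg 22) s₄.mem s'.mem ∧
      s'.time ≤ s₄.time + 10000 * ((2 * T.size + 1) * ((A.size + 1) * (F.size + 1)))) s₄ := by
    rw [Nat.mul_comm (A.size + 1)]
    cases d
    · rw [Nat.mul_comm (F.size + 1)]
      exact wp_concat (F := A) (G := F) (he.of_reg x10 x11) (by simpa [xm, x20]) (by simpa [xm, x21])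
        (by omega) (by omega) (by simp [x20]; omega) (by simp [x21]; omega) (by omega)
    · exact wp_concat (F := F) (G := A) (he.of_reg x10 x11) (by simpa [xm, x20])
        (by simpa [xm, x21]) (by omega) (by omega) (by simp [x20]; omega) (by simp [x21]; omega)
        (by omega)
  refine .seq (hconcat.frame.mono fun s₅ ⟨hfr₅, hB₅, hk₅, ht₅⟩ => ?_)
  have y10 : s₅.reg 10 = s.reg 10 := (hfr₅ 10 (by norm_num) (by decide)).trans x10
  have y17 : s₅.reg 17 = i := (hfr₅ 17 (by norm_num) (by decide)).trans x17
  have y22 : s₅.reg 22 = s₃.reg 13 := (hfr₅ 22 (by norm_num) (by decide)).trans x22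
  rw [x22] at hB₅ hk₅
  rw [xm] at hk₅
  refine .seq (.assign (by norm_num) (by simp) ?_)
  refine .assign (by norm_num) (by simp [y22]; omega) ?_
  simp [y10, y17, y22]
  refine ⟨hB₅, by omega, by omega, hb₃.trans (hk₅.below le_rfl) hn₃, ?_⟩
  -- a table of size `F` and its product with the old table take time `O(|F|² + |A| |F|)`
  have h₁ : 100000 * (F.size * F.size + F.size + 1) + 10000 * ((A.size + 1) * (F.size + 1)) + 100
      + 400000 * A.size ^ 2 ≤ 400000 * (A.size + F.size) ^ 2 := by
    obtain ⟨g, hg⟩ : ∃ g, F.size = g + 1 := ⟨F.size - 1, by omega⟩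
    rw [hg]
    exact Nat.le.intro (k := 790000 * (A.size * g) + 780000 * A.size + 300000 * g ^ 2 +
      490000 * g + 79900) (by ring)
  have h₂ := Nat.mul_le_mul_left (2 * T.size + 1) h₁
  have h₃ : (2 * T.size + 1) * (100000 * (F.size * F.size + F.size + 1) +
      10000 * ((A.size + 1) * (F.size + 1)) + 100 + 400000 * A.size ^ 2) =
      100000 * ((2 * T.size + 1) * (F.size * F.size + F.size + 1)) +
      10000 * ((2 * T.size + 1) * ((A.size + 1) * (F.size + 1))) + 100 * (2 * T.size + 1) +
      400000 * ((2 * T.size + 1) * A.size ^ 2) := by ring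
  have h₄ : (2 * T.size + 1) * (400000 * (A.size + F.size) ^ 2) =
      400000 * ((2 * T.size + 1) * (A.size + F.size) ^ 2) := by ring
  omega

/-- The sum of the first or, if `d` is true, of the last `t` forests. -/
def accum {α : Type*} (d : Bool) (Fs : List (Forest α)) (t : ℕ) : Forest α :=
  sum (if d then Fs.drop (Fs.length - t) else Fs.take t)

theorem index_lt {k t : ℕ} (d : Bool) (h : t < k) : index d k t < k := by
  cases d <;> simp [index] <;> omega

theorem accum_zero {α : Type*} (d : Bool) (Fs : List (Forest α)) : accum d Fs 0 = nil := by
  cases d <;> simp [accum, sum]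

theorem accum_succ {α : Type*} (d : Bool) {Fs : List (Forest α)} {t : ℕ} (h : t < Fs.length) :
    accum d Fs (t + 1) = join d (accum d Fs t) (Fs[index d Fs.length t]'(index_lt d h)) := by
  cases d
  · simp [accum, join, index, sum_take_succ h]
  · simp only [accum, join, index, if_true]
    rw [show Fs.length - (t + 1) = Fs.length - t - 1 by omega, sum_drop (by omega)]
    congr 3
    omega

theorem size_accum_le {α : Type*} (d : Bool) (Fs : List (Forest α)) (t : ℕ) :
    (accum d Fs t).size ≤ (sum Fs).size := by
  have h : ∀ i, (sum Fs).size = (sum (Fs.take i)).size + (sum (Fs.drop i)).size := fun i => by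
    rw [← size_add, ← sum_append, List.take_append_drop]
  cases d
  · have := h t
    simp only [accum, Bool.false_eq_true, if_false]
    omega
  · have := h (Fs.length - t)
    simp only [accum, if_true]
    omega

/-- Compute the tables of all prefix sums or, if `d` is true, of all suffix sums. -/
def build (d : Bool) : Program :=
  .seq readHeaders (.seq (assign 14 0) (.seq (assign 13 1) (.seq (assign 16 0)
    (.seq (forLt 16 12 (addForest d)) (write 0 (.var 10))))))

theorem wp_build {σ : ℕ} {T : Forest (Fin σ)} {Fs : List (Forest (Fin σ))} {L : ℕ}
    {s : NatState} (d : Bool) (hin : IsInput s.mem Fs T)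
    (hL : L = 2 * start T Fs Fs.length + 10) (hcap : (L + 1) * L * L ≤ wordCount w)
    (hzero : ∀ a, start T Fs Fs.length ≤ a → s.mem a = 0) (hk : Fs ≠ []) (hT : 0 < T.size) :
    Wp w (build d) (fun s' => s'.mem 0 = L ∧ s'.mem 1 = T.size ∧
      (∀ t < Fs.length, IsTab L T s'.mem (s'.mem (ad L 0 3 (index d Fs.length t + 1)))
        (accum d Fs (t + 1))) ∧
      s'.time ≤ s.time + 2000000 * (Fs.length + (sum Fs).size ^ 2 * T.size)) s := by
  have hk : 0 < Fs.length := List.length_pos_iff.2 hk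
  have hstart : start T Fs Fs.length = 2 + 2 * T.size + Fs.length + 2 * (sum Fs).size := by
    simp [start]
  refine .seq ((wp_readHeaders hin hL hcap).mono fun s₁ ⟨he, h12, hhdr, hm, ht⟩ => ?_)
  have hB := he.lt_pow
  refine .seq (.assign (by norm_num) (by simp; omega) ?_)
  refine .seq (.assign (by norm_num) (by simp; omega) ?_)
  refine .seq (.assign (by norm_num) (by simp; omega) ?_)
  generalize hs₂ : NatState.upd _ _ _ _ = s₂
  have u10 : s₂.reg 10 = s₁.reg 10 := by rw [← hs₂]; simp
  have u11 : s₂.reg 11 = s₁.reg 11 := by rw [← hs₂]; simp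
  have u12 : s₂.reg 12 = Fs.length := by rw [← hs₂]; simp [h12]
  have u13 : s₂.reg 13 = 1 := by rw [← hs₂]; simp
  have u14 : s₂.reg 14 = 0 := by rw [← hs₂]; simp
  have u16 : s₂.reg 16 = 0 := by rw [← hs₂]; simp
  have um : s₂.mem = s₁.mem := by rw [← hs₂]; simp
  have ut : s₂.time ≤ s₁.time + 20 := by rw [← hs₂]; simp
  clear hs₂
  have he₂ : Env w L (2 * T.size) s₂ := he.of_reg u10 u11
  have hX : s₁.mem (ad L 0 6 0) = 0 := by
    rw [hm _ _ (by omega) (by omega) (by omega), hzero]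
    simp [ad]
    omega
  have hset : ∀ r ∈ [10, 11, 12], Program.sets (.seq (addForest d) (assign 16 (.var 16 + 1))) r =
      false := by
    cases d <;> decide
  simp only [List.mem_cons, List.not_mem_nil, or_false, forall_eq_or_imp, forall_eq] at hset
  obtain ⟨hset10, hset11, hset12⟩ := hset
  refine .seq (Wp.forLt (fun t s' => IsTab L T s'.mem (s'.reg 14) (accum d Fs t) ∧
      s'.reg 14 < s'.reg 13 ∧ s'.reg 13 ≤ 1 + t + 4 * (accum d Fs t).size ∧
      (∀ t' < t, IsTab L T s'.mem (s'.mem (ad L 0 3 (index d Fs.length t' + 1)))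
        (accum d Fs (t' + 1)) ∧ s'.mem (ad L 0 3 (index d Fs.length t' + 1)) < s'.reg 13) ∧
      (∀ i x, i < L → x < L → (i = 0 ∨ i = 7 ∨ i = 6 ∧ x = 0) →
        s'.mem (ad L 0 i x) = s₁.mem (ad L 0 i x)) ∧
      s'.time ≤ s₂.time + 300 * t + 400000 * ((2 * T.size + 1) * (accum d Fs t).size ^ 2))
    (by norm_num) (by norm_num) (by norm_num) (by cases d <;> decide) (by cases d <;> decide)
    (by omega) ?_ ?_ ?_)
  · rw [u13, u14, u16, accum_zero]
    refine ⟨⟨by omega, by simp; omega, by simp, by rw [um, hX, size_nil], fun _ _ x h₁ h₂ => ?_⟩,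
      by omega, by simp, fun _ h => by omega, fun _ _ _ _ _ => by rw [um], by simp⟩
    simp at h₂
    omega
  · rintro t s₃ - htk ht16 hfr ⟨hA, h14, h13, hdone, hm₃, ht₃⟩
    rw [u12] at htk
    have v10 : s₃.reg 10 = s₁.reg 10 := (hfr 10 (by norm_num) hset10).trans u10
    have v11 : s₃.reg 11 = s₁.reg 11 := (hfr 11 (by norm_num) hset11).trans u11
    have v12 : s₃.reg 12 = Fs.length := (hfr 12 (by norm_num) hset12).trans u12
    have hidx := index_lt d htk
    set i := index d Fs.length t with hi
    have hsucc : accum d Fs (t + 1) = join d (accum d Fs t) Fs[i] := accum_succ d htk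
    have hsize := size_accum_le d Fs (t + 1)
    rw [hsucc, size_join] at hsize
    have hpos := start_succ T hidx
    have hpos' := start_mono T (Fs := Fs) (i := i + 1) hidx le_rfl
    have hin₃ : IsInput s₃.mem Fs T := hin.congr fun a ha => by
      have h₁ := hm₃ 0 a (by omega) (by omega) (by omega)
      have h₂ := hm 0 a (by omega) (by omega) (by omega)
      rw [ad_zero] at h₁ h₂
      rw [h₁, h₂]
    refine (wp_addForest (s := s₃.tick 5) (A := accum d Fs t) (F := Fs[i]) (i := i)
      (p := start T Fs i) d (he.of_reg v10 v11) hin₃.tree hA h14 (by simp; omega)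
      (by simp; omega) (by simp [v12, ht16, hi]) (by omega) ?_ (by omega) (hin₃.header i hidx)
      (hin₃.forest i hidx) ?_ (by omega)).mono ?_
    · rw [NatState.mem_tick, hm₃ _ _ (by omega) (by omega) (by omega), hhdr i hidx]
    · rw [NatState.mem_tick, hm₃ _ _ (by omega) (by omega) (by omega), hX]
    rintro s₄ ⟨hA₄, h14₄, h13₄, h13₄', ⟨mem', hb, hm₄⟩, ht₄⟩
    simp only [NatState.reg_tick, NatState.mem_tick, NatState.time_tick] at h13₄ h13₄' hb ht₄
    rw [hsucc, size_join]
    simp only [NatState.reg_upd, NatState.mem_upd, NatState.time_upd,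
      show (14 : ℕ) ≠ 16 by norm_num, show (13 : ℕ) ≠ 16 by norm_num, if_false]
    refine ⟨hA₄, h14₄, by omega, fun t' ht' => ?_, fun i' x hi' hx h => ?_, by omega⟩
    · have hlt : t' < Fs.length := by omega
      have hlt' := index_lt d hlt
      rw [hm₄, update_ad _ _ (by omega) (by omega) (by omega) (by omega)]
      rcases Nat.lt_or_eq_of_le (Nat.le_of_lt_succ ht') with ht' | rfl
      · have hne : index d Fs.length t' ≠ i := by
          rw [hi]
          cases d <;> simp [index] <;> omega
        rw [if_neg (by omega), hb _ _ _ (by omega) (by omega) (by omega) (by omega)]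
        obtain ⟨h₁, h₂⟩ := hdone t' ht'
        exact ⟨(hb.isTab h₁ h₂ he.le (by omega)).update (by omega) (by omega) (by omega) he.le
          (by omega), by omega⟩
      · rw [if_pos ⟨rfl, rfl, by rw [hi]⟩, hsucc, ← hm₄]
        exact ⟨hA₄, h14₄⟩
    · rw [hm₄, update_ad _ _ (by omega) (by omega) hi' hx, if_neg (by omega),
        hb _ _ _ hi' hx (by omega) (by omega), hm₃ i' x hi' hx h]
  · rintro s₃ - hfr ⟨hA, h14, h13, hdone, hm₃, ht₃⟩
    rw [u12] at hdone ht₃ h13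
    have v10 : s₃.reg 10 = L := (hfr 10 (by norm_num) hset10).trans (u10.trans he.regL)
    refine .write (by simp; omega) (by simp) ?_
    simp only [Expr.eval_lit, Expr.eval_var, NatState.reg_tick, NatState.mem_tick,
      NatState.mem_put, NatState.time_put, NatState.time_tick, v10]
    have hsize := size_accum_le d Fs Fs.length
    refine ⟨Function.update_self _ _ _, ?_, fun t ht => ?_, ?_⟩
    · have h₁ := hm₃ 0 1 (by omega) (by omega) (by omega)
      have h₂ := hm 0 1 (by omega) (by omega) (by omega)
      rw [ad_zero] at h₁ h₂
      rw [Function.update_of_ne (by norm_num), h₁, h₂, hin.size]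
    · have hlt' := index_lt d ht
      have := (hdone t ht).1.update (i := 0) (x := 0) (v := L) (by omega) (by omega) (by omega) he.le
        (by omega)
      rw [show Function.update s₃.mem 0 L = Function.update s₃.mem (ad L 0 0 0) L by rw [ad_zero],
        update_ad _ _ (by omega) (by omega) (by omega) (by omega),
        if_neg (by omega)]
      exact this
    · have h₁ : (accum d Fs Fs.length).size ^ 2 ≤ (sum Fs).size ^ 2 := Nat.pow_le_pow_left hsize 2
      have h₂ : (2 * T.size + 1) * (accum d Fs Fs.length).size ^ 2 ≤
          3 * T.size * (sum Fs).size ^ 2 := Nat.mul_le_mul (by omega) h₁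
      rw [show 3 * T.size * (sum Fs).size ^ 2 = 3 * ((sum Fs).size ^ 2 * T.size) by ring] at h₂
      simp
      omega

/-! ### Answering range queries -/

/-- The table determines the matrix. -/
theorem le_simMatrix_iff {α : Type*} [DecidableEq α] {F T : Forest α} {i j : Fin (2 * T.size + 1)}
    (x : ℕ) : (((x : ℤ) : WithBot ℤ) ≤ simMatrix F T i j) ↔ tab T F i x ≤ j := by
  rw [tab_le_iff (by omega), simMatrix]
  split_ifs with h
  · rw [WithBot.coe_le_coe, le_sim_iff h]
  · simp only [le_bot_iff, WithBot.coe_ne_bot, false_iff]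
    exact fun h' => h h'.le

theorem answers_of_wp {q : Program} {mem : BitVec w → BitVec w} {τ : ℕ} {x y z : BitVec w}
    {ok : BitVec w → Prop} {m : ℕ → ℕ} (hm : ∀ a, (mem a).toNat = m a.toNat)
    (hq : q.stores = false) (h : ∀ s : NatState, s.mem = m → s.reg 0 = x.toNat →
      s.reg 1 = y.toNat → s.reg 2 = z.toNat → s.time = 0 →
      Wp w q (fun s' => s'.time ≤ τ ∧ ∀ v : BitVec w, v.toNat = s'.reg 0 → ok v) s) :
    Answers q mem τ x y z ok := by
  rintro σ rfl rfl rfl rfl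
  obtain ⟨t, σ', s', h₁, h₂, h₃, h₄, h₅⟩ := h ⟨fun r => (σ.reg r).toNat, m, 0⟩ rfl rfl rfl rfl rfl
    σ ⟨fun _ _ => rfl, hm⟩
  exact ⟨t, σ', h₁, by simp only at h₃; omega, h₁.mem_eq hq, h₅ _ (h₂.1 0 (by norm_num))⟩

/-- The memory is as it is left for queries on the similarity matrix with number `l`, which is that
of `F`. -/
structure IsReady {α : Type*} [DecidableEq α] (w L : ℕ) (T : Forest α) (mem : ℕ → ℕ) (l : ℕ)
    (F : Forest α) : Prop where
  width : mem 0 = L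
  size : mem 1 = T.size
  lt : l < L
  tab : IsTab L T mem (mem (ad L 0 3 l)) F
  le : 10 ≤ L
  size_lt : 2 * T.size + 5 < L
  cap : (L + 1) * L * L ≤ wordCount w

/-- Put the block of the table of the matrix with the number in register `0` into register `63`. -/
def enter : Program :=
  .seq (assign 10 (.get 0)) (.seq (assign 11 (2 * .get 1)) (assign 63 (.get (adE 0 3 (.var 0)))))

theorem Wp.enter {α : Type*} [DecidableEq α] {T F : Forest α} {L : ℕ} {Q : NatState → Prop}
    {s : NatState} (h : IsReady w L T s.mem (s.reg 0) F)
    (hQ : ∀ s', Env w L (2 * T.size) s' → s'.mem = s.mem →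
      (∀ r, r ≠ 10 → r ≠ 11 → r ≠ 63 → s'.reg r = s.reg r) →
      IsTab L T s'.mem (s'.reg 63) F → s'.time ≤ s.time + 50 → Q s') : Wp w enter Q s := by
  obtain ⟨h0, h1, hl, htab, hle, hlt, hcap⟩ := h
  have he₀ : Env w L (2 * T.size) ((s.upd 10 L 0).upd 11 (2 * T.size) 0) :=
    ⟨by simp, by simp, hle, hlt, hcap⟩
  have hB := he₀.lt_pow
  refine .seq (.assign (by norm_num) (by simp; omega) ?_)
  refine .seq (.assign (by norm_num) (by simp [h1]; omega) ?_)
  refine .assign (by norm_num) (he₀.ok_get (by simp [h0]) (by simp; omega)) ?_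
  refine hQ _ ⟨by simp [h0], by simp [h1], hle, hlt, hcap⟩ rfl (fun r h₁ h₂ h₃ => ?_) ?_ (by simp)
  · simp [h₁, h₂, h₃]
  · simpa [h0] using htab

/-- Find the last number in the range from `0` to the register `64` for which the value that `body`
computes in register `62` is at most register `65`.  The number is passed to `body` in register
`61`, and the result is in register `60`. -/
def search (body : Program) : Program :=
  whileLt (.var 60 + 1) (.var 64) (.seq (assign 61 ((.var 60 + .var 64) / 2))
    (.seq body (ifLt (.var 65) (.var 62) (assign 64 (.var 61)) (assign 60 (.var 61)))))

theorem wp_search {body : Program} {g : ℕ → ℕ} {s : NatState} (h60 : s.reg 60 = 0)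
    (h64 : 0 < s.reg 64) (hw : 2 * s.reg 64 < wordCount w)
    (hb : ∀ r ∈ [60, 61, 64, 65], body.sets r = false)
    (hbody : ∀ s', Frame (search body) s s' → s'.mem = s.mem → s'.reg 61 < s.reg 64 →
      Wp w body (fun s'' => s''.mem = s'.mem ∧ s''.reg 62 = g (s'.reg 61) ∧
        s''.time ≤ s'.time + 60) s') :
    Wp w (search body) (fun s' => s'.reg 60 < s.reg 64 ∧
      (s'.reg 60 = 0 ∨ g (s'.reg 60) ≤ s.reg 65) ∧
      (s'.reg 60 + 1 = s.reg 64 ∨ s.reg 65 < g (s'.reg 60 + 1)) ∧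
      s'.time ≤ s.time + 200 * (Nat.log 2 (s.reg 64) + 2)) s := by
  simp only [List.mem_cons, List.not_mem_nil, or_false, forall_eq_or_imp, forall_eq] at hb
  obtain ⟨hb60, hb61, hb64, hb65⟩ := hb
  have hset65 : (Program.seq (assign 61 ((.var 60 + .var 64) / 2))
    (.seq body (ifLt (.var 65) (.var 62) (assign 64 (.var 61)) (assign 60 (.var 61))))).sets 65 =
      false := by
    simp [sets_seq, sets_assign, sets_ifLt, hb65]
  refine Wp.whileLt (fun s' => s'.mem = s.mem ∧ s'.reg 60 < s'.reg 64 ∧ s'.reg 64 ≤ s.reg 64 ∧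
      (s'.reg 60 = 0 ∨ g (s'.reg 60) ≤ s.reg 65) ∧
      (s'.reg 64 = s.reg 64 ∨ s.reg 65 < g (s'.reg 64)) ∧
      ∃ j, (s'.reg 64 - s'.reg 60 - 1) * 2 ^ j ≤ s.reg 64 ∧ j ≤ Nat.log 2 (s.reg 64) + 1 ∧
        s'.time ≤ s.time + 200 * j) (fun s' => s'.reg 64 - s'.reg 60) ?_ ?_ ?_ ?_
  · exact ⟨rfl, by omega, le_rfl, .inl h60, .inl rfl, 0, by simp; omega, by omega, by omega⟩
  · rintro s' - ⟨-, h₁, h₂, -⟩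
    exact ⟨by simp; omega, by simp⟩
  · rintro s₁ hfr ⟨hm, h₁, h₂, hlo, hhi, j, hj, hjL, ht⟩ hlt
    simp only [Expr.eval_add, Expr.eval_var, Expr.eval_lit] at hlt
    have r65 : s₁.reg 65 = s.reg 65 := hfr 65 (by norm_num) hset65
    refine .seq (.assign (by norm_num) (by simp; omega) ?_)
    generalize hs₂ : NatState.upd _ _ _ _ = s₂
    have hreg : ∀ r, r ≠ 61 → s₂.reg r = s₁.reg r := by
      intro r h
      rw [← hs₂]
      simp [h]
    have t60 : s₂.reg 60 = s₁.reg 60 := hreg 60 (by norm_num)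
    have t64 : s₂.reg 64 = s₁.reg 64 := hreg 64 (by norm_num)
    have t65 : s₂.reg 65 = s.reg 65 := (hreg 65 (by norm_num)).trans r65
    have t61 : s₂.reg 61 = (s₁.reg 60 + s₁.reg 64) / 2 := by rw [← hs₂]; simp
    have tm : s₂.mem = s.mem := by rw [← hs₂]; simp [hm]
    have tt : s₂.time ≤ s₁.time + 50 := by rw [← hs₂]; simp
    clear hs₂
    refine .seq ((hbody s₂ (fun r hr hset => ?_) tm (by omega)).frame.mono
      fun s₃ ⟨hfr₃, hm₃, h62, ht₃⟩ => ?_)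
    · have hne : r ≠ 61 := by
        rintro rfl
        simp [search, sets_seq, sets_assign, sets_whileLt] at hset
      rw [hreg r hne]
      exact hfr r hr (by rwa [search, sets_whileLt _ _ _ hr] at hset)
    · have u60 : s₃.reg 60 = s₁.reg 60 := (hfr₃ 60 (by norm_num) hb60).trans t60
      have u64 : s₃.reg 64 = s₁.reg 64 := (hfr₃ 64 (by norm_num) hb64).trans t64
      have u65 : s₃.reg 65 = s.reg 65 := (hfr₃ 65 (by norm_num) hb65).trans t65
      -- the width of the interval, less one, is halved
      have hpow : 2 ^ j ≤ s.reg 64 :=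
        (Nat.le_mul_of_pos_left _ (by omega)).trans hj
      have hjL' : j ≤ Nat.log 2 (s.reg 64) := Nat.le_log_of_pow_le (by norm_num) hpow
      have hhalf : ∀ d, 2 * d ≤ s₁.reg 64 - s₁.reg 60 - 1 → d * 2 ^ (j + 1) ≤ s.reg 64 := by
        intro d hd
        refine le_trans ?_ hj
        rw [pow_succ, show d * (2 ^ j * 2) = 2 * d * 2 ^ j by ring]
        exact Nat.mul_le_mul_right _ hd
      have u61 : s₃.reg 61 = s₂.reg 61 := hfr₃ 61 (by norm_num) hb61
      refine .ifLt (by simp) (by simp) (fun hlt' => ?_) (fun hle' => ?_)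
      · simp only [Expr.eval_var, u65, h62] at hlt'
        refine .assign (by norm_num) (by simp) ?_
        simp [u60, u61, hm₃, tm]
        exact ⟨⟨by omega, by omega, hlo, .inr hlt', j + 1, hhalf _ (by omega), by omega, by omega⟩,
          by omega⟩
      · simp only [Expr.eval_var, u65, h62] at hle'
        refine .assign (by norm_num) (by simp) ?_
        simp [u64, u61, hm₃, tm]
        exact ⟨⟨by omega, h₂, .inr hle', hhi, j + 1, hhalf _ (by omega), by omega, by omega⟩,
          by omega⟩
  · rintro s₁ - ⟨-, h₁, h₂, hlo, hhi, j, hj, hjL, ht⟩ hge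
    simp only [Expr.eval_add, Expr.eval_var, Expr.eval_lit] at hge
    have : s₁.reg 60 + 1 = s₁.reg 64 := by omega
    refine ⟨by simp; omega, hlo, ?_, by simp; omega⟩
    simp only [NatState.reg_tick, this]
    exact hhi

theorem log_le_of_le_mul {x N : ℕ} (hN : 0 < N) (hx : x ≤ 16 * N) :
    Nat.log 2 x ≤ Nat.log 2 N + 4 := by
  refine (Nat.log_mono_right hx).trans ?_
  rw [show 16 * N = N * 2 * 2 * 2 * 2 by ring]
  repeat rw [Nat.log_mul_base (by norm_num) (by omega)]

/-- The program for the query `mincol`, which is a look into the table. -/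
def mincolQuery : Program :=
  .seq enter (ifLt 0 (.var 2)
    (.seq (assign 66 (.var 1 - 1)) (.seq (assign 61 (.var 2 - 1)) (.seq (look 63 66 61 62)
      (ifLt (.var 11) (.var 62) (assign 0 1) (assign 0 (.var 62 + 1))))))
    (assign 0 1))

theorem wp_mincolQuery {α : Type*} [DecidableEq α] {T F : Forest α} {L i x : ℕ} {s : NatState}
    (h : IsReady w L T s.mem (s.reg 0) F) (h1 : s.reg 1 = i + 1) (h2 : s.reg 2 = x) :
    Wp w mincolQuery (fun s' => s'.time ≤ s.time + 500 ∧
      s'.reg 0 = if x = 0 ∨ 2 * T.size < tab T F i (x - 1) then 1 else tab T F i (x - 1) + 1) s := by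
  refine .seq (.enter h fun s₁ he hm hreg htab ht => ?_)
  have hB := he.lt_pow
  have hE := he.regE
  have hlt := he.lt
  have t1 : s₁.reg 1 = i + 1 := (hreg 1 (by norm_num) (by norm_num) (by norm_num)).trans h1
  have t2 : s₁.reg 2 = x := (hreg 2 (by norm_num) (by norm_num) (by norm_num)).trans h2
  refine .ifLt (by simp; omega) (by simp) (fun hpos => ?_) (fun hzero => ?_)
  · simp [t2] at hpos
    refine .seq (.assign (by norm_num) (by simp [t1]; omega) ?_)
    refine .seq (.assign (by norm_num) (by simp [t2]; omega) ?_)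
    refine .seq (.look (F := F) (he.of_reg (by simp) (by simp)) (by norm_num) (by norm_num)
      (by norm_num) (by norm_num) (by simpa using htab) ?_)
    refine .ifAssign (if 2 * T.size < tab T F i (x - 1) then 1 else tab T F i (x - 1) + 1)
      (by norm_num) (by simp) (by simp) (fun h => ?_) (fun h => ?_) ?_
    · simp [t1, t2, hE] at h
      simp [h]
      omega
    · simp [t1, t2, hE] at h
      simp [t1, t2, not_lt.2 h]
      omega
    · simp [show x ≠ 0 by omega]
      omega
  · simp [t2] at hzero
    refine .assign (by norm_num) (by simp; omega) ?_
    simp [hzero]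
    omega

/-- The program for the query for an entry: by binary search for the greatest number that is at
most the entry. -/
def entryQuery : Program :=
  .seq enter (ifLt (.var 2) (.var 1) (assign 0 0)
    (.seq (assign 66 (.var 1 - 1)) (.seq (assign 65 (.var 2 - 1)) (.seq (assign 60 0)
      (.seq (assign 64 (.get (adE 0 6 (.var 63)) + 1)) (.seq (search (look 63 66 61 62))
      (assign 0 (.var 60 + 1))))))))

theorem wp_entryQuery {α : Type*} [DecidableEq α] {T F : Forest α} {L N i j : ℕ} {s : NatState}
    (h : IsReady w L T s.mem (s.reg 0) F) (hN : L ≤ 16 * N) (hN0 : 0 < N)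
    (h1 : s.reg 1 = i + 1) (h2 : s.reg 2 = j + 1) (hj : j ≤ 2 * T.size) :
    Wp w entryQuery (fun s' => s'.time ≤ s.time + 200 * (Nat.log 2 N + 10) ∧
      (j < i → s'.reg 0 = 0) ∧ (i ≤ j → ∃ x, s'.reg 0 = x + 1 ∧ tab T F i x ≤ j ∧
        j < tab T F i (x + 1))) s := by
  refine .seq (.enter h fun s₁ he hm hreg htab ht => ?_)
  have hB := he.lt_pow
  have hE := he.regE
  have hlt := he.lt
  have h10 := he.regL
  have hle := he.le
  have hFL := htab.size_lt
  have hXF := htab.size_eq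
  have h63 := htab.lt
  have t1 : s₁.reg 1 = i + 1 := (hreg 1 (by norm_num) (by norm_num) (by norm_num)).trans h1
  have t2 : s₁.reg 2 = j + 1 := (hreg 2 (by norm_num) (by norm_num) (by norm_num)).trans h2
  refine .ifLt (by simp) (by simp) (fun hji => ?_) (fun hij => ?_)
  · simp [t1, t2] at hji
    refine .assign (by norm_num) (by simp; omega) ?_
    simp
    omega
  simp [t1, t2] at hij
  refine .seq (.assign (by norm_num) (by simp [t1]; omega) ?_)
  refine .seq (.assign (by norm_num) (by simp [t2]; omega) ?_)
  refine .seq (.assign (by norm_num) (by simp; omega) ?_)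
  refine .seq (.assign (by norm_num) ?_ ?_)
  · refine (Expr.ok_add ..).2 ⟨he.ok_get (by simp) (by simp; omega), by simp; omega, ?_⟩
    simp [h10, hXF]
    omega
  generalize hs₂ : NatState.upd _ _ _ _ = s₂
  have u10 : s₂.reg 10 = s₁.reg 10 := by rw [← hs₂]; simp
  have u11 : s₂.reg 11 = s₁.reg 11 := by rw [← hs₂]; simp
  have u60 : s₂.reg 60 = 0 := by rw [← hs₂]; simp
  have u63 : s₂.reg 63 = s₁.reg 63 := by rw [← hs₂]; simp
  have u64 : s₂.reg 64 = 2 * F.size + 1 := by rw [← hs₂]; simp [h10, hXF]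
  have u65 : s₂.reg 65 = j := by rw [← hs₂]; simp [t2]
  have u66 : s₂.reg 66 = i := by rw [← hs₂]; simp [t1]
  have um : s₂.mem = s₁.mem := by rw [← hs₂]; simp
  have ut : s₂.time ≤ s.time + 100 := by rw [← hs₂]; simp; omega
  clear hs₂
  refine .seq ((wp_search (g := fun x => tab T F i x) u60 (by omega) (by omega) (by decide)
    fun s₃ hfr hm₃ _ => ?_).mono fun s₃ ⟨h₁, h₂, h₃, ht₃⟩ => ?_)
  · have f (r : ℕ) (hr : r < 100) (h : (search (look 63 66 61 62)).sets r = false) := hfr r hr h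
    have v63 := (f 63 (by norm_num) (by decide)).trans u63
    have v66 := (f 66 (by norm_num) (by decide)).trans u66
    refine .look (F := F) (he.of_reg ((f 10 (by norm_num) (by decide)).trans u10)
      ((f 11 (by norm_num) (by decide)).trans u11)) (by norm_num) (by norm_num) (by norm_num)
      (by norm_num) (by rwa [hm₃, um, v63]) ?_
    simp [v66]
  · refine .assign (by norm_num) (by simp; omega) ?_
    have hlog := log_le_of_le_mul hN0 (x := s₂.reg 64) (by omega)
    refine ⟨by simp; omega, fun h => by omega, fun _ => ⟨s₃.reg 60, by simp, ?_, ?_⟩⟩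
    · rcases h₂ with h₂ | h₂
      · rw [h₂, tab_zero F (by omega)]
        omega
      · rwa [u65] at h₂
    · rcases h₃ with h₃ | h₃
      · rw [h₃, u64, tab_of_size_lt T _ (by omega)]
        omega
      · rwa [u65] at h₃

/-- The program for the query `maxrow`, by binary search: the entries of a column of the matrix
decrease. -/
def maxrowQuery : Program :=
  .seq enter (ifLt 0 (.var 2)
    (.seq (assign 66 (.var 2 - 1)) (.seq (assign 65 (.var 1 - 1)) (.seq (assign 60 0)
      (.seq (assign 64 (.var 11 + 1)) (.seq (search (look 63 61 66 62))
      (assign 0 (.var 60 + 1)))))))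
    (assign 0 (.var 11 + 1)))

theorem wp_maxrowQuery {α : Type*} [DecidableEq α] {T F : Forest α} {L N j x : ℕ} {s : NatState}
    (h : IsReady w L T s.mem (s.reg 0) F) (hN : L ≤ 16 * N) (hN0 : 0 < N)
    (h1 : s.reg 1 = j + 1) (h2 : s.reg 2 = x) :
    Wp w maxrowQuery (fun s' => s'.time ≤ s.time + 200 * (Nat.log 2 N + 10) ∧
      (x = 0 → s'.reg 0 = 2 * T.size + 1) ∧ (0 < x → ∃ i ≤ 2 * T.size, s'.reg 0 = i + 1 ∧
        (i = 0 ∨ tab T F i (x - 1) ≤ j) ∧ (i = 2 * T.size ∨ j < tab T F (i + 1) (x - 1)))) s := by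
  refine .seq (.enter h fun s₁ he hm hreg htab ht => ?_)
  have hB := he.lt_pow
  have hE := he.regE
  have hlt := he.lt
  have t1 : s₁.reg 1 = j + 1 := (hreg 1 (by norm_num) (by norm_num) (by norm_num)).trans h1
  have t2 : s₁.reg 2 = x := (hreg 2 (by norm_num) (by norm_num) (by norm_num)).trans h2
  refine .of_lt fun hw => ?_
  have hw1 := hw 1 (by norm_num)
  refine .ifLt (by simp; omega) (by simp) (fun hpos => ?_) (fun hzero => ?_)
  swap
  · simp [t2] at hzero
    refine .assign (by norm_num) (by simp [hE]; omega) ?_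
    simp [hzero, hE]
    omega
  simp [t2] at hpos
  refine .seq (.assign (by norm_num) (by simp [t2]; omega) ?_)
  refine .seq (.assign (by norm_num) (by simp [t1]; omega) ?_)
  refine .seq (.assign (by norm_num) (by simp; omega) ?_)
  refine .seq (.assign (by norm_num) (by simp [hE]; omega) ?_)
  generalize hs₂ : NatState.upd _ _ _ _ = s₂
  have u10 : s₂.reg 10 = s₁.reg 10 := by rw [← hs₂]; simp
  have u11 : s₂.reg 11 = s₁.reg 11 := by rw [← hs₂]; simp
  have u60 : s₂.reg 60 = 0 := by rw [← hs₂]; simp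
  have u63 : s₂.reg 63 = s₁.reg 63 := by rw [← hs₂]; simp
  have u64 : s₂.reg 64 = 2 * T.size + 1 := by rw [← hs₂]; simp [hE]
  have u65 : s₂.reg 65 = j := by rw [← hs₂]; simp [t1]
  have u66 : s₂.reg 66 = x - 1 := by rw [← hs₂]; simp [t2]
  have um : s₂.mem = s₁.mem := by rw [← hs₂]; simp
  have ut : s₂.time ≤ s.time + 100 := by rw [← hs₂]; simp; omega
  clear hs₂
  refine .seq ((wp_search (g := fun i => tab T F i (x - 1)) u60 (by omega) (by omega) (by decide)
    fun s₃ hfr hm₃ _ => ?_).mono fun s₃ ⟨h₁, h₂, h₃, ht₃⟩ => ?_)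
  · have f (r : ℕ) (hr : r < 100) (h : (search (look 63 61 66 62)).sets r = false) := hfr r hr h
    have v63 := (f 63 (by norm_num) (by decide)).trans u63
    have v66 := (f 66 (by norm_num) (by decide)).trans u66
    refine .look (F := F) (he.of_reg ((f 10 (by norm_num) (by decide)).trans u10)
      ((f 11 (by norm_num) (by decide)).trans u11)) (by norm_num) (by norm_num) (by norm_num)
      (by norm_num) (by rwa [hm₃, um, v63]) ?_
    simp [v66]
  · refine .assign (by norm_num) (by simp; omega) ?_
    have hlog := log_le_of_le_mul hN0 (x := s₂.reg 64) (by omega)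
    rw [u64] at h₁ h₃
    rw [u65] at h₂ h₃
    exact ⟨by simp; omega, fun h => by omega, fun _ => ⟨s₃.reg 60, by omega, by simp, h₂,
      h₃.imp (fun h => by omega) id⟩⟩

/-! ### The data structure -/

theorem le_of_mem_encodeForest {σ : ℕ} {F : Forest (Fin σ)} {x : ℕ} (h : x ∈ encodeForest F) :
    x ≤ σ := by
  induction F with
  | nil => simp [encodeForest] at h
  | cons a c s ihc ihs =>
    simp only [encodeForest, List.mem_cons, List.mem_append] at h
    rcases h with rfl | h | rfl | h
    · exact a.isLt
    · exact ihc h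
    · exact Nat.zero_le _
    · exact ihs h

theorem size_le_of_mem {α : Type*} {F : Forest α} {Fs : List (Forest α)} (h : F ∈ Fs) :
    F.size ≤ (sum Fs).size := by
  induction Fs with
  | nil => simp at h
  | cons G Fs ih =>
    simp only [sum, size_add]
    rcases List.mem_cons.1 h with rfl | h
    · omega
    · have := ih h
      omega

theorem getD_encodeInput_lt {σ B : ℕ} {Fs : List (Forest (Fin σ))} {T : Forest (Fin σ)}
    (hσ : σ < B) (hB : Fs.length + (sum Fs).size + T.size < B) (a : ℕ) :
    (encodeInput Fs T).getD a 0 < B := by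
  have h : ∀ x ∈ encodeInput Fs T, x < B := by
    intro x hx
    simp only [encodeInput, List.mem_cons, List.mem_append, List.mem_flatMap] at hx
    rcases hx with rfl | rfl | hx | ⟨F, hF, rfl | hx⟩
    · omega
    · omega
    · exact (le_of_mem_encodeForest hx).trans_lt hσ
    · have := size_le_of_mem hF
      omega
    · exact (le_of_mem_encodeForest hx).trans_lt hσ
  rcases lt_or_ge a (encodeInput Fs T).length with ha | ha
  · rw [List.getD_eq_getElem _ _ ha]
    exact h _ (List.getElem_mem ha)
  · rw [List.getD_eq_default _ _ ha]
    omega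

theorem decodeValue_of_toNat {v : BitVec w} {x : ℕ} (h : v.toNat = x + 1) :
    decodeValue v = ((x : ℤ) : WithBot ℤ) := by
  simp [decodeValue, h]

theorem toNat_indexWord {N : ℕ} (h : N < 2 ^ w) (i : Fin N) : (indexWord w i).toNat = i + 1 := by
  rw [indexWord, BitVec.toNat_ofNat, Nat.mod_eq_of_lt (by omega)]

theorem decodeValue_cases (v : BitVec w) :
    v.toNat = 0 ∧ decodeValue v = ⊥ ∨
      0 < v.toNat ∧ decodeValue v = (((v.toNat - 1 : ℕ) : ℤ) : WithBot ℤ) := by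
  rcases Nat.eq_zero_or_pos v.toNat with h | h
  · exact .inl ⟨h, by simp [decodeValue, h]⟩
  · exact .inr ⟨h, decodeValue_of_toNat (by omega)⟩

theorem represents_of_isReady {α : Type*} [DecidableEq α] {T : Forest α} {L N k τ : ℕ}
    {mem : BitVec w → BitVec w} {m : ℕ → ℕ} {G : ℕ → Forest α}
    (hm : ∀ a, (mem a).toNat = m a.toNat) (hN : L ≤ 16 * N) (hN0 : 0 < N) (hL : L < 2 ^ w)
    (hG : ∀ l, 1 ≤ l → l ≤ k → IsReady w L T m l (G l))
    (hτ : 200 * (Nat.log 2 N + 10) ≤ τ) :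
    Represents entryQuery mincolQuery maxrowQuery τ mem k fun l => (G l).simMatrix T := by
  intro l hl hlk
  have hr := hG l hl hlk
  have hTL := hr.size_lt
  have hlL := hr.lt
  have hidx : ∀ i : Fin (2 * T.size + 1), (indexWord w i).toNat = i + 1 :=
    toNat_indexWord (by omega)
  have hl' : (BitVec.ofNat w l).toNat = l := by
    rw [BitVec.toNat_ofNat, Nat.mod_eq_of_lt (by omega)]
  have heq : ∀ (v : BitVec w) (i : Fin (2 * T.size + 1)), v.toNat = i + 1 → v = indexWord w i :=
    fun v i h => BitVec.eq_of_toNat_eq (by rw [h, hidx])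
  have hready : ∀ s : NatState, s.mem = m → s.reg 0 = (BitVec.ofNat w l).toNat →
      IsReady w L T s.mem (s.reg 0) (G l) := fun s h₁ h₂ => by rwa [h₁, h₂, hl']
  refine ⟨fun i j => ?_, fun i x => ?_, fun j x => ?_⟩
  · refine answers_of_wp hm (by decide) fun s hs h0 h1 h2 ht => ?_
    refine (wp_entryQuery (N := N) (hready s hs h0) hN hN0 (h1.trans (hidx i))
      (h2.trans (hidx j)) (by omega)).mono fun s' ⟨ht', hlt, hle⟩ => ⟨by omega, fun v hv => ?_⟩
    rcases lt_or_ge (j : ℕ) i with hij | hij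
    · have hnot : ¬ i ≤ j := not_le.2 hij
      have : v.toNat = 0 := hv.trans (hlt hij)
      simp [decodeValue, this, simMatrix, hnot]
    · obtain ⟨y, hy, h₁, h₂⟩ := hle hij
      rw [decodeValue_of_toNat (hv.trans hy)]
      have h₁' := (le_simMatrix_iff (i := i) (j := j) y).2 h₁
      have h₂' := (not_congr (le_simMatrix_iff (i := i) (j := j) (F := G l) (y + 1))).2 (by omega)
      have hij' : i ≤ j := hij
      simp only [simMatrix, hij', if_true, WithBot.coe_le_coe, WithBot.coe_inj] at h₁' h₂' ⊢
      push_cast at h₂'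
      omega
  · refine answers_of_wp hm (by decide) fun s hs h0 h1 h2 ht => ?_
    refine (wp_mincolQuery (hready s hs h0) (h1.trans (hidx i)) h2).mono
      fun s' ⟨ht', hres⟩ => ⟨by omega, fun v hv => ?_⟩
    rw [← hv] at hres
    rcases decodeValue_cases x with ⟨hx, hdec⟩ | ⟨hx, hdec⟩
    · refine ⟨0, heq _ _ (by simpa [hx] using hres), fun _ => ⟨?_, fun _ _ => Fin.zero_le _⟩⟩
      simp [hdec]
    · split_ifs at hres with hif
      · refine ⟨0, heq _ _ (by simpa using hres), ?_⟩
        rintro ⟨j, hj⟩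
        rw [hdec, le_simMatrix_iff] at hj
        omega
      · have ht := tab_le T (G l) i (x.toNat - 1)
        refine ⟨⟨tab T (G l) i (x.toNat - 1), by omega⟩, heq _ _ hres, fun _ => ⟨?_, fun j hj => ?_⟩⟩
        · rw [Set.mem_ofPred_eq, hdec, le_simMatrix_iff]
        · rw [Set.mem_ofPred_eq, hdec, le_simMatrix_iff] at hj
          exact hj
  · refine answers_of_wp hm (by decide) fun s hs h0 h1 h2 ht => ?_
    refine (wp_maxrowQuery (N := N) (hready s hs h0) hN hN0 (h1.trans (hidx j)) h2).mono
      fun s' ⟨ht', hzero, hpos⟩ => ⟨by omega, fun v hv => ?_⟩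
    rcases decodeValue_cases x with ⟨hx, hdec⟩ | ⟨hx, hdec⟩
    · refine ⟨Fin.last _, heq _ _ (hv.trans (hzero hx)), fun _ => ⟨?_, fun _ _ => Fin.le_last _⟩⟩
      simp [hdec]
    · obtain ⟨i, hi, hres, h₁, h₂⟩ := hpos hx
      -- the rows with an entry that is large enough form an initial segment
      have hanti : ∀ i i', i ≤ i' → tab T (G l) i' (x.toNat - 1) ≤ j →
          tab T (G l) i (x.toNat - 1) ≤ j := fun i i' hii h =>
        (tab_le_iff (by omega)).2 (((tab_le_iff (by omega)).1 h).mono hii le_rfl le_rfl)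
      refine ⟨⟨i, by omega⟩, heq _ _ (hv.trans hres), ?_⟩
      rintro ⟨i₀, hi₀⟩
      rw [hdec, le_simMatrix_iff] at hi₀
      refine ⟨?_, fun i' hi' => ?_⟩
      · rw [Set.mem_ofPred_eq, hdec, le_simMatrix_iff]
        rcases h₁ with rfl | h₁
        · exact hanti 0 i₀ (Nat.zero_le _) hi₀
        · exact h₁
      · rw [Set.mem_ofPred_eq, hdec, le_simMatrix_iff] at hi'
        rw [Fin.le_def]
        by_contra hlt
        have hlt : i + 1 ≤ i' := not_le.1 hlt
        have := hanti _ _ hlt hi'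
        omega

theorem simMatricesComputable (d : Bool) {H : ∀ {α : Type}, List (Forest α) → ℕ → Forest α}
    (hH : ∀ {α : Type} (Fs : List (Forest α)) (t : ℕ), t < Fs.length →
      H Fs (index d Fs.length t + 1) = accum d Fs (t + 1)) : SimMatricesComputable H := by
  -- the constant in the running times; the exponent of the word length need only be `15`
  obtain ⟨K, hK⟩ : ∃ K, 2000000 ≤ K := ⟨_, le_rfl⟩
  refine ⟨build d, entryQuery, mincolQuery, maxrowQuery, K, ?_⟩
  intro σ w Fs T hFs hT k n N hσ hw
  have hk : 0 < k := List.length_pos_iff.2 hFs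
  have hm : 0 < T.size := by
    obtain ⟨a, c, rfl⟩ := hT
    simp
  have hN : N = k + n + T.size := rfl
  have hpoly : K * (1 + Nat.log 2 N) ≤ polylog K N :=
    Nat.mul_le_mul_left K (Nat.le_self_pow (by omega) _)
  have hpoly' : K ≤ polylog K N := (Nat.le_mul_of_pos_right K (by omega)).trans hpoly
  obtain ⟨L, hL⟩ : ∃ L, L = 2 * start T Fs Fs.length + 10 := ⟨_, rfl⟩
  have hstart : start T Fs Fs.length = 2 + 2 * T.size + k + 2 * n := by simp [start, k, n]
  have hLN : L + 1 ≤ 16 * N := by omega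
  have hcap : (L + 1) * L * L ≤ wordCount w := by
    calc (L + 1) * L * L ≤ 16 * N * (16 * N) * (16 * N) :=
          Nat.mul_le_mul (Nat.mul_le_mul hLN (by omega)) (by omega)
      _ = 2 ^ 12 * N ^ 3 := by ring
      _ ≤ N ^ 12 * N ^ 3 := Nat.mul_le_mul_right _ (Nat.pow_le_pow_left (by omega) 12)
      _ = N ^ 15 := by ring
      _ ≤ N ^ K := Nat.pow_le_pow_right (by omega) (by omega)
      _ ≤ 2 ^ w := hw
  have hLw : L < wordCount w := by
    have : 11 * L ≤ (L + 1) * L := Nat.mul_le_mul_right L (by omega)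
    have : (L + 1) * L ≤ (L + 1) * L * L := Nat.le_mul_of_pos_right _ (by omega)
    omega
  have hbuild := wp_build (w := w) (s := ⟨fun _ => 0, fun a => (encodeInput Fs T).getD a 0, 0⟩) d
    (isInput_encodeInput Fs T) hL hcap
    (fun a ha => List.getD_eq_default _ _ (by rwa [length_encodeInput])) hFs hm
  obtain ⟨t, σ', s', hrun, hrel, ht, h0, h1, htab, ht'⟩ := hbuild (initial w (encodeInput Fs T))
    ⟨fun _ _ => by simp [initial], fun a => by
      rw [initial, BitVec.toNat_ofNat, Nat.mod_eq_of_lt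
        (getD_encodeInput_lt hσ (show k + n + T.size < wordCount w by omega) _)]⟩
  refine ⟨t, σ', hrun, ?_, ?_⟩
  · have h₁ : 2000000 * (k + n ^ 2 * T.size) ≤ polylog K N * (k + n ^ 2 * T.size) :=
      Nat.mul_le_mul_right _ (hK.trans hpoly')
    refine le_trans ?_ h₁
    have ht₂ : s'.time ≤ 0 + 2000000 * (k + n ^ 2 * T.size) := ht'
    have ht₁ : 0 + t ≤ s'.time := ht
    omega
  · refine represents_of_isReady hrel.2 (N := N) (L := L) (by omega) (by omega) hLw
      (fun l hl hlk => ?_) ?_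
    · obtain ⟨t, ht, rfl⟩ : ∃ t < k, l = index d k t + 1 := by
        refine ⟨index d k (l - 1), index_lt d (by omega), ?_⟩
        cases d <;> simp [index] <;> omega
      refine ⟨h0, h1, by omega, ?_, by omega, by omega, hcap⟩
      change IsTab L T s'.mem _ (H Fs (index d Fs.length t + 1))
      rw [hH Fs t ht]
      exact htab t ht
    · have : 2000000 * (1 + Nat.log 2 N) ≤ K * (1 + Nat.log 2 N) := Nat.mul_le_mul_right _ hK
      omega

end TED

theorem mainTheorem5 :
    TED.SimMatricesComputable TED.Forest.prefixSum ∧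
      TED.SimMatricesComputable TED.Forest.suffixSum := by
  refine ⟨TED.simMatricesComputable false fun Fs t ht => ?_,
    TED.simMatricesComputable true fun Fs t ht => ?_⟩
  · simp [TED.Forest.prefixSum, TED.accum, TED.index]
  · simp only [TED.Forest.suffixSum, TED.accum, TED.index, if_true]
    congr 2
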